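/- Knots are oriented knots in $S^3$ up to isotopy. For a knot $K$ with Seifert matrix $V$ let $\Delta(K)(t)=\det(t^{1/2}V-t^{-1/2}V^T)$ be its symmetrized Alexander polynomial, which is real on $S^1$, let $\mathrm{Div}_{\Delta(K)}=\{\rho\in S^1 : \Delta(K)(\rho)=0\}$, and let $\sigma_t(K)$, for $t\in S^1$, be the signature of the Hermitian matrix $(1-t)V+(1-\bar t)V^T$. The jump of the signature function at $\rho$ is $\lim_{h\to 0^+}\sigma_{\rho e^{ih}}(K)-\lim_{h\to 0^-}\sigma_{\rho e^{ih}}(K)$. The knot $K$ is simple if all roots of $\Delta(K)$ on $S^1$ are simple. For a planar projection of $K$ and a chosen crossing of sign $\epsilon\in\{+,-\}$, let $K^+$ and $K^-$ be the knots obtained by making this crossing positive respectively negative, so that $K=K^{\epsilon}$. For $\rho\in\mathrm{Div}_{\Delta(K)}$, the projection with its chosen crossing is called $(\rho,K)$-good if $\Delta(K^{-\epsilon})(\rho)\neq 0$. For a real analytic function $f$ near $a\in\mathbb R$ let $\operatorname{sgn}(f,a)$ be the sign of the first nonvanishing Taylor coefficient of $f$ at $a$, and $0$ if there is none; $\operatorname{sgn}(\Delta(K),\theta)$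 means $\operatorname{sgn}(f,\theta)$ for $f(x)=\Delta(K)(e^{ix})$. Theorem. There is a unique integer valued invariant $j$, defined for all simple knots $K$ and all $\rho\in\mathrm{Div}_{\Delta(K)}$, such that for every $(\rho,K)$-good projection and every $\theta\in\mathbb R$ with $\rho=e^{i\theta}$ $$j_\rho(K)=2\epsilon\,\operatorname{sgn}(\Delta(K^+),\theta)\,\operatorname{sgn}(\Delta(K^-),\theta).$$ This invariant is the jump function: the one-sided limits of the signature function of $K$ at $\rho$ exist and $j_\rho(K)$ is the jump at $\rho$. Moreover, for every simple knot $K$ and every $\rho\in\mathrm{Div}_{\Delta(K)}$ a $(\rho,K)$-good projection exists. -/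

import Mathlib

open scoped Polynomial Topology
open Filter

noncomputable section

/-!
## Oriented knot diagrams

An oriented diagram of a knot on the sphere is encoded by its signed Gauss code: walking once
along the knot one passes each crossing twice, once on the over-strand and once on the
under-strand. The code determines the diagram up to isotopy of the sphere, and a code comes from
a diagram on the sphere exactly when the ribbon surface that it determines has genus `0`.
-/

/-- A signed Gauss code with `n` crossings and one component. A passage `(c, true)` is the
over-passage of the crossing `c`, and `(c, false)` is its under-passage. `next p` is the passage
that follows `p` along the oriented knot. The edges of the underlying 4-valent graph are
identified with passages: the edge `p` runs from the passage `p` to the passage `next p`. -/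
structure GaussCode where
  n : ℕ
  next : Equiv.Perm (Fin n × Bool)
  sign : Fin n → ℤˣ
  one_component : ∀ p q, next.SameCycle p q

namespace GaussCode

variable (D : GaussCode)

/-- The passages of a Gauss code, which also index its edges. -/
abbrev Passage : Type := Fin D.n × Bool

/-- The other passage through the same crossing. -/
def other (p : D.Passage) : D.Passage := (p.1, !p.2)

/-- A person walking forward through the passage `p` sees the other strand of the crossing go from
the right to the left. At a positive crossing this is so on the over-strand,
at a negative one on the under-strand. -/
def otherGoesLeft (p : D.Passage) : Bool := p.2 == decide (D.sign p.1 = 1)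

/-- The next edge along the boundary of a face. The pair `(p, true)` stands for the edge `p`
walked forward, the pair `(p, false)` for the edge `p` walked backward, always with the face on
the left hand side. At the end of the edge one turns left. -/
def faceStep : D.Passage × Bool → D.Passage × Bool
  | (p, true) =>
      if D.otherGoesLeft (D.next p) then (D.other (D.next p), true)
      else (D.next.symm (D.other (D.next p)), false)
  | (p, false) =>
      if D.otherGoesLeft p then (D.next.symm (D.other p), false)
      else (D.other p, true)

/-- The faces: the orbits of `faceStep`. -/
def Face : Type := Quot fun d e : D.Passage × Bool => D.faceStep d = e

/-- The Gauss code is realized by a diagram on the sphere. There are `n` vertices and `2 n` edges,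
so the Euler characteristic is `2` exactly if there are `n + 2` faces. The code without crossings
is the round circle. -/
def Planar : Prop := D.n = 0 ∨ Nat.card D.Face = D.n + 2

/-- Exchange of the over- and under-passage of the crossing `c`. -/
def flip (c : Fin D.n) : Equiv.Perm D.Passage := Equiv.swap (c, true) (c, false)

/-- The crossing change at `c`: the over-strand becomes the under-strand and the sign changes. -/
def crossingChange (c : Fin D.n) : GaussCode where
  n := D.n
  next := D.flip c * D.next * (D.flip c)⁻¹
  sign := Function.update D.sign c (-D.sign c)
  one_component := fun p q => by
    rw [Equiv.Perm.sameCycle_conj]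
    exact D.one_component _ _

end GaussCode

/-- Oriented knot diagrams on the sphere. -/
structure KnotDiagram extends GaussCode where
  planar : toGaussCode.Planar

/-!
## Reidemeister moves and knots
-/

namespace GaussCode

/-- `D` arises from `E` by erasing the crossings in `S`: the crossings of `D` are the remaining
crossings of `E`, with the same signs, and are passed in the same order. -/
def IsErasure (E : GaussCode) (S : Set (Fin E.n)) (D : GaussCode) : Prop :=
  ∃ f : Fin D.n → Fin E.n, Function.Injective f ∧ Set.range f = Sᶜ ∧
    (∀ c, E.sign (f c) = D.sign c) ∧
    ∀ p : D.Passage, ∃ k : ℕ,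
      (E.next ^ (k + 1)) (f p.1, p.2) = (f (D.next p).1, (D.next p).2) ∧
      ∀ i < k, ((E.next ^ (i + 1)) (f p.1, p.2)).1 ∈ S

/-- First move, from `D` to `E`: `E` has an additional kink, with a crossing `c` of any sign. -/
def Move1 (D E : GaussCode) : Prop :=
  ∃ (c : Fin E.n) (b : Bool), E.next (c, b) = (c, !b) ∧ E.IsErasure {c} D

/-- Second move, from `D` to `E`: `E` has two additional crossings `a`, `b` of opposite sign, which
follow each other on the over-strand and, in one order or the other, on the under-strand.
In a planar code these two stretches bound a bigon. -/
def Move2 (D E : GaussCode) : Prop :=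
  ∃ a b : Fin E.n, a ≠ b ∧ E.sign a = -E.sign b ∧ E.next (a, true) = (b, true) ∧
    (E.next (a, false) = (b, false) ∨ E.next (b, false) = (a, false)) ∧
    E.IsErasure {a, b} D

/-- The passages `p` and `q` follow each other directly, in the order `p`, `q` if `s = 1`, and in
the order `q`, `p` if `s = -1`. -/
def Consecutive (D : GaussCode) (s : ℤˣ) (p q : D.Passage) : Prop :=
  if s = 1 then D.next p = q else D.next q = p

/-- Third move. The top and the middle strand cross at `a`, the top and the bottom strand at
`b`, the middle and the bottom strand at `c`; any two of these crossings follow each other directly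
on the strand that they share. The condition on the signs says that these three stretches bound a
triangular face: for oriented lines through the vertices `A, B, C` of a triangle with
orientation `τ = ± 1` the signs are `s * t * τ`, `s * u * τ` and `t * u * τ`, where `s`, `t`, `u`
tell whether the lines run from `A` to `B`, from `A` to `C`, from `B` to `C` or in reverse.
The move exchanges the two crossings on each of the strands and keeps the signs.
It includes a renumbering `e` of the crossings. -/
def Move3 (D E : GaussCode) : Prop :=
  ∃ (a b c : Fin D.n) (s t u : ℤˣ), a ≠ b ∧ a ≠ c ∧ b ≠ c ∧
    D.Consecutive s (a, true) (b, true) ∧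
    D.Consecutive t (a, false) (c, true) ∧
    D.Consecutive u (b, false) (c, false) ∧
    D.sign a * (s * t) = D.sign b * (s * u) ∧
    D.sign b * (s * u) = D.sign c * (t * u) ∧
    ∃ e : Fin D.n ≃ Fin E.n, (∀ x, E.sign (e x) = D.sign x) ∧
      let σ : Equiv.Perm D.Passage :=
        Equiv.swap (a, true) (b, true) * Equiv.swap (a, false) (c, true) *
          Equiv.swap (b, false) (c, false)
      ∀ p : D.Passage, E.next (e p.1, p.2) =
        (e ((σ * D.next * σ⁻¹) p).1, ((σ * D.next * σ⁻¹) p).2)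

/-- Renumbering of the crossings. -/
def Renumbering (D E : GaussCode) : Prop :=
  ∃ e : Fin D.n ≃ Fin E.n, (∀ x, E.sign (e x) = D.sign x) ∧
    ∀ p : D.Passage, E.next (e p.1, p.2) = (e (D.next p).1, (D.next p).2)

end GaussCode

/-- `D` and `E` differ by one Reidemeister move or by a renumbering of the crossings. -/
inductive ReidemeisterMove (D E : KnotDiagram) : Prop
  | renumber : D.Renumbering E.toGaussCode → ReidemeisterMove D E
  | move1 : D.Move1 E.toGaussCode → ReidemeisterMove D E
  | move2 : D.Move2 E.toGaussCode → ReidemeisterMove D E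
  | move3 : D.Move3 E.toGaussCode → ReidemeisterMove D E

/-- Oriented knots in the 3-sphere up to isotopy: oriented diagrams up to the equivalence relation
generated by Reidemeister moves. -/
def Knot : Type := Quot ReidemeisterMove

/-!
## Crossing changes in planar diagrams
-/

namespace GaussCode

lemma crossingChange_otherGoesLeft (D : GaussCode) (c : Fin D.n) (p : D.Passage) :
    (D.crossingChange c).otherGoesLeft (D.flip c p) = D.otherGoesLeft p := by
  obtain ⟨x, b⟩ := p
  by_cases h : x = c
  · subst h
    rcases Int.units_eq_one_or (D.sign x) with h | h <;> cases b <;>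
      simp [otherGoesLeft, flip, crossingChange, h]
  · have h1 : D.flip c (x, b) = (x, b) :=
      Equiv.swap_apply_of_ne_of_ne (by simp [h]) (by simp [h])
    rw [h1]
    simp [otherGoesLeft, crossingChange, Function.update_of_ne h]

lemma flip_other (D : GaussCode) (c : Fin D.n) (p : D.Passage) :
    D.flip c (D.other p) = D.other (D.flip c p) := by
  obtain ⟨x, b⟩ := p
  by_cases h : x = c
  · subst h
    cases b <;> simp [other, flip]
  · have h1 : ∀ b, D.flip c (x, b) = (x, b) := fun b =>
      Equiv.swap_apply_of_ne_of_ne (by simp [h]) (by simp [h])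
    simp [other, h1]

lemma crossingChange_faceStep (D : GaussCode) (c : Fin D.n) (d : D.Passage × Bool) :
    (D.crossingChange c).faceStep (D.flip c d.1, d.2) =
      (D.flip c (D.faceStep d).1, (D.faceStep d).2) := by
  have hn : ∀ p, (D.crossingChange c).next (D.flip c p) = D.flip c (D.next p) := fun p => by
    change (D.flip c * D.next * (D.flip c)⁻¹) (D.flip c p) = _
    simp
  have hs : ∀ p, (D.crossingChange c).next.symm (D.flip c p) = D.flip c (D.next.symm p) :=
    fun p => (Equiv.symm_apply_eq _).2 (by
      have h := hn (D.next.symm p)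
      rw [Equiv.apply_symm_apply] at h
      exact h.symm)
  have ho : ∀ p, (D.crossingChange c).other (D.flip c p) = D.flip c (D.other p) :=
    fun p => (D.flip_other c p).symm
  obtain ⟨p, _ | _⟩ := d
  · simp only [faceStep, crossingChange_otherGoesLeft, ho, hs]
    split_ifs <;> rfl
  · simp only [faceStep, hn, crossingChange_otherGoesLeft, ho, hs]
    split_ifs <;> rfl

lemma crossingChange_planar (D : GaussCode) (c : Fin D.n) (h : D.Planar) :
    (D.crossingChange c).Planar := by
  refine h.imp id fun h => ?_
  let e : D.Passage × Bool ≃ D.Passage × Bool := (D.flip c).prodCongr (Equiv.refl Bool)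
  have key : D.Face ≃ (D.crossingChange c).Face := Quot.congr e fun d d' => by
    change D.faceStep d = d' ↔
      (D.crossingChange c).faceStep (D.flip c d.1, d.2) = (D.flip c d'.1, d'.2)
    rw [crossingChange_faceStep]
    exact e.injective.eq_iff.symm
  exact (Nat.card_congr key).symm.trans h

end GaussCode

namespace KnotDiagram

/-- The diagram after the crossing change at `c`. -/
def crossingChange (D : KnotDiagram) (c : Fin D.n) : KnotDiagram where
  toGaussCode := D.toGaussCode.crossingChange c
  planar := D.toGaussCode.crossingChange_planar c D.planar

/-- The diagram with the crossing `c` replaced by a crossing of sign `ε`. -/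
def withSign (D : KnotDiagram) (c : Fin D.n) (ε : ℤˣ) : KnotDiagram :=
  if D.sign c = ε then D else D.crossingChange c

/-- The knot presented by a diagram. -/
def knot (D : KnotDiagram) : Knot := Quot.mk _ D

end KnotDiagram

/-!
## The Seifert matrix

Seifert's algorithm smooths every crossing according to the orientation, lets the resulting Seifert
circles bound disjoint discs, and joins these discs by one half-twisted band at every crossing.
With both strands of a crossing going up, the smoothed strand on the left enters along the edge
`leftIn` and leaves along the edge `leftOut`, and the band joins the left strand to the right one.

A 1-cycle on the surface minus the discs runs along the edges of the smoothed diagram and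
through the bands. It is given by its multiplicity on every edge: the multiplicity on the band at
`c`, from left to right, is the difference between `leftIn c` and `leftOut c`, and conservation
at the two ends of the band amounts to conservation at the crossing `c` of the 4-valent graph.
The cycles with multiplicity `0` on all bands are the combinations of Seifert circles. So
the first homology of the Seifert surface is the image of the cycles under `bandFlow`.
-/

namespace GaussCode

variable (D : GaussCode)

/-- The edge that enters the passage `p`. -/
def inEdge (p : D.Passage) : D.Passage := D.next.symm p

/-- The lower left edge of a crossing with both strands going up. -/
def leftIn (c : Fin D.n) : D.Passage :=
  if D.sign c = 1 then D.inEdge (c, true) else D.inEdge (c, false)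

/-- The upper left edge of a crossing with both strands going up. -/
def leftOut (c : Fin D.n) : D.Passage :=
  if D.sign c = 1 then (c, false) else (c, true)

/-- The integral 1-cycles on the 4-valent graph. -/
def cycles : Submodule ℤ (D.Passage → ℤ) where
  carrier := {x | ∀ c, x (D.inEdge (c, true)) + x (D.inEdge (c, false)) =
    x (c, true) + x (c, false)}
  add_mem' := fun {x y} hx hy c => by
    have h1 := hx c
    have h2 := hy c
    simp only [Pi.add_apply]
    linarith
  zero_mem' := fun c => by simp
  smul_mem' := fun r x hx c => by
    have h1 := hx c
    simp only [Pi.smul_apply, smul_eq_mul, ← mul_add, h1]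

/-- The multiplicities of a cycle on the bands, counted from left to right. -/
def bandFlow : (D.Passage → ℤ) →ₗ[ℤ] (Fin D.n → ℤ) where
  toFun x c := x (D.leftIn c) - x (D.leftOut c)
  map_add' x y := by
    ext c
    simp only [Pi.add_apply]
    ring
  map_smul' r x := by
    ext c
    simp only [Pi.smul_apply, smul_eq_mul, RingHom.id_apply]
    ring

/-- The first homology group of the Seifert surface. -/
def seifertHomology : Submodule ℤ (Fin D.n → ℤ) := D.cycles.map D.bandFlow

/-- The left edge of the under-strand of a crossing. -/
def leftUnderEdge (c : Fin D.n) : D.Passage :=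
  if D.sign c = 1 then D.leftOut c else D.leftIn c

/-- The Seifert form, that is the linking number of the cycle `x` with the push-off of `y` to the
positive side of the Seifert surface. The projections of `x` and of the push-off can be
arranged so that the push-off passes over `x` only where its part in a band starts at
the left end and, at a negative crossing, once more in the middle of the band. The first passages
contribute `x (leftOut c)` times, the others `bandFlow x c` times the multiplicity of `y` on the
band. Together this is the multiplicity of `x` on the edge `leftUnderEdge c` times that of `y` on
the band. -/
def seifertForm (x y : D.Passage → ℤ) : ℤ :=
  ∑ c, x (D.leftUnderEdge c) * D.bandFlow y c

/-- The rank of the first homology of the Seifert surface, which is twice the genus. -/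
def seifertRank : ℕ := Module.finrank ℤ D.seifertHomology

/-- A basis of the first homology of the Seifert surface. -/
def seifertBasis : Module.Basis (Fin D.seifertRank) ℤ D.seifertHomology :=
  Module.finBasis ℤ D.seifertHomology

/-- A cycle that represents the `i`-th basis element. -/
def seifertCycle (i : Fin D.seifertRank) : D.Passage → ℤ :=
  Classical.choose (D.seifertBasis i).2

/-- A Seifert matrix of the diagram. -/
def seifertMatrix : Matrix (Fin D.seifertRank) (Fin D.seifertRank) ℤ :=
  Matrix.of fun i j => D.seifertForm (D.seifertCycle i) (D.seifertCycle j)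

end GaussCode

/-!
## Alexander polynomial and signature function
-/

/-- The signature of a Hermitian matrix: the number of positive eigenvalues minus the number of
negative eigenvalues, with multiplicities. -/
def hermitianSignature {m : ℕ} {B : Matrix (Fin m) (Fin m) ℂ} (hB : B.IsHermitian) : ℤ :=
  ∑ i, (SignType.sign (hB.eigenvalues i) : ℤ)

/-- The matrix `(1 - t) V + (1 - t̄) Vᵀ`. -/
def tristramMatrix {m : ℕ} (V : Matrix (Fin m) (Fin m) ℤ) (t : ℂ) : Matrix (Fin m) (Fin m) ℂ :=
  (1 - t) • V.map (Int.cast : ℤ → ℂ) + (1 - star t) • (V.map (Int.cast : ℤ → ℂ)).transpose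

lemma tristramMatrix_isHermitian {m : ℕ} (V : Matrix (Fin m) (Fin m) ℤ) (t : ℂ) :
    (tristramMatrix V t).IsHermitian := by
  ext i j
  simp [tristramMatrix, Matrix.conjTranspose_apply]
  ring

namespace Knot

/-- A diagram of the knot `K`. The signature function and the Alexander polynomial
do not depend on its choice. -/
def diagram (K : Knot) : KnotDiagram := Quot.out K

/-- A Seifert matrix of the knot `K`. -/
def seifertMatrix (K : Knot) :
    Matrix (Fin K.diagram.seifertRank) (Fin K.diagram.seifertRank) ℤ :=
  K.diagram.seifertMatrix

/-- The polynomial `det (X V - Vᵀ)`, which is `t ^ g` times the symmetrized Alexander polynomial,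
where `g` is the genus of the Seifert surface. -/
def alexanderPolynomial (K : Knot) : ℤ[X] :=
  ((Polynomial.X : ℤ[X]) • K.seifertMatrix.map (Polynomial.C : ℤ →+* ℤ[X]) -
    (K.seifertMatrix.map (Polynomial.C : ℤ →+* ℤ[X])).transpose).det

/-- The values `Δ(K)(t) = det (t ^ (1/2) V - t ^ (-1/2) Vᵀ) = t ^ (-g) det (t V - Vᵀ)` of the
symmetrized Alexander polynomial, where `V` has size `2 g`. -/
def alexander (K : Knot) (t : ℂ) : ℂ :=
  t ^ (-((K.diagram.seifertRank / 2 : ℕ) : ℤ)) * Polynomial.aeval t K.alexanderPolynomial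

/-- The real function `θ ↦ Δ(K)(e ^ (i θ))`. The symmetrized Alexander polynomial is real on the
unit circle. -/
def alexanderAngle (K : Knot) (θ : ℝ) : ℝ := (K.alexander (Circle.exp θ)).re

/-- The set of roots of the Alexander polynomial on the unit circle. -/
def div (K : Knot) : Set Circle := {ρ | K.alexander ρ = 0}

/-- The roots of the Alexander polynomial on the unit circle are simple. -/
def IsSimple (K : Knot) : Prop :=
  ∀ ρ ∈ K.div,
    (K.alexanderPolynomial.map (Int.castRingHom ℂ)).rootMultiplicity (ρ : ℂ) = 1

/-- The signature function of the knot `K` on the unit circle. -/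
def signature (K : Knot) (t : Circle) : ℤ :=
  hermitianSignature (tristramMatrix_isHermitian K.seifertMatrix t)

/-- The signature function of `K` has one-sided limits at `ρ`, and the limit from the
counterclockwise side minus the limit from the clockwise side is `v`. -/
def HasSignatureJump (K : Knot) (ρ : Circle) (v : ℤ) : Prop :=
  ∃ a b : ℤ, Tendsto (fun h : ℝ => K.signature (ρ * Circle.exp h)) (𝓝[>] 0) (𝓝 a) ∧
    Tendsto (fun h : ℝ => K.signature (ρ * Circle.exp h)) (𝓝[<] 0) (𝓝 b) ∧ v = a - b

end Knot

/-!
## The skein formula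
-/

open Classical in
/-- The sign of a real analytic function `f` at `a`: the sign of the first nonvanishing Taylor
coefficient, and `0` if there is none. -/
def signAt (f : ℝ → ℝ) (a : ℝ) : ℤ :=
  if h : ∃ k, iteratedDeriv k f a ≠ 0 then (SignType.sign (iteratedDeriv (Nat.find h) f a) : ℤ)
  else 0

/-- The diagram `D` with the crossing `c` of sign `ε` is a `(ρ, K)`-good projection:
it is a diagram of `K = K^ε`, and the Alexander polynomial of `K^(-ε)` does not vanish at `ρ`. -/
def IsGoodProjection (K : Knot) (ρ : Circle) (D : KnotDiagram) (c : Fin D.n) : Prop :=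
  D.knot = K ∧ (D.withSign c (-D.sign c)).knot.alexander ρ ≠ 0

/-- Integer valued functions of a simple knot (up to isotopy) and a root of its Alexander
polynomial on the unit circle. -/
abbrev JumpInvariant : Type := ∀ K : Knot, K.IsSimple → K.div → ℤ

/-- The skein formula for all good projections. -/
def SatisfiesSkein (j : JumpInvariant) : Prop :=
  ∀ (K : Knot) (hK : K.IsSimple) (ρ : K.div) (D : KnotDiagram) (c : Fin D.n),
    IsGoodProjection K ρ D c → ∀ θ : ℝ, Circle.exp θ = ρ →
      j K hK ρ = 2 * ((D.sign c : ℤˣ) : ℤ) *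
        signAt (D.withSign c 1).knot.alexanderAngle θ *
        signAt (D.withSign c (-1)).knot.alexanderAngle θ

end

/-! The jump is computed with the Hermitian form `form`, which is `-i e^{iθ/2} V + i e^{-iθ/2} Vᵀ`.
For `0 < θ < 2π` the Tristram matrix is this form times the positive number `2 sin(θ/2)`
(`tristramMatrix_exp`), and its determinant is the Alexander polynomial up to the sign `(-1)^g`
(`det_form_eq`).

A crossing change keeps the Seifert circles and the homology of the surface. It alters the form by a
real rank one matrix whose coefficient has the sign `ε` of the crossing. Such a change moves each
index of inertia by at most one, and the parity of the negative index is the sign of the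
determinant. Hence the signature changes by `ε (1 - s s')`, where `s`, `s'` are the signs of the two
Alexander polynomials (`signature_crossingChange`). Near a simple root `ρ` of `Δ(K)` the sign `s`
flips, while `s'` and the signature of `K^{-ε}` stay constant if the projection is good. The jump is
therefore `2 ε` times the product of the two signs (`KnotDiagram.hasSignatureJump`).

Good projections exist because a simple root has a one-dimensional kernel. A nonzero kernel vector
flows through some band, and the crossing change there makes the form nonsingular
(`exists_crossingChange`). Together with the uniqueness of limits this determines `j`.

The knot is a class of diagrams, so signature and singular angles must be compared along
Reidemeister moves (`KnotDiagram.sameSignature`). For this every crossing gets a real weight, `0` or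
`1` according to its sign in the actual Seifert form. Varying the weights perturbs the form by
independent multiples of rank one matrices. Nonsingularity is equivalent to rigidity of certain
linear colourings of the faces (`IsNondegenerate.isRigid`, `IsRigid.isNondegenerate`), a local
condition that can be followed through a move. Two families with the same singular parameters have a
constant signature difference (`sigIdx_perturb_sub_eq`). Since suitable weights remove a singularity
at any given angle, the difference is also locally constant across singular angles. At angle zero
both forms are nonsingular of signature zero, so the difference vanishes (`sigIdx_twist_eq`).

For the first two moves all surviving crossings have free weights. In the third move only one
crossing of the triangle is free at a time. If all three resulting families were singular at some
angle, kernel vectors with flow through two crossings only would lead to a contradiction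
(`false_of_triangle_kernels`). -/

noncomputable section

open scoped Matrix ComplexOrder

/-! ## Index of inertia of Hermitian matrices -/

/-- The real value of the Hermitian form of `A` at `v`. -/
def quadForm {m : ℕ} (A : Matrix (Fin m) (Fin m) ℂ) (v : Fin m → ℂ) : ℝ :=
  (star v ⬝ᵥ A *ᵥ v).re

/-- The dimensions of the subspaces on which the form of `A` is positive definite. -/
def posDims {m : ℕ} (A : Matrix (Fin m) (Fin m) ℂ) : Set ℕ :=
  {k | ∃ P : Submodule ℂ (Fin m → ℂ), Module.finrank ℂ P = k ∧ ∀ v ∈ P, v ≠ 0 → 0 < quadForm A v}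

/-- The positive index of inertia. -/
def posIdx {m : ℕ} (A : Matrix (Fin m) (Fin m) ℂ) : ℕ := sSup (posDims A)

lemma posDims_bddAbove {m : ℕ} (A : Matrix (Fin m) (Fin m) ℂ) : BddAbove (posDims A) := by
  refine ⟨m, ?_⟩
  rintro k ⟨P, rfl, -⟩
  simpa using Submodule.finrank_le P

lemma posDims_nonempty {m : ℕ} (A : Matrix (Fin m) (Fin m) ℂ) : (posDims A).Nonempty :=
  ⟨0, ⊥, by simp, by simp⟩

lemma exists_posIdx {m : ℕ} (A : Matrix (Fin m) (Fin m) ℂ) :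
    ∃ P : Submodule ℂ (Fin m → ℂ), Module.finrank ℂ P = posIdx A ∧
      ∀ v ∈ P, v ≠ 0 → 0 < quadForm A v :=
  Nat.sSup_mem (posDims_nonempty A) (posDims_bddAbove A)

lemma finrank_le_posIdx {m : ℕ} {A : Matrix (Fin m) (Fin m) ℂ} {P : Submodule ℂ (Fin m → ℂ)}
    (h : ∀ v ∈ P, v ≠ 0 → 0 < quadForm A v) : Module.finrank ℂ P ≤ posIdx A :=
  le_csSup (posDims_bddAbove A) ⟨P, rfl, h⟩

lemma quadForm_zero {m : ℕ} (A : Matrix (Fin m) (Fin m) ℂ) : quadForm A 0 = 0 := by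
  simp [quadForm]

lemma quadForm_add {m : ℕ} (A B : Matrix (Fin m) (Fin m) ℂ) (v : Fin m → ℂ) :
    quadForm (A + B) v = quadForm A v + quadForm B v := by
  simp [quadForm, Matrix.add_mulVec]

lemma quadForm_smul {m : ℕ} (r : ℝ) (A : Matrix (Fin m) (Fin m) ℂ) (v : Fin m → ℂ) :
    quadForm ((r : ℂ) • A) v = r * quadForm A v := by
  simp [quadForm, Matrix.smul_mulVec]

lemma quadForm_congr {m k : ℕ} (A : Matrix (Fin m) (Fin m) ℂ) (P : Matrix (Fin m) (Fin k) ℂ)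
    (v : Fin k → ℂ) : quadForm (Pᴴ * A * P) v = quadForm A (P *ᵥ v) := by
  simp only [quadForm, Matrix.star_mulVec, ← Matrix.mulVec_mulVec, Matrix.dotProduct_mulVec,
    Matrix.vecMul_vecMul]

lemma quadForm_conj {m : ℕ} (A : Matrix (Fin m) (Fin m) ℂ) (v : Fin m → ℂ) :
    quadForm (A.map star) v = quadForm A (star v) := by
  have : star (star (star v) ⬝ᵥ A *ᵥ (star v)) = star v ⬝ᵥ (A.map star) *ᵥ v := by
    simp only [dotProduct, Matrix.mulVec, star_sum, star_mul', Pi.star_apply, star_star,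
      Matrix.map_apply]
  rw [quadForm, ← this, quadForm]
  simp

/-- If a linear map does not decrease the quadratic form and is injective on positive vectors, then
the positive index does not decrease. -/
lemma posIdx_le_of_injective {m k : ℕ} {A : Matrix (Fin m) (Fin m) ℂ}
    {B : Matrix (Fin k) (Fin k) ℂ} (f : (Fin m → ℂ) →ₗ[ℂ] (Fin k → ℂ))
    (hf : Function.Injective f) (h : ∀ v, quadForm A v ≤ quadForm B (f v)) :
    posIdx A ≤ posIdx B := by
  obtain ⟨P, hP, hpos⟩ := exists_posIdx A
  rw [← hP, (Submodule.equivMapOfInjective f hf P).finrank_eq]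
  apply finrank_le_posIdx
  rintro _ ⟨v, hv, rfl⟩ hne
  exact (hpos v hv (by rintro rfl; simp at hne)).trans_le (h v)

lemma posIdx_mono {m : ℕ} {A B : Matrix (Fin m) (Fin m) ℂ}
    (h : ∀ v, quadForm A v ≤ quadForm B v) : posIdx A ≤ posIdx B :=
  posIdx_le_of_injective LinearMap.id Function.injective_id h

lemma posIdx_congr_le {m k : ℕ} (A : Matrix (Fin m) (Fin m) ℂ) (P : Matrix (Fin m) (Fin k) ℂ)
    (Q : Matrix (Fin k) (Fin m) ℂ) (h : Q * P = 1) : posIdx (Pᴴ * A * P) ≤ posIdx A := by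
  refine posIdx_le_of_injective P.mulVecLin (fun v w hvw => ?_)
    (fun v => (quadForm_congr A P v).le)
  have := congrArg (Q *ᵥ ·) hvw
  simpa [Matrix.mulVec_mulVec, h] using this

/-- Sylvester's law of inertia without diagonalization: each of the two forms is pulled back from
the other, so the inequality applies in both directions. -/
lemma posIdx_congr {m k : ℕ} (A : Matrix (Fin m) (Fin m) ℂ) (P : Matrix (Fin m) (Fin k) ℂ)
    (Q : Matrix (Fin k) (Fin m) ℂ) (h : Q * P = 1) (h' : P * Q = 1) :
    posIdx (Pᴴ * A * P) = posIdx A := by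
  refine le_antisymm (posIdx_congr_le A P Q h) ?_
  have h2 : Qᴴ * (Pᴴ * A * P) * Q = A := by
    have h3 : Qᴴ * Pᴴ = 1 := by rw [← Matrix.conjTranspose_mul, h', Matrix.conjTranspose_one]
    calc Qᴴ * (Pᴴ * A * P) * Q = (Qᴴ * Pᴴ) * A * (P * Q) := by simp only [Matrix.mul_assoc]
      _ = A := by rw [h3, h']; simp
  conv_lhs => rw [← h2]
  exact posIdx_congr_le _ Q P h'

lemma posIdx_smul {m : ℕ} {r : ℝ} (hr : 0 < r) (A : Matrix (Fin m) (Fin m) ℂ) :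
    posIdx ((r : ℂ) • A) = posIdx A := by
  have key : posDims ((r : ℂ) • A) = posDims A := by
    ext k
    simp only [posDims, quadForm_smul, mul_pos_iff_of_pos_left hr]
  rw [posIdx, key, posIdx]

/-- Complex conjugation carries positive subspaces to positive subspaces. It is only semilinear, so
the image is built as the span of a conjugated basis. -/
lemma posIdx_conj {m : ℕ} (A : Matrix (Fin m) (Fin m) ℂ) : posIdx (A.map star) = posIdx A := by
  have key : ∀ A : Matrix (Fin m) (Fin m) ℂ, posIdx A ≤ posIdx (A.map star) := fun A => by
    obtain ⟨P, hP, hpos⟩ := exists_posIdx A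
    obtain ⟨b⟩ : Nonempty (Module.Basis (Fin (posIdx A)) ℂ P) :=
      ⟨Module.finBasisOfFinrankEq ℂ P hP⟩
    let b' : Fin (posIdx A) → Fin m → ℂ := fun i => star (b i : Fin m → ℂ)
    have hconj : ∀ c : Fin (posIdx A) → ℂ,
        star (∑ i, c i • b' i) = ((∑ i, star (c i) • b i : P) : Fin m → ℂ) := fun c => by
      simp [b', star_sum, star_smul]
    have hli : LinearIndependent ℂ b' := by
      rw [Fintype.linearIndependent_iff]
      intro c hc i
      have h1 := hconj c
      rw [hc, star_zero] at h1
      have h2 := Fintype.linearIndependent_iff.1 b.linearIndependent (fun i => star (c i))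
        (Subtype.ext h1.symm) i
      simpa using h2
    have := finrank_span_eq_card hli
    rw [Fintype.card_fin] at this
    conv_lhs => rw [← this]
    apply finrank_le_posIdx
    intro v hv hne
    obtain ⟨c, rfl⟩ := (Submodule.mem_span_range_iff_exists_fun ℂ).1 hv
    rw [quadForm_conj, hconj]
    refine hpos _ (Subtype.coe_prop _) fun h0 => hne ?_
    rw [← hconj, star_eq_zero] at h0
    exact h0
  refine le_antisymm ?_ (key A)
  have := key (A.map star)
  rwa [Matrix.map_map, show (star ∘ star : ℂ → ℂ) = id by ext; simp, Matrix.map_id] at this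

/-- Forgetting the coordinates with `d i ≤ 0` is injective on a positive subspace, which gives the
upper bound. Extension by zero from the remaining coordinates realizes it. -/
lemma posIdx_diagonal {m : ℕ} (d : Fin m → ℝ) :
    posIdx (Matrix.diagonal fun i => (d i : ℂ)) = (Finset.univ.filter fun i => 0 < d i).card := by
  have hq : ∀ v : Fin m → ℂ, quadForm (Matrix.diagonal fun i => (d i : ℂ)) v =
      ∑ i, d i * ‖v i‖ ^ 2 := fun v => by
    simp only [quadForm, dotProduct, Matrix.mulVec_diagonal, Pi.star_apply, Complex.re_sum]
    refine Finset.sum_congr rfl fun i _ => ?_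
    have h : star (v i) * ((d i : ℂ) * v i) = ((d i * ‖v i‖ ^ 2 : ℝ) : ℂ) := by
      have := Complex.conj_mul' (v i)
      push_cast
      rw [← this]
      simp only [RCLike.star_def]
      ring
    rw [h, Complex.ofReal_re]
  apply le_antisymm
  · obtain ⟨P, hP, hpos⟩ := exists_posIdx (Matrix.diagonal fun i => (d i : ℂ))
    rw [← hP, ← Fintype.card_subtype]
    let f : P →ₗ[ℂ] ({i // 0 < d i} → ℂ) :=
      (LinearMap.funLeft ℂ ℂ (Subtype.val : {i // 0 < d i} → Fin m)).comp P.subtype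
    have hf : Function.Injective f := by
      rw [← LinearMap.ker_eq_bot, LinearMap.ker_eq_bot']
      intro v hv
      by_contra hne
      have h1 := hpos v v.2 (by simpa using hne)
      rw [hq] at h1
      refine h1.not_ge (Finset.sum_nonpos fun i _ => ?_)
      by_cases hi : 0 < d i
      · have : (v : Fin m → ℂ) i = 0 := congrFun hv ⟨i, hi⟩
        simp [this]
      · exact mul_nonpos_of_nonpos_of_nonneg (not_lt.1 hi) (by positivity)
    simpa using LinearMap.finrank_le_finrank_of_injective hf
  · rw [← Fintype.card_subtype]
    let f : ({i // 0 < d i} → ℂ) →ₗ[ℂ] (Fin m → ℂ) :=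
      Function.ExtendByZero.linearMap ℂ (Subtype.val : {i // 0 < d i} → Fin m)
    have hfa : ∀ (w : {i // 0 < d i} → ℂ) (i : {i // 0 < d i}), f w i = w i := fun w i =>
      Function.Injective.extend_apply Subtype.val_injective _ _ _
    have hf : Function.Injective f := fun w w' h => funext fun i => by
      rw [← hfa w, ← hfa w', h]
    have h1 := LinearMap.finrank_range_of_inj hf
    rw [Module.finrank_fintype_fun_eq_card] at h1
    rw [← h1]
    apply finrank_le_posIdx
    rintro _ ⟨w, rfl⟩ hne
    rw [hq]
    have hz : ∀ i, ¬ 0 < d i → f w i = 0 := fun i hi =>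
      Function.extend_apply' _ _ _ (by rintro ⟨j, rfl⟩; exact hi j.2)
    obtain ⟨i, hi⟩ := Function.ne_iff.1 hne
    have hdi : 0 < d i := by
      by_contra h
      exact hi (hz i h)
    refine Finset.sum_pos' (fun j _ => ?_) ⟨i, Finset.mem_univ _, ?_⟩
    · by_cases hj : 0 < d j
      · positivity
      · simp [hz j hj]
    · have : 0 < ‖f w i‖ := norm_pos_iff.2 hi
      positivity

lemma posIdx_eq_card {m : ℕ} {A : Matrix (Fin m) (Fin m) ℂ} (hA : A.IsHermitian) :
    posIdx A = (Finset.univ.filter fun i => 0 < hA.eigenvalues i).card ∧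
    posIdx (-A) = (Finset.univ.filter fun i => hA.eigenvalues i < 0).card := by
  set U : Matrix (Fin m) (Fin m) ℂ := (hA.eigenvectorUnitary : Matrix (Fin m) (Fin m) ℂ)
  have hU : Uᴴ * U = 1 := Matrix.mem_unitaryGroup_iff'.1 hA.eigenvectorUnitary.2
  have hU' : U * Uᴴ = 1 := Matrix.mem_unitaryGroup_iff.1 hA.eigenvectorUnitary.2
  have hs : A = (Uᴴ)ᴴ * Matrix.diagonal (fun i => (hA.eigenvalues i : ℂ)) * Uᴴ := by
    conv_lhs => rw [hA.spectral_theorem]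
    rw [Matrix.conjTranspose_conjTranspose, Unitary.conjStarAlgAut_apply]
    rfl
  constructor
  · conv_lhs => rw [hs]
    rw [posIdx_congr _ Uᴴ U hU' hU, posIdx_diagonal]
  · have hs' : -A = (Uᴴ)ᴴ * Matrix.diagonal (fun i => ((-hA.eigenvalues i : ℝ) : ℂ)) * Uᴴ := by
      conv_lhs => rw [hs]
      have : Matrix.diagonal (fun i => ((-hA.eigenvalues i : ℝ) : ℂ)) =
          -Matrix.diagonal (fun i => (hA.eigenvalues i : ℂ)) := by
        rw [Matrix.diagonal_neg]
        congr 1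
        ext i
        simp
      rw [this, Matrix.mul_neg, Matrix.neg_mul]
    conv_lhs => rw [hs']
    rw [posIdx_congr _ Uᴴ U hU' hU, posIdx_diagonal]
    simp

/-- The signature in terms of the positive indices of `A` and `-A`. -/
def sigIdx {m : ℕ} (A : Matrix (Fin m) (Fin m) ℂ) : ℤ := posIdx A - posIdx (-A)

lemma hermitianSignature_eq {m : ℕ} {A : Matrix (Fin m) (Fin m) ℂ} (hA : A.IsHermitian) :
    hermitianSignature hA = sigIdx A := by
  rw [sigIdx, (posIdx_eq_card hA).1, (posIdx_eq_card hA).2, hermitianSignature,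
    Finset.card_filter, Finset.card_filter]
  push_cast
  rw [← Finset.sum_sub_distrib]
  refine Finset.sum_congr rfl fun i _ => ?_
  rcases lt_trichotomy (hA.eigenvalues i) 0 with h | h | h
  · simp [sign_neg h, h, h.not_gt]
  · simp [h]
  · simp [sign_pos h, h, h.not_gt]

lemma posIdx_add_posIdx_neg_le {m : ℕ} {A : Matrix (Fin m) (Fin m) ℂ} (hA : A.IsHermitian) :
    posIdx A + posIdx (-A) ≤ m := by
  rw [(posIdx_eq_card hA).1, (posIdx_eq_card hA).2, ← Finset.card_union_of_disjoint]
  · simpa using Finset.card_le_univ (α := Fin m) _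
  · rw [Finset.disjoint_filter]
    intro i _ h
    exact h.le.not_gt

/-- This turns nonsingularity into an equation between indices of inertia, which passes through
congruences, small deformations and rank one changes together with the signature. -/
lemma det_ne_zero_iff_posIdx {m : ℕ} {A : Matrix (Fin m) (Fin m) ℂ} (hA : A.IsHermitian) :
    A.det ≠ 0 ↔ posIdx A + posIdx (-A) = m := by
  rw [(posIdx_eq_card hA).1, (posIdx_eq_card hA).2, ← Finset.card_union_of_disjoint,
    hA.det_eq_prod_eigenvalues, Finset.prod_ne_zero_iff, ← Finset.filter_or]
  · constructor
    · intro h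
      rw [Finset.filter_true_of_mem]
      · simp
      · intro i hi
        have := h i hi
        rcases lt_trichotomy (hA.eigenvalues i) 0 with h | h | h
        · exact Or.inr h
        · simp [h] at this
        · exact Or.inl h
    · intro h i _ h0
      have h1 : (Finset.univ.filter fun i => 0 < hA.eigenvalues i ∨ hA.eigenvalues i < 0) =
          Finset.univ := Finset.eq_univ_of_card _ (by simpa using h)
      have h2 := (Finset.mem_filter.1 (h1.symm ▸ Finset.mem_univ i)).2
      simp at h0
      rw [h0] at h2
      simp at h2
  · rw [Finset.disjoint_filter]
    intro i _ h
    exact h.le.not_gt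

lemma det_im_eq_zero {m : ℕ} {A : Matrix (Fin m) (Fin m) ℂ} (hA : A.IsHermitian) :
    A.det = (A.det.re : ℂ) := by
  rw [hA.det_eq_prod_eigenvalues]
  have : ∏ i, ((hA.eigenvalues i : ℝ) : ℂ) = ((∏ i, hA.eigenvalues i : ℝ) : ℂ) := by push_cast; rfl
  simp only [Complex.coe_algebraMap] at *
  rw [this, Complex.ofReal_re]

/-- Only the parity of the negative index is visible in the determinant. This is the link between
the signature and the sign of the Alexander polynomial. -/
lemma sign_det {m : ℕ} {A : Matrix (Fin m) (Fin m) ℂ} (hA : A.IsHermitian) (h : A.det ≠ 0) :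
    ((SignType.sign A.det.re : SignType) : ℤ) = (-1) ^ posIdx (-A) := by
  have h1 : A.det.re = ∏ i, hA.eigenvalues i := by
    rw [hA.det_eq_prod_eigenvalues]
    have : ∏ i, ((hA.eigenvalues i : ℝ) : ℂ) = ((∏ i, hA.eigenvalues i : ℝ) : ℂ) := by
      push_cast; rfl
    simp only [Complex.coe_algebraMap] at *
    rw [this, Complex.ofReal_re]
  have h0 : ∀ i, hA.eigenvalues i ≠ 0 := fun i hi => by
    apply h
    rw [hA.det_eq_prod_eigenvalues]
    exact Finset.prod_eq_zero (Finset.mem_univ i) (by simp [hi])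
  have hs : ((SignType.sign A.det.re : SignType) : ℤ) =
      ∏ i, ((SignType.sign (hA.eigenvalues i) : SignType) : ℤ) := by
    rw [h1, show SignType.sign (∏ i, hA.eigenvalues i) = ∏ i, SignType.sign (hA.eigenvalues i) from
      map_prod signHom _ _]
    exact map_prod (SignType.castHom (α := ℤ)) _ _
  rw [hs, (posIdx_eq_card hA).2, ← Finset.prod_const, Finset.prod_filter]
  refine Finset.prod_congr rfl fun i _ => ?_
  rcases lt_or_gt_of_ne (h0 i) with h | h
  · simp [h]
  · simp [h, h.le]

/-! ## Rank one perturbations -/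

/-- The Hermitian matrix of rank one given by a real vector. -/
def rankOne {m : ℕ} (q : Fin m → ℝ) : Matrix (Fin m) (Fin m) ℂ :=
  Matrix.vecMulVec (fun i => (q i : ℂ)) (fun i => (q i : ℂ))

/-- The pairing of a complex vector with a real one. -/
def pairing {m : ℕ} (q : Fin m → ℝ) : (Fin m → ℂ) →ₗ[ℂ] ℂ :=
  Fintype.linearCombination ℂ (fun i => (q i : ℂ))

lemma pairing_apply {m : ℕ} (q : Fin m → ℝ) (v : Fin m → ℂ) :
    pairing q v = ∑ i, (q i : ℂ) * v i := by
  simp [pairing, Fintype.linearCombination_apply, mul_comm]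

lemma pairing_star {m : ℕ} (q : Fin m → ℝ) (v : Fin m → ℂ) :
    pairing q (star v) = star (pairing q v) := by
  simp [pairing_apply, star_sum]

lemma rankOne_isHermitian {m : ℕ} (q : Fin m → ℝ) (c : ℝ) : ((c : ℂ) • rankOne q).IsHermitian := by
  ext i j
  simp [rankOne, Matrix.vecMulVec_apply, Matrix.conjTranspose_apply, mul_comm]

lemma rankOne_mulVec {m : ℕ} (q : Fin m → ℝ) (v : Fin m → ℂ) :
    rankOne q *ᵥ v = pairing q v • fun i => (q i : ℂ) := by
  ext i
  simp only [rankOne, Matrix.mulVec, dotProduct, Matrix.vecMulVec_apply, Pi.smul_apply,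
    smul_eq_mul, pairing_apply, Finset.sum_mul]
  exact Finset.sum_congr rfl fun j _ => by ring

lemma star_dotProduct_rankOne {m : ℕ} (q : Fin m → ℝ) (v w : Fin m → ℂ) :
    star v ⬝ᵥ rankOne q *ᵥ w = star (pairing q v) * pairing q w := by
  rw [rankOne_mulVec, ← pairing_star]
  simp only [dotProduct, Pi.smul_apply, smul_eq_mul, pairing_apply (v := star v), Finset.sum_mul]
  exact Finset.sum_congr rfl fun j _ => by ring

lemma quadForm_rankOne {m : ℕ} (q : Fin m → ℝ) (c : ℝ) (v : Fin m → ℂ) :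
    quadForm ((c : ℂ) • rankOne q) v = c * ‖pairing q v‖ ^ 2 := by
  rw [quadForm_smul, quadForm, star_dotProduct_rankOne, RCLike.star_def, Complex.conj_mul']
  norm_cast

lemma posIdx_le_add_rankOne {m : ℕ} (A : Matrix (Fin m) (Fin m) ℂ) (q : Fin m → ℝ) {c : ℝ}
    (hc : 0 ≤ c) : posIdx A ≤ posIdx (A + (c : ℂ) • rankOne q) :=
  posIdx_mono fun v => by
    rw [quadForm_add, quadForm_rankOne]
    have : 0 ≤ c * ‖pairing q v‖ ^ 2 := by positivity
    linarith

/-- The two forms agree on the kernel of `pairing q`, and a positive subspace loses at most one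
dimension when it is cut with this hyperplane. -/
lemma posIdx_add_rankOne_le {m : ℕ} (A : Matrix (Fin m) (Fin m) ℂ) (q : Fin m → ℝ) (c : ℝ) :
    posIdx (A + (c : ℂ) • rankOne q) ≤ posIdx A + 1 := by
  obtain ⟨P, hP, hpos⟩ := exists_posIdx (A + (c : ℂ) • rankOne q)
  have h1 : Module.finrank ℂ (P ⊓ LinearMap.ker (pairing q) : Submodule ℂ _) ≤ posIdx A := by
    apply finrank_le_posIdx
    rintro v ⟨hv, hv0⟩ hne
    have := hpos v hv hne
    rw [quadForm_add, quadForm_rankOne, LinearMap.mem_ker.1 hv0] at this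
    simpa using this
  have h2 := Submodule.finrank_sup_add_finrank_inf_eq P (LinearMap.ker (pairing q))
  have h3 := Submodule.finrank_le (P ⊔ LinearMap.ker (pairing q))
  have h4 := LinearMap.finrank_range_add_finrank_ker (pairing q)
  have h5 := Submodule.finrank_le (LinearMap.range (pairing q))
  simp only [Module.finrank_fintype_fun_eq_card, Module.finrank_self, Fintype.card_fin]
    at h3 h4 h5
  omega

/-- The positive index stays or grows by one, and the negative index compensates since both matrices
are nonsingular of the same size. The signature thus changes by `0` or `2`, and the parities of the
negative indices tell which. -/
lemma sigIdx_add_rankOne_of_nonneg {m : ℕ} {A : Matrix (Fin m) (Fin m) ℂ} (hA : A.IsHermitian)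
    (q : Fin m → ℝ) {c : ℝ} (hc : 0 ≤ c) (h0 : A.det ≠ 0)
    (h1 : (A + (c : ℂ) • rankOne q).det ≠ 0) :
    sigIdx (A + (c : ℂ) • rankOne q) - sigIdx A =
      1 - (SignType.sign A.det.re : ℤ) * SignType.sign (A + (c : ℂ) • rankOne q).det.re := by
  have hB := hA.add (rankOne_isHermitian q c)
  rw [sign_det hA h0, sign_det hB h1]
  have e1 := (det_ne_zero_iff_posIdx hA).1 h0
  have e2 := (det_ne_zero_iff_posIdx hB).1 h1
  have e3 := posIdx_le_add_rankOne A q hc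
  have e4 := posIdx_add_rankOne_le A q c
  set B := A + (c : ℂ) • rankOne q
  simp only [sigIdx]
  rcases (by omega : posIdx B = posIdx A ∨ posIdx B = posIdx A + 1) with h | h
  · have : posIdx (-B) = posIdx (-A) := by omega
    rw [this, ← mul_pow, h]
    simp
  · have : posIdx (-A) = posIdx (-B) + 1 := by omega
    rw [this, pow_succ, mul_assoc, mul_comm (-1 : ℤ), ← mul_assoc, ← mul_pow, h]
    push_cast
    simp
    ring

lemma sigIdx_add_rankOne {m : ℕ} {A : Matrix (Fin m) (Fin m) ℂ} (hA : A.IsHermitian)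
    (q : Fin m → ℝ) {c : ℝ} (h0 : A.det ≠ 0) (h1 : (A + (c : ℂ) • rankOne q).det ≠ 0) :
    sigIdx (A + (c : ℂ) • rankOne q) - sigIdx A = (if 0 ≤ c then 1 else -1) *
      (1 - (SignType.sign A.det.re : ℤ) * SignType.sign (A + (c : ℂ) • rankOne q).det.re) := by
  split_ifs with hc
  · rw [one_mul, sigIdx_add_rankOne_of_nonneg hA q hc h0 h1]
  · have hB := hA.add (rankOne_isHermitian q c)
    -- For negative `c` the roles of the two matrices are exchanged.
    have e : A + (c : ℂ) • rankOne q + ((-c : ℝ) : ℂ) • rankOne q = A := by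
      push_cast
      rw [neg_smul]
      abel
    have := sigIdx_add_rankOne_of_nonneg hB q (c := -c) (by linarith) h1 (by rwa [e])
    rw [e] at this
    linarith

/-- By the matrix determinant lemma the determinant is affine in `c`, with relative slope `qᵀ A⁻¹
q`. Its real part suffices for `β` because both determinants are real. -/
lemma exists_det_add_rankOne {m : ℕ} {A : Matrix (Fin m) (Fin m) ℂ} (hA : A.IsHermitian)
    (h0 : A.det ≠ 0) (q : Fin m → ℝ) : ∃ β : ℝ, ∀ c : ℝ,
    (A + (c : ℂ) • rankOne q).det = ((A.det.re * (1 + c * β) : ℝ) : ℂ) := by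
  set v : Fin m → ℂ := fun i => (q i : ℂ)
  have key : ∀ c : ℂ, (A + c • rankOne q).det = A.det * (1 + c * (v ⬝ᵥ A⁻¹ *ᵥ v)) := fun c => by
    have h := Matrix.det_add_replicateCol_mul_replicateRow (ι := Unit) (isUnit_iff_ne_zero.2 h0)
      (c • v) v
    have e : Matrix.replicateCol Unit (c • v) * Matrix.replicateRow Unit v = c • rankOne q := by
      ext i j
      simp [Matrix.mul_apply, rankOne, Matrix.vecMulVec_apply, v, mul_assoc]
    rw [e] at h
    rw [h, Matrix.det_unique (n := Unit), Matrix.add_apply, Matrix.one_apply_eq, Matrix.mul_assoc]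
    congr 2
    simp only [Matrix.mul_apply, Matrix.replicateRow_apply, Matrix.replicateCol_apply,
      dotProduct, Matrix.mulVec, Finset.mul_sum, Pi.smul_apply, smul_eq_mul]
    exact Finset.sum_congr rfl fun i _ => Finset.sum_congr rfl fun j _ => by ring
  refine ⟨(v ⬝ᵥ A⁻¹ *ᵥ v).re, fun c => ?_⟩
  rw [det_im_eq_zero (hA.add (rankOne_isHermitian q c)), key, det_im_eq_zero hA]
  rw [Complex.re_ofReal_mul]
  simp

/-- Changing a common coefficient has the same effect on two signatures if the same coefficients
are singular. -/
lemma sigIdx_add_rankOne_sub_eq {m k : ℕ} {A : Matrix (Fin m) (Fin m) ℂ}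
    {B : Matrix (Fin k) (Fin k) ℂ} (hA : A.IsHermitian) (hB : B.IsHermitian)
    (p : Fin m → ℝ) (q : Fin k → ℝ)
    (h : ∀ c : ℝ, (A + (c : ℂ) • rankOne p).det = 0 ↔ (B + (c : ℂ) • rankOne q).det = 0)
    {c : ℝ} (h0 : A.det ≠ 0) (h1 : (A + (c : ℂ) • rankOne p).det ≠ 0) :
    sigIdx (A + (c : ℂ) • rankOne p) - sigIdx (B + (c : ℂ) • rankOne q) =
      sigIdx A - sigIdx B := by
  have g0 : B.det ≠ 0 := by
    have := h 0
    simp only [Complex.ofReal_zero, zero_smul, add_zero] at this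
    exact fun hb => h0 (this.2 hb)
  have g1 : (B + (c : ℂ) • rankOne q).det ≠ 0 := fun hb => h1 ((h c).2 hb)
  have eA := sigIdx_add_rankOne hA p h0 h1
  have eB := sigIdx_add_rankOne hB q g0 g1
  obtain ⟨α, hα⟩ := exists_det_add_rankOne hA h0 p
  obtain ⟨β, hβ⟩ := exists_det_add_rankOne hB g0 q
  have a0 : A.det.re ≠ 0 := fun e => h0 (by rw [det_im_eq_zero hA, e]; simp)
  have b0 : B.det.re ≠ 0 := fun e => g0 (by rw [det_im_eq_zero hB, e]; simp)
  -- The sign of the initial determinant cancels, so each signature change depends only on the sign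
  -- of `1 + c α` or `1 + c β`.
  have hs : ∀ {a x : ℝ}, a ≠ 0 → ((SignType.sign a : SignType) : ℤ) * SignType.sign (a * x) =
      SignType.sign x := fun {a x} ha => by
    rw [sign_mul, SignType.coe_mul, ← mul_assoc, ← SignType.coe_mul, ← sign_mul,
      sign_pos (mul_self_pos.2 ha)]
    simp
  rw [hα, Complex.ofReal_re, hs a0] at eA
  rw [hβ, Complex.ofReal_re, hs b0] at eB
  have hαβ : ∀ r : ℝ, 1 + r * α = 0 ↔ 1 + r * β = 0 := fun r => by
    have := h r
    rw [hα, hβ, Complex.ofReal_eq_zero, Complex.ofReal_eq_zero, mul_eq_zero, mul_eq_zero] at this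
    simpa [a0, b0] using this
  -- The factor `1 + r α` vanishes only at `r = -1/α`, and nowhere if `α = 0`. So the common
  -- singular set determines the slope.
  have : α = β := by
    by_cases hz : α = 0
    · by_contra hne
      have hb : β ≠ 0 := fun hb => hne (by rw [hz, hb])
      have := (hαβ (-1 / β)).2 (by field_simp; ring)
      rw [hz] at this
      norm_num at this
    · have := (hαβ (-1 / α)).1 (by field_simp; ring)
      field_simp at this
      linarith
  rw [this] at eA
  linarith

/-! ## Multi-parameter families -/

/-- The family `A + ∑ w j • q j (q j)ᵀ`. -/
def perturb {m : ℕ} {J : Type*} [Fintype J] (A : Matrix (Fin m) (Fin m) ℂ) (q : J → Fin m → ℝ)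
    (w : J → ℝ) : Matrix (Fin m) (Fin m) ℂ :=
  A + ∑ j, (w j : ℂ) • rankOne (q j)

section perturb

variable {m k : ℕ} {J : Type*} [Fintype J]

lemma perturb_isHermitian {A : Matrix (Fin m) (Fin m) ℂ} (hA : A.IsHermitian) (q : J → Fin m → ℝ)
    (w : J → ℝ) : (perturb A q w).IsHermitian := by
  refine hA.add ?_
  rw [Matrix.IsHermitian, Matrix.conjTranspose_sum]
  exact Finset.sum_congr rfl fun j _ => rankOne_isHermitian _ _

lemma perturb_update [DecidableEq J] (A : Matrix (Fin m) (Fin m) ℂ) (q : J → Fin m → ℝ)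
    (w : J → ℝ) (j : J) (z : ℝ) : perturb A q (Function.update w j z) =
      perturb A q w + ((z - w j : ℝ) : ℂ) • rankOne (q j) := by
  rw [perturb, perturb, add_assoc]
  congr 1
  rw [← Finset.add_sum_erase _ _ (Finset.mem_univ j),
    ← Finset.add_sum_erase (a := j) _ (fun j => (w j : ℂ) • rankOne (q j)) (Finset.mem_univ j)]
  rw [Function.update_self]
  have : ∀ i ∈ Finset.univ.erase j, ((Function.update w j z i : ℝ) : ℂ) • rankOne (q i) =
      (w i : ℂ) • rankOne (q i) := fun i hi => by
    rw [Function.update_of_ne (Finset.ne_of_mem_erase hi)]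
  rw [Finset.sum_congr rfl this]
  push_cast
  rw [sub_smul]
  abel

/-- Along one coordinate the determinant is a nonzero affine function, so almost every value of the
coordinate is admissible. -/
lemma perturb_det_finite [DecidableEq J] {A : Matrix (Fin m) (Fin m) ℂ} (hA : A.IsHermitian)
    (q : J → Fin m → ℝ) {w : J → ℝ} (h : (perturb A q w).det ≠ 0) (j : J) :
    {z : ℝ | (perturb A q (Function.update w j z)).det = 0}.Finite := by
  obtain ⟨β, hβ⟩ := exists_det_add_rankOne (perturb_isHermitian hA q w) h (q j)
  refine Set.Finite.subset (Set.finite_singleton (w j - 1 / β)) fun z hz => ?_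
  have a0 : (perturb A q w).det.re ≠ 0 := fun e => h (by
    rw [det_im_eq_zero (perturb_isHermitian hA q w), e]; simp)
  rw [Set.mem_ofPred_eq, perturb_update, hβ, Complex.ofReal_eq_zero, mul_eq_zero] at hz
  have hz := hz.resolve_left a0
  have : β ≠ 0 := by rintro rfl; simp at hz
  rw [Set.mem_singleton_iff]
  field_simp
  linarith

/-- The difference of the signatures of two families with the same singular parameters is the same
at all other parameters. -/
lemma sigIdx_perturb_sub_eq [DecidableEq J] {A : Matrix (Fin m) (Fin m) ℂ}
    {B : Matrix (Fin k) (Fin k) ℂ} (hA : A.IsHermitian) (hB : B.IsHermitian)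
    (p : J → Fin m → ℝ) (q : J → Fin k → ℝ)
    (h : ∀ w, (perturb A p w).det = 0 ↔ (perturb B q w).det = 0) {w w' : J → ℝ}
    (hw : (perturb A p w).det ≠ 0) (hw' : (perturb A p w').det ≠ 0) :
    sigIdx (perturb A p w) - sigIdx (perturb B q w) =
      sigIdx (perturb A p w') - sigIdx (perturb B q w') := by
  have step : ∀ (w : J → ℝ) j z, (perturb A p w).det ≠ 0 →
      (perturb A p (Function.update w j z)).det ≠ 0 →
      sigIdx (perturb A p (Function.update w j z)) - sigIdx (perturb B q (Function.update w j z)) =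
      sigIdx (perturb A p w) - sigIdx (perturb B q w) := fun w j z h0 h1 => by
    rw [perturb_update] at h1
    rw [perturb_update, perturb_update]
    refine sigIdx_add_rankOne_sub_eq (perturb_isHermitian hA p w) (perturb_isHermitian hB q w)
      (p j) (q j) (fun c => ?_) h0 h1
    have := h (Function.update w j (w j + c))
    rwa [perturb_update, perturb_update, add_sub_cancel_left] at this
  -- Induction over the set of coordinates in which the two parameters may differ.
  have key : ∀ S : Finset J, ∀ w w' : J → ℝ, (∀ j ∉ S, w j = w' j) → (perturb A p w).det ≠ 0 →
      (perturb A p w').det ≠ 0 → sigIdx (perturb A p w) - sigIdx (perturb B q w) =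
      sigIdx (perturb A p w') - sigIdx (perturb B q w') := by
    intro S
    induction S using Finset.induction_on with
    | empty =>
      intro w w' hww _ _
      rw [show w = w' from funext fun j => hww j (by simp)]
    | insert j S hj ih =>
      intro w w' hww h0 h1
      -- Only finitely many values of the coordinate `j` are singular for either parameter. A common
      -- value `z` outside of them removes `j` from the set of differences.
      obtain ⟨z, hz⟩ := ((perturb_det_finite hA p h0 j).union
        (perturb_det_finite hA p h1 j)).infinite_compl.nonempty
      simp only [Set.compl_union, Set.mem_inter_iff, Set.mem_compl_iff, Set.mem_ofPred_eq] at hz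
      rw [← step w j z h0 hz.1, ← step w' j z h1 hz.2]
      refine ih _ _ (fun i hi => ?_) hz.1 hz.2
      by_cases hij : i = j
      · subst hij
        simp
      · rw [Function.update_of_ne hij, Function.update_of_ne hij]
        exact hww i (by simp [hij, hi])
  exact key Finset.univ w w' (by simp) hw hw'

/-- For some parameter, all kernel vectors are annihilated by all the vectors `q j`. -/
lemma exists_perturb_ker {A : Matrix (Fin m) (Fin m) ℂ} (hA : A.IsHermitian)
    (q : J → Fin m → ℝ) :
    ∃ w : J → ℝ, ∀ u, perturb A q w *ᵥ u = 0 → ∀ j, pairing (q j) u = 0 := by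
  classical
  let N : (J → ℝ) → ℕ := fun w => Module.finrank ℂ (LinearMap.ker (perturb A q w).mulVecLin)
  -- The parameter is chosen with minimal nullity. If a kernel vector `u` paired nontrivially with
  -- some `q j`, raising that coordinate by one would shrink the kernel strictly.
  obtain ⟨w, hw⟩ := exists_minimal_of_wellFoundedLT (fun k => k ∈ Set.range N) ⟨_, ⟨0, rfl⟩⟩
  obtain ⟨⟨w, rfl⟩, hmin⟩ := hw
  refine ⟨w, fun u hu j => ?_⟩
  by_contra hne
  let w' := Function.update w j (w j + 1)
  have hw' : perturb A q w' = perturb A q w + rankOne (q j) := by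
    simp [w', perturb_update]
  have hH := perturb_isHermitian hA q w
  have hlt : LinearMap.ker (perturb A q w').mulVecLin <
      LinearMap.ker (perturb A q w).mulVecLin := by
    -- Pairing the equation with `u` kills the old form, which is Hermitian with `u` in its kernel,
    -- and leaves only the rank one term.
    have horth : ∀ v, perturb A q w' *ᵥ v = 0 → pairing (q j) v = 0 := fun v hv => by
      rw [hw', Matrix.add_mulVec] at hv
      have h1 := congrArg (star u ⬝ᵥ ·) hv
      simp only [dotProduct_add, star_dotProduct_rankOne, dotProduct_zero] at h1
      have h2 : star u ⬝ᵥ perturb A q w *ᵥ v = 0 := by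
        rw [Matrix.dotProduct_mulVec, ← hH.eq, ← Matrix.star_mulVec, hu]
        simp
      rw [h2, zero_add, mul_eq_zero, star_eq_zero] at h1
      exact h1.resolve_left hne
    refine lt_of_le_of_ne (fun v hv => ?_) fun heq => ?_
    · rw [LinearMap.mem_ker, Matrix.mulVecLin_apply] at hv ⊢
      have h1 := horth v hv
      rw [hw', Matrix.add_mulVec, rankOne_mulVec, h1, zero_smul, add_zero] at hv
      exact hv
    · have : u ∈ LinearMap.ker (perturb A q w').mulVecLin := by
        rw [heq]
        exact hu
      exact hne (horth u this)
  exact (Submodule.finrank_lt_finrank_of_lt hlt).not_ge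
    (hmin ⟨w', rfl⟩ (Submodule.finrank_mono hlt.le))

end perturb

/-! ## Continuity -/

lemma abs_quadForm_le {m : ℕ} (A : Matrix (Fin m) (Fin m) ℂ) (v : Fin m → ℂ) :
    |quadForm A v| ≤ (∑ i, ∑ j, ‖A i j‖) * ‖v‖ ^ 2 := by
  refine (Complex.abs_re_le_norm _).trans ?_
  simp only [dotProduct, Matrix.mulVec, Finset.mul_sum, Finset.sum_mul]
  refine (norm_sum_le _ _).trans (Finset.sum_le_sum fun i _ => ?_)
  refine (norm_sum_le _ _).trans (Finset.sum_le_sum fun j _ => ?_)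
  have hi := norm_le_pi_norm v i
  have hj := norm_le_pi_norm v j
  rw [norm_mul, norm_mul, Pi.star_apply, norm_star]
  calc ‖v i‖ * (‖A i j‖ * ‖v j‖) = ‖A i j‖ * (‖v i‖ * ‖v j‖) := by ring
    _ ≤ ‖A i j‖ * (‖v‖ * ‖v‖) := by gcongr
    _ = _ := by ring

lemma quadForm_smul_vec {m : ℕ} (A : Matrix (Fin m) (Fin m) ℂ) (r : ℝ) (v : Fin m → ℂ) :
    quadForm A ((r : ℂ) • v) = r ^ 2 * quadForm A v := by
  simp only [quadForm, Matrix.mulVec_smul, star_smul, dotProduct_smul, smul_dotProduct,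
    smul_eq_mul, RCLike.star_def, Complex.conj_ofReal, Complex.re_ofReal_mul]
  ring

lemma continuous_quadForm {m : ℕ} (A : Matrix (Fin m) (Fin m) ℂ) : Continuous (quadForm A) := by
  unfold quadForm dotProduct Matrix.mulVec dotProduct
  fun_prop

/-- The form has a positive minimum on the compact unit sphere of `P`, and homogeneity extends the
bound. If `P` is zero the sphere is empty and any constant serves. -/
lemma exists_quadForm_ge {m : ℕ} {A : Matrix (Fin m) (Fin m) ℂ} {P : Submodule ℂ (Fin m → ℂ)}
    (h : ∀ v ∈ P, v ≠ 0 → 0 < quadForm A v) :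
    ∃ ε > 0, ∀ v ∈ P, ε * ‖v‖ ^ 2 ≤ quadForm A v := by
  have hc : IsCompact ((P : Set (Fin m → ℂ)) ∩ Metric.sphere 0 1) :=
    (isCompact_sphere _ _).inter_left P.closed_of_finiteDimensional
  obtain ⟨ε, hε, hmin⟩ : ∃ ε > 0, ∀ v ∈ (P : Set (Fin m → ℂ)) ∩ Metric.sphere 0 1,
      ε ≤ quadForm A v := by
    rcases Set.eq_empty_or_nonempty ((P : Set (Fin m → ℂ)) ∩ Metric.sphere 0 1) with he | hne
    · exact ⟨1, one_pos, by simp [he]⟩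
    · obtain ⟨v, ⟨hvP, hv1⟩, hv⟩ := hc.exists_isMinOn hne (continuous_quadForm A).continuousOn
      exact ⟨quadForm A v, h v hvP (by rintro rfl; simp at hv1), fun w hw => hv hw⟩
  refine ⟨ε, hε, fun v hv => ?_⟩
  by_cases h0 : v = 0
  · simp [h0, quadForm_zero]
  · have hn : ‖v‖ ≠ 0 := norm_ne_zero_iff.2 h0
    have := hmin (((‖v‖⁻¹ : ℝ) : ℂ) • v) ⟨P.smul_mem _ hv, by simp [norm_smul, hn]⟩
    rw [quadForm_smul_vec, inv_pow, inv_mul_eq_div, le_div_iff₀ (by positivity)] at this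
    exact this

/-- The positive index is lower semicontinuous: one and the same subspace stays positive, since the
perturbation is eventually smaller than the lower bound on it. -/
lemma eventually_posIdx_le {m : ℕ} {X : Type*} [TopologicalSpace X]
    {A : X → Matrix (Fin m) (Fin m) ℂ} {x : X} (hA : ContinuousAt A x) :
    ∀ᶠ y in 𝓝 x, posIdx (A x) ≤ posIdx (A y) := by
  obtain ⟨P, hP, hpos⟩ := exists_posIdx (A x)
  obtain ⟨ε, hε, hge⟩ := exists_quadForm_ge hpos
  have hcont : ContinuousAt (fun y => ∑ i, ∑ j, ‖(A y - A x) i j‖) x := by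
    have : ∀ i j, ContinuousAt (fun y => (A y - A x) i j) x := fun i j =>
      ((continuous_apply_apply i j).continuousAt.comp hA).sub continuousAt_const
    exact tendsto_finsetSum _ fun i _ => tendsto_finsetSum _ fun j _ => (this i j).norm
  have := hcont.eventually_lt (continuousAt_const (y := ε)) (by simpa using hε)
  filter_upwards [this] with y hy
  rw [← hP]
  apply finrank_le_posIdx
  intro v hv hne
  have h1 := hge v hv
  have h2 := (abs_le.1 (abs_quadForm_le (A y - A x) v)).1
  have h3 : quadForm (A y) v = quadForm (A x) v + quadForm (A y - A x) v := by
    rw [← quadForm_add]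
    congr 1
    abel
  have h4 : 0 < ‖v‖ ^ 2 := by
    have := norm_pos_iff.2 hne
    positivity
  nlinarith

/-- Neither index can drop nearby, and their sum is already maximal at a nonsingular point. -/
lemma eventually_posIdx_eq {m : ℕ} {X : Type*} [TopologicalSpace X]
    {A : X → Matrix (Fin m) (Fin m) ℂ} {x : X} (hA : ContinuousAt A x)
    (hH : ∀ y, (A y).IsHermitian) (h0 : (A x).det ≠ 0) :
    ∀ᶠ y in 𝓝 x, posIdx (A y) = posIdx (A x) ∧ posIdx (-A y) = posIdx (-A x) := by
  filter_upwards [eventually_posIdx_le hA, eventually_posIdx_le hA.neg] with y h1 h2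
  have h3 := (det_ne_zero_iff_posIdx (hH x)).1 h0
  have h4 := posIdx_add_posIdx_neg_le (hH y)
  simp only [Pi.neg_apply] at h2
  omega

lemma eventually_sigIdx_eq {m : ℕ} {X : Type*} [TopologicalSpace X]
    {A : X → Matrix (Fin m) (Fin m) ℂ} {x : X} (hA : ContinuousAt A x)
    (hH : ∀ y, (A y).IsHermitian) (h0 : (A x).det ≠ 0) :
    ∀ᶠ y in 𝓝 x, (A y).det ≠ 0 ∧ sigIdx (A y) = sigIdx (A x) := by
  filter_upwards [eventually_posIdx_eq hA hH h0] with y hy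
  refine ⟨?_, by rw [sigIdx, sigIdx, hy.1, hy.2]⟩
  rw [det_ne_zero_iff_posIdx (hH y), hy.1, hy.2]
  exact (det_ne_zero_iff_posIdx (hH x)).1 h0

/-- A function that is constant near every point of an open interval, up to the point itself, is
eventually zero everywhere if it is near the left end. -/
lemma eventually_eq_zero_of_locally_constant {a b : ℝ} {d : ℝ → ℤ}
    (h0 : ∀ᶠ θ in 𝓝[>] a, d θ = 0)
    (h : ∀ x ∈ Set.Ioo a b, ∃ c, ∀ᶠ θ in 𝓝[≠] x, d θ = c) {x : ℝ} (hx : x ∈ Set.Ioo a b) :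
    ∀ᶠ θ in 𝓝[≠] x, d θ = 0 := by
  let u : Set ℝ := {x | ∀ᶠ θ in 𝓝[≠] x, d θ = 0}
  have hopen : ∀ y c, (∀ᶠ θ in 𝓝[≠] y, d θ = c) →
      ∀ᶠ z in 𝓝 y, ∀ᶠ θ in 𝓝[≠] z, d θ = c := fun y c hy => by
    have := eventually_eventually_nhdsWithin.2 hy
    rw [eventually_nhdsWithin_iff] at this
    filter_upwards [this] with z hz
    by_cases hzy : z = y
    · rw [hzy]
      exact hy
    · have h1 := hz hzy
      rw [nhdsWithin_eq_nhds.2 (isOpen_compl_singleton.mem_nhds hzy)] at h1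
      exact h1.filter_mono nhdsWithin_le_nhds
  have hu : IsOpen u := isOpen_iff_mem_nhds.2 fun y hy => hopen y 0 hy
  -- The open set `u` is also relatively closed: near a limit point the constant `c` is compared
  -- with the value `0` at a nearby member of `u`.
  refine isPreconnected_Ioo.subset_of_closure_inter_subset hu ?_ ?_ hx
  · have h1 : ∀ᶠ z in 𝓝[>] a, z ∈ u := by
      filter_upwards [eventually_eventually_nhdsWithin.2 h0, self_mem_nhdsWithin] with z hz hza
      rw [nhdsWithin_eq_nhds.2 (isOpen_Ioi.mem_nhds hza)] at hz
      exact hz.filter_mono nhdsWithin_le_nhds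
    have h2 : ∀ᶠ z in 𝓝[>] a, z ∈ Set.Ioo a b := Ioo_mem_nhdsGT (hx.1.trans hx.2)
    obtain ⟨z, hz⟩ := (h1.and h2).exists
    exact ⟨z, hz.2, hz.1⟩
  · rintro y ⟨hy, hyab⟩
    obtain ⟨c, hc⟩ := h y hyab
    obtain ⟨z, hz, hzu⟩ := mem_closure_iff_nhds.1 hy _ (hopen y c hc)
    have hz' : ∀ᶠ θ in 𝓝[≠] z, d θ = c := hz
    have hzu' : ∀ᶠ θ in 𝓝[≠] z, d θ = 0 := hzu
    obtain ⟨θ, hθ⟩ := (hz'.and hzu').exists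
    have : c = 0 := by rw [← hθ.1, hθ.2]
    rw [this] at hc
    exact hc

/-! ## The normalized Hermitian form of a Seifert matrix -/

/-- The complexification of a real matrix. -/
def cplx {m : ℕ} (V : Matrix (Fin m) (Fin m) ℝ) : Matrix (Fin m) (Fin m) ℂ :=
  V.map ((↑) : ℝ → ℂ)

/-- The Hermitian matrix `-i e^{iθ/2} V + i e^{-iθ/2} Vᵀ`. -/
def twist {m : ℕ} (θ : ℝ) (V : Matrix (Fin m) (Fin m) ℝ) : Matrix (Fin m) (Fin m) ℂ :=
  (-Complex.I * Complex.exp (Complex.I * (θ / 2))) • cplx V +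
    (Complex.I * Complex.exp (-(Complex.I * (θ / 2)))) • (cplx V)ᵀ

section twist

variable {m k : ℕ}

lemma star_exp_I_mul (x : ℝ) :
    star (Complex.exp (Complex.I * x)) = Complex.exp (-(Complex.I * x)) := by
  rw [RCLike.star_def, ← Complex.exp_conj]
  simp

lemma twist_isHermitian (θ : ℝ) (V : Matrix (Fin m) (Fin m) ℝ) : (twist θ V).IsHermitian := by
  have h := star_exp_I_mul (θ / 2)
  have h' := star_exp_I_mul (-(θ / 2))
  push_cast at h h'
  rw [mul_neg, neg_neg] at h'
  ext i j
  simp only [twist, cplx, Matrix.conjTranspose_apply, Matrix.add_apply, Matrix.smul_apply,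
    Matrix.map_apply, Matrix.transpose_apply, smul_eq_mul, star_add, star_mul', star_neg, h, h',
    RCLike.star_def, Complex.conj_I, Complex.conj_ofReal]
  ring

lemma twist_apply (θ : ℝ) (V : Matrix (Fin m) (Fin m) ℝ) (i j : Fin m) :
    twist θ V i j = -Complex.I * Complex.exp (-(Complex.I * (θ / 2))) *
      (Complex.exp (Complex.I * θ) * V i j - V j i) := by
  have h : Complex.exp (Complex.I * (θ / 2)) =
      Complex.exp (-(Complex.I * (θ / 2))) * Complex.exp (Complex.I * θ) := by
    rw [← Complex.exp_add]
    congr 1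
    ring
  simp only [twist, cplx, Matrix.add_apply, Matrix.smul_apply, Matrix.map_apply,
    Matrix.transpose_apply, smul_eq_mul, h]
  ring

lemma twist_eq_smul (θ : ℝ) (V : Matrix (Fin m) (Fin m) ℝ) :
    twist θ V = (-Complex.I * Complex.exp (-(Complex.I * (θ / 2)))) •
      (Complex.exp (Complex.I * θ) • cplx V - (cplx V)ᵀ) := by
  ext i j
  rw [twist_apply]
  simp [cplx]

lemma continuous_twist (V : Matrix (Fin m) (Fin m) ℝ) : Continuous fun θ => twist θ V := by
  unfold twist
  fun_prop

lemma two_sin_half (θ : ℝ) : ((2 * Real.sin (θ / 2) : ℝ) : ℂ) =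
    -Complex.I * Complex.exp (Complex.I * (θ / 2)) +
      Complex.I * Complex.exp (-(Complex.I * (θ / 2))) := by
  push_cast
  rw [Complex.sin]
  ring_nf

/-- For a symmetric summand the two coefficients of `twist` add up to `2 sin(θ/2)`, which is real.
-/
lemma twist_add_rankOne (θ : ℝ) (V : Matrix (Fin m) (Fin m) ℝ) (r : ℝ) (q : Fin m → ℝ) :
    twist θ (V + r • Matrix.vecMulVec q q) =
      twist θ V + ((2 * Real.sin (θ / 2) * r : ℝ) : ℂ) • rankOne q := by
  rw [Complex.ofReal_mul, two_sin_half]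
  ext i j
  simp only [twist, cplx, rankOne, Matrix.add_apply, Matrix.smul_apply, Matrix.map_apply,
    Matrix.transpose_apply, smul_eq_mul, Matrix.vecMulVec_apply]
  push_cast
  ring

lemma twist_congr (θ : ℝ) (V : Matrix (Fin m) (Fin m) ℝ) (P : Matrix (Fin k) (Fin m) ℝ) :
    twist θ (P * V * Pᵀ) = ((P.map ((↑) : ℝ → ℂ))ᵀ)ᴴ * twist θ V * (P.map ((↑) : ℝ → ℂ))ᵀ := by
  have hP : ((P.map ((↑) : ℝ → ℂ))ᵀ)ᴴ = P.map ((↑) : ℝ → ℂ) := by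
    ext i j
    simp
  have h1 : cplx (P * V * Pᵀ) = P.map ((↑) : ℝ → ℂ) * cplx V * (P.map ((↑) : ℝ → ℂ))ᵀ := by
    rw [cplx, cplx, ← Matrix.transpose_map]
    have := fun {a b c : ℕ} (M : Matrix (Fin a) (Fin b) ℝ) (N : Matrix (Fin b) (Fin c) ℝ) =>
      Matrix.map_mul (L := M) (M := N) (f := Complex.ofRealHom)
    rw [show ((↑) : ℝ → ℂ) = Complex.ofRealHom from rfl, this, this]
  rw [hP, twist, twist, h1]
  simp only [Matrix.transpose_mul, Matrix.transpose_transpose, Matrix.mul_add, Matrix.add_mul,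
    Matrix.mul_smul, Matrix.smul_mul, Matrix.mul_assoc]

/-- At angle zero the form is `-i (V - Vᵀ)`. Conjugation changes its sign but preserves the indices.
-/
lemma sigIdx_twist_zero (V : Matrix (Fin m) (Fin m) ℝ) : sigIdx (twist 0 V) = 0 := by
  have : (twist 0 V).map star = -twist 0 V := by
    ext i j
    simp [twist, cplx]
    ring
  rw [sigIdx, ← this, posIdx_conj, sub_self]

lemma analyticOnNhd_det_twist (V : Matrix (Fin m) (Fin m) ℝ) :
    AnalyticOnNhd ℝ (fun θ => (twist θ V).det) Set.univ := by
  have hc : ∀ i j, AnalyticOnNhd ℝ (fun θ : ℝ => twist θ V i j) Set.univ := fun i j => by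
    have h1 : ∀ c : ℂ, AnalyticOnNhd ℝ (fun θ : ℝ => Complex.exp (c * θ)) Set.univ := fun c => by
      have h2 : AnalyticOnNhd ℝ (fun z : ℂ => Complex.exp (c * z)) Set.univ := fun z _ =>
        AnalyticAt.restrictScalars (𝕜 := ℝ) (by fun_prop : AnalyticAt ℂ (fun z : ℂ =>
          Complex.exp (c * z)) z)
      exact h2.comp (Complex.ofRealCLM.analyticOnNhd _) (fun _ _ => trivial)
    have h3 : (fun θ : ℝ => twist θ V i j) = fun θ : ℝ =>
        -Complex.I * Complex.exp (Complex.I / 2 * θ) * V i j +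
        Complex.I * Complex.exp (-Complex.I / 2 * θ) * V j i := by
      ext θ
      simp only [twist, cplx, Matrix.add_apply, Matrix.smul_apply, Matrix.map_apply,
        Matrix.transpose_apply, smul_eq_mul]
      rw [show Complex.I * ((θ : ℂ) / 2) = Complex.I / 2 * θ by ring,
        show -(Complex.I / 2 * (θ : ℂ)) = -Complex.I / 2 * θ by ring]
    rw [h3]
    exact ((analyticOnNhd_const.mul (h1 _)).mul analyticOnNhd_const).add
      ((analyticOnNhd_const.mul (h1 _)).mul analyticOnNhd_const)
  simp only [Matrix.det_apply]
  refine Finset.analyticOnNhd_fun_sum _ fun σ _ => ?_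
  simp only [Units.smul_def, zsmul_eq_mul]
  exact analyticOnNhd_const.mul (Finset.analyticOnNhd_fun_prod _ fun i _ => hc _ _)

/-- By the identity theorem an analytic determinant that is nonzero at angle zero has isolated
zeros. -/
lemma eventually_det_twist_ne_zero {V : Matrix (Fin m) (Fin m) ℝ} (h : (twist 0 V).det ≠ 0)
    (x : ℝ) : ∀ᶠ θ in 𝓝[≠] x, (twist θ V).det ≠ 0 := by
  by_contra hf
  have hf : ∃ᶠ θ in 𝓝[≠] x, (twist θ V).det = 0 := by
    simpa only [Filter.not_eventually, not_not] using hf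
  exact h ((analyticOnNhd_det_twist V).eqOn_zero_of_preconnected_of_frequently_eq_zero
    isPreconnected_univ (Set.mem_univ x) hf (Set.mem_univ 0))

/-- A nonsingular Hermitian form of signature zero has equal positive and negative indices, and
these add up to the size. -/
lemma even_of_det_twist_zero_ne_zero {V : Matrix (Fin m) (Fin m) ℝ} (h : (twist 0 V).det ≠ 0) :
    Even m := by
  have h1 := (det_ne_zero_iff_posIdx (twist_isHermitian 0 V)).1 h
  have h2 := sigIdx_twist_zero V
  rw [sigIdx] at h2
  exact ⟨posIdx (twist 0 V), by omega⟩

lemma sin_half_pos {θ : ℝ} (h : θ ∈ Set.Ioo 0 (2 * Real.pi)) : 0 < 2 * Real.sin (θ / 2) :=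
  mul_pos two_pos (Real.sin_pos_of_pos_of_lt_pi (by linarith [h.1]) (by linarith [h.2]))

/-! ## Comparison of two families -/

/-- The signatures of the forms of `V` and `W` differ by a constant near `x`, up to `x` itself. -/
def SigDiffConstAt (V : Matrix (Fin m) (Fin m) ℝ) (W : Matrix (Fin k) (Fin k) ℝ) (x : ℝ) : Prop :=
  ∃ c : ℤ, ∀ᶠ θ in 𝓝[≠] x, sigIdx (twist θ V) - sigIdx (twist θ W) = c

/-- One parameter `w` that is nonsingular at `x` stays nonsingular nearby, with constant signatures
of the perturbed forms. At each nearby nonsingular angle the unperturbed signatures have the same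
difference, by `sigIdx_perturb_sub_eq`. So the constant survives the crossing of a singular angle
`x`. -/
lemma sigDiffConstAt_of_perturb {J : Type*} [Fintype J] {V : Matrix (Fin m) (Fin m) ℝ}
    {W : Matrix (Fin k) (Fin k) ℝ} (hV : (twist 0 V).det ≠ 0)
    (p : J → Fin m → ℝ) (q : J → Fin k → ℝ)
    (h : ∀ θ ∈ Set.Ioo 0 (2 * Real.pi), ∀ w,
      (perturb (twist θ V) p w).det = 0 ↔ (perturb (twist θ W) q w).det = 0)
    {x : ℝ} (hx : x ∈ Set.Ioo 0 (2 * Real.pi)) {w : J → ℝ}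
    (hw : (perturb (twist x V) p w).det ≠ 0) : SigDiffConstAt V W x := by
  classical
  have hcont : ∀ {n : ℕ} (V : Matrix (Fin n) (Fin n) ℝ) (p : J → Fin n → ℝ),
      ContinuousAt (fun θ => perturb (twist θ V) p w) x := fun V p =>
    ((continuous_twist V).add continuous_const).continuousAt
  have e1 := eventually_sigIdx_eq (hcont V p)
    (fun θ => perturb_isHermitian (twist_isHermitian θ V) p w) hw
  have e2 := eventually_sigIdx_eq (hcont W q)
    (fun θ => perturb_isHermitian (twist_isHermitian θ W) q w) (fun h0 => hw ((h x hx w).2 h0))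
  refine ⟨sigIdx (perturb (twist x V) p w) - sigIdx (perturb (twist x W) q w), ?_⟩
  filter_upwards [e1.filter_mono nhdsWithin_le_nhds, e2.filter_mono nhdsWithin_le_nhds,
    eventually_det_twist_ne_zero hV x, nhdsWithin_le_nhds (isOpen_Ioo.mem_nhds hx)]
    with θ h1 h2 h3 h4
  have hz : ∀ {n : ℕ} (V : Matrix (Fin n) (Fin n) ℝ) (p : J → Fin n → ℝ),
      perturb (twist θ V) p 0 = twist θ V := fun V p => by simp [perturb]
  have := sigIdx_perturb_sub_eq (twist_isHermitian θ V) (twist_isHermitian θ W) p q (h θ h4)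
    (w := 0) (w' := w) (by rwa [hz]) h1.1
  rw [hz, hz, h1.2, h2.2] at this
  exact this

/-- Just after angle zero both signatures vanish, and local constancy carries the zero difference
along the interval. At `x` itself nonsingularity makes both signatures constant nearby. -/
lemma sigIdx_twist_eq {V : Matrix (Fin m) (Fin m) ℝ} {W : Matrix (Fin k) (Fin k) ℝ}
    (hV : (twist 0 V).det ≠ 0) (hW : (twist 0 W).det ≠ 0)
    (h : ∀ x ∈ Set.Ioo 0 (2 * Real.pi), SigDiffConstAt V W x) {x : ℝ}
    (hx : x ∈ Set.Ioo 0 (2 * Real.pi)) (hVx : (twist x V).det ≠ 0) (hWx : (twist x W).det ≠ 0) :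
    sigIdx (twist x V) = sigIdx (twist x W) := by
  have e := fun {n : ℕ} {V : Matrix (Fin n) (Fin n) ℝ} {x : ℝ} (h0 : (twist x V).det ≠ 0) =>
    eventually_sigIdx_eq (continuous_twist V).continuousAt (fun θ => twist_isHermitian θ V) h0
  have h0 : ∀ᶠ θ in 𝓝[>] (0 : ℝ), sigIdx (twist θ V) - sigIdx (twist θ W) = 0 := by
    filter_upwards [(e hV).filter_mono nhdsWithin_le_nhds,
      (e hW).filter_mono nhdsWithin_le_nhds] with θ h1 h2
    rw [h1.2, h2.2, sigIdx_twist_zero, sigIdx_twist_zero, sub_self]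
  have h1 := eventually_eq_zero_of_locally_constant h0 h hx
  obtain ⟨θ, ⟨h1, h2⟩, h3⟩ := ((h1.and ((e hVx).filter_mono nhdsWithin_le_nhds)).and
    ((e hWx).filter_mono nhdsWithin_le_nhds)).exists
  rw [h2.2, h3.2] at h1
  linarith

end twist

namespace GaussCode

variable (D : GaussCode)

/-! ## Edges and faces at a crossing -/

/-- The lower right edge of a crossing with both strands going up. -/
def rightIn (c : Fin D.n) : D.Passage :=
  if D.sign c = 1 then D.inEdge (c, false) else D.inEdge (c, true)

/-- The upper right edge of a crossing with both strands going up. -/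
def rightOut (c : Fin D.n) : D.Passage :=
  if D.sign c = 1 then (c, true) else (c, false)

lemma next_leftIn (c : Fin D.n) : D.next (D.leftIn c) = D.rightOut c := by
  unfold leftIn rightOut inEdge
  split_ifs <;> simp

lemma next_rightIn (c : Fin D.n) : D.next (D.rightIn c) = D.leftOut c := by
  unfold rightIn leftOut inEdge
  split_ifs <;> simp

lemma leftOut_fst (c : Fin D.n) : (D.leftOut c).1 = c := by
  unfold leftOut
  split_ifs <;> rfl

lemma rightOut_fst (c : Fin D.n) : (D.rightOut c).1 = c := by
  unfold rightOut
  split_ifs <;> rfl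

lemma eq_leftOut_or_rightOut (p : D.Passage) : p = D.leftOut p.1 ∨ p = D.rightOut p.1 := by
  obtain ⟨c, b⟩ := p
  unfold leftOut rightOut
  split_ifs <;> cases b <;> simp

lemma eq_leftIn_or_rightIn (p : D.Passage) :
    p = D.leftIn (D.next p).1 ∨ p = D.rightIn (D.next p).1 := by
  rcases D.eq_leftOut_or_rightOut (D.next p) with h | h
  · right
    apply D.next.injective
    rw [next_rightIn]
    exact h
  · left
    apply D.next.injective
    rw [next_leftIn]
    exact h

lemma leftOut_ne_rightOut (c c' : Fin D.n) : D.leftOut c ≠ D.rightOut c' := by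
  intro h
  have h1 := congrArg Prod.fst h
  rw [leftOut_fst, rightOut_fst] at h1
  subst h1
  unfold leftOut rightOut at h
  split_ifs at h <;> simp at h

lemma leftOut_injective : Function.Injective D.leftOut := fun c c' h => by
  have h1 := congrArg Prod.fst h
  rwa [leftOut_fst, leftOut_fst] at h1

lemma leftIn_injective : Function.Injective D.leftIn := fun c c' h => by
  have h1 := congrArg (fun p => (D.next p).1) h
  simpa only [next_leftIn, rightOut_fst] using h1

lemma leftIn_ne_rightIn (c c' : Fin D.n) : D.leftIn c ≠ D.rightIn c' := fun h => by
  have h1 := congrArg D.next h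
  rw [next_leftIn, next_rightIn] at h1
  exact D.leftOut_ne_rightOut c' c h1.symm

lemma sum_out {M : Type*} [AddCommMonoid M] (g : D.Passage → M) :
    ∑ c, (g (D.leftOut c) + g (D.rightOut c)) = ∑ p, g p := by
  rw [Fintype.sum_prod_type]
  refine Finset.sum_congr rfl fun c _ => ?_
  rw [Fintype.sum_bool]
  unfold leftOut rightOut
  split_ifs
  · rw [add_comm]
  · rfl

lemma sum_in {M : Type*} [AddCommMonoid M] (g : D.Passage → M) :
    ∑ c, (g (D.leftIn c) + g (D.rightIn c)) = ∑ p, g p := by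
  rw [← Equiv.sum_comp D.next.symm g, ← D.sum_out]
  refine Finset.sum_congr rfl fun c _ => ?_
  rw [add_comm, ← next_leftIn, ← next_rightIn, Equiv.symm_apply_apply, Equiv.symm_apply_apply]

/-- Induction along the knot. -/
lemma passage_induction {P : D.Passage → Prop} (p₀ : D.Passage) (h₀ : P p₀)
    (step : ∀ p, P p → P (D.next p)) (q : D.Passage) : P q := by
  obtain ⟨i, -, hi⟩ := (D.one_component p₀ q).exists_pow_eq'
  rw [← hi]
  clear hi
  induction i with
  | zero => exact h₀
  | succ i ih =>
    rw [pow_succ', Equiv.Perm.mul_apply]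
    exact step _ ih

/-- Induction along the knot, crossing by crossing. -/
lemma passage_induction' {P : D.Passage → Prop} (p₀ : D.Passage) (h₀ : P p₀)
    (step : ∀ c, P (D.leftIn c) → P (D.rightOut c)) (step' : ∀ c, P (D.rightIn c) → P (D.leftOut c))
    (q : D.Passage) : P q := by
  refine D.passage_induction p₀ h₀ (fun p hp => ?_) q
  rcases D.eq_leftIn_or_rightIn p with h | h
  · rw [h, next_leftIn]
    rw [h] at hp
    exact step _ hp
  · rw [h, next_rightIn]
    rw [h] at hp
    exact step' _ hp

/-! ## Functions on the faces -/

/-- The values to the left (`true`) and to the right (`false`) of the four edges at a crossing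
come from values on the four corners. -/
def IsCorner {R : Type*} (lI lO rI rO : Bool → R) : Prop :=
  lI true = lO true ∧ lI false = rI true ∧ lO false = rO true ∧ rI false = rO false

/-- Functions on the faces, given by the values on the two sides of every edge. -/
def faceFun (R : Type*) [CommRing R] : Submodule R (D.Passage → Bool → R) where
  carrier := {k | ∀ c, IsCorner (k (D.leftIn c)) (k (D.leftOut c)) (k (D.rightIn c))
    (k (D.rightOut c))}
  add_mem' := fun {x y} hx hy c => by
    have h1 := hx c
    have h2 := hy c
    simp only [IsCorner, Pi.add_apply] at *
    rw [h1.1, h1.2.1, h1.2.2.1, h1.2.2.2, h2.1, h2.2.1, h2.2.2.1, h2.2.2.2]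
    simp
  zero_mem' := fun c => by simp [IsCorner]
  smul_mem' := fun r x hx c => by
    have h1 := hx c
    simp only [IsCorner, Pi.smul_apply] at *
    rw [h1.1, h1.2.1, h1.2.2.1, h1.2.2.2]
    simp

/-- Each step along the boundary of a face stays in one corner of a crossing. The local corner
equations are convenient for algebra, the orbit description for counting faces. -/
lemma mem_faceFun_iff {R : Type*} [CommRing R] {k : D.Passage → Bool → R} :
    k ∈ D.faceFun R ↔ ∀ d, k (D.faceStep d).1 (D.faceStep d).2 = k d.1 d.2 := by
  constructor
  · rintro h ⟨p, _ | _⟩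
    · obtain ⟨c, b⟩ := p
      obtain ⟨h1, h2, h3, h4⟩ := h c
      rcases Int.units_eq_one_or (D.sign c) with hs | hs <;> cases b <;>
        simp_all [faceStep, otherGoesLeft, other, leftIn, leftOut, rightIn, rightOut, inEdge]
    · obtain ⟨q, rfl⟩ := D.next.symm.surjective p
      obtain ⟨c, b⟩ := q
      obtain ⟨h1, h2, h3, h4⟩ := h c
      rcases Int.units_eq_one_or (D.sign c) with hs | hs <;> cases b <;>
        simp_all [faceStep, otherGoesLeft, other, leftIn, leftOut, rightIn, rightOut, inEdge]
  · intro h c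
    have h1 := h ((c, true), false)
    have h2 := h ((c, false), false)
    have h3 := h (D.next.symm (c, true), true)
    have h4 := h (D.next.symm (c, false), true)
    rcases Int.units_eq_one_or (D.sign c) with hs | hs <;>
      simp_all [faceStep, otherGoesLeft, other, leftIn, leftOut, rightIn, rightOut, inEdge,
        IsCorner]

instance : Finite D.Face := Quot.finite _

/-- The function on the faces as a function on the orbits. -/
def faceFunEquiv (R : Type*) [CommRing R] : D.faceFun R ≃ₗ[R] (D.Face → R) where
  toFun k f := Quot.lift (fun d => k.1 d.1 d.2)
    (fun d e h => by rw [← h]; exact (D.mem_faceFun_iff.1 k.2 d).symm) f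
  invFun κ := ⟨fun p b => κ (Quot.mk _ (p, b)), D.mem_faceFun_iff.2 fun d =>
    congrArg κ (Quot.sound (r := fun d e => D.faceStep d = e) rfl).symm⟩
  map_add' k k' := by
    ext f
    induction f using Quot.ind
    rfl
  map_smul' r k := by
    ext f
    induction f using Quot.ind
    rfl
  left_inv k := rfl
  right_inv κ := by
    ext f
    induction f using Quot.ind
    rfl

/-- The Euler characteristic of the sphere enters the argument here. -/
lemma finrank_faceFun (h : D.Planar) (hn : D.n ≠ 0) : Module.finrank ℂ (D.faceFun ℂ) = D.n + 2 := by
  have := Fintype.ofFinite D.Face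
  rw [(D.faceFunEquiv ℂ).finrank_eq, Module.finrank_fintype_fun_eq_card, ← Nat.card_eq_fintype_card]
  exact h.resolve_left hn

/-! ## Cycles as boundaries of face functions -/

/-- The cycles on the 4-valent graph with coefficients in a ring. -/
def cyclesOver (R : Type*) [CommRing R] : Submodule R (D.Passage → R) where
  carrier := {x | ∀ c, x (D.leftIn c) + x (D.rightIn c) = x (D.leftOut c) + x (D.rightOut c)}
  add_mem' := fun {x y} hx hy c => by
    have h1 := hx c
    have h2 := hy c
    simp only [Pi.add_apply]
    linear_combination h1 + h2
  zero_mem' := fun c => by simp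
  smul_mem' := fun r x hx c => by
    have h1 := hx c
    simp only [Pi.smul_apply, smul_eq_mul]
    linear_combination r * h1

lemma mem_cycles_iff {x : D.Passage → ℤ} : x ∈ D.cycles ↔ x ∈ D.cyclesOver ℤ := by
  refine forall_congr' fun c => ?_
  unfold leftIn leftOut rightIn rightOut
  split_ifs
  · rw [add_comm (x (c, false))]
  · rw [add_comm (x (D.inEdge (c, false)))]

/-- The differences across the edges of a function on the faces. -/
def faceDiff (R : Type*) [CommRing R] : (D.Passage → Bool → R) →ₗ[R] (D.Passage → R) where
  toFun k p := k p true - k p false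
  map_add' k k' := by
    ext p
    simp only [Pi.add_apply]
    ring
  map_smul' r k := by
    ext p
    simp only [Pi.smul_apply, smul_eq_mul, RingHom.id_apply]
    ring

/-- The multiplicities on the bands. -/
def flow (R : Type*) [CommRing R] : (D.Passage → R) →ₗ[R] (Fin D.n → R) where
  toFun x c := x (D.leftIn c) - x (D.leftOut c)
  map_add' k k' := by
    ext p
    simp only [Pi.add_apply]
    ring
  map_smul' r k := by
    ext p
    simp only [Pi.smul_apply, smul_eq_mul, RingHom.id_apply]
    ring

lemma faceDiff_apply {R : Type*} [CommRing R] (k : D.Passage → Bool → R) (p : D.Passage) :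
    D.faceDiff R k p = k p true - k p false := rfl

lemma flow_apply {R : Type*} [CommRing R] (x : D.Passage → R) (c : Fin D.n) :
    D.flow R x c = x (D.leftIn c) - x (D.leftOut c) := rfl

lemma flow_eq_bandFlow (x : D.Passage → ℤ) : D.flow ℤ x = D.bandFlow x := rfl

lemma faceDiff_mem {R : Type*} [CommRing R] {k : D.Passage → Bool → R} (hk : k ∈ D.faceFun R) :
    D.faceDiff R k ∈ D.cyclesOver R := fun c => by
  obtain ⟨h1, h2, h3, h4⟩ := hk c
  simp only [faceDiff_apply]
  rw [h1, h2, h3, h4]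
  ring

/-- The linear map whose kernel consists of the cycles. -/
def conservation : (D.Passage → ℂ) →ₗ[ℂ] (Fin D.n → ℂ) where
  toFun x c := x (D.leftIn c) + x (D.rightIn c) - (x (D.leftOut c) + x (D.rightOut c))
  map_add' k k' := by
    ext p
    simp only [Pi.add_apply]
    ring
  map_smul' r k := by
    ext p
    simp only [Pi.smul_apply, smul_eq_mul, RingHom.id_apply]
    ring

lemma ker_conservation : LinearMap.ker D.conservation = D.cyclesOver ℂ := by
  ext x
  rw [LinearMap.mem_ker]
  constructor
  · exact fun h c => sub_eq_zero.1 (congrFun h c)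
  · exact fun h => funext fun c => sub_eq_zero.2 (h c)

/-- The conservation map is the boundary map of the graph: an edge is sent to its head minus its
tail. -/
lemma conservation_single (p : D.Passage) : D.conservation (Pi.single p 1) =
    Pi.single (D.next p).1 1 - Pi.single p.1 1 := by
  ext c
  have hin : (Pi.single p (1 : ℂ) : D.Passage → ℂ) (D.leftIn c) +
      (Pi.single p 1 : D.Passage → ℂ) (D.rightIn c) =
      (Pi.single (D.next p).1 (1 : ℂ) : Fin D.n → ℂ) c := by
    rcases D.eq_leftIn_or_rightIn p with h | h <;> set e := (D.next p).1 <;> rw [h] <;>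
      by_cases hc : c = e
    · subst hc; simp [(D.leftIn_ne_rightIn _ _).symm]
    · simp [(D.leftIn_ne_rightIn _ _).symm, D.leftIn_injective.eq_iff, hc]
    · subst hc; simp [D.leftIn_ne_rightIn]
    · have : D.rightIn c ≠ D.rightIn e := fun h' => hc (by
        have := congrArg (fun p => (D.next p).1) h'
        simpa only [next_rightIn, leftOut_fst] using this)
      simp [D.leftIn_ne_rightIn, this, hc]
  have hout : (Pi.single p (1 : ℂ) : D.Passage → ℂ) (D.leftOut c) +
      (Pi.single p 1 : D.Passage → ℂ) (D.rightOut c) =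
      (Pi.single p.1 (1 : ℂ) : Fin D.n → ℂ) c := by
    rcases D.eq_leftOut_or_rightOut p with h | h <;> set e := p.1 <;> rw [h] <;>
      by_cases hc : c = e
    · subst hc; simp [(D.leftOut_ne_rightOut _ _).symm]
    · simp [(D.leftOut_ne_rightOut _ _).symm, D.leftOut_injective.eq_iff, hc]
    · subst hc; simp [D.leftOut_ne_rightOut]
    · have : D.rightOut c ≠ D.rightOut e := fun h' => hc (by
        have := congrArg Prod.fst h'
        simpa only [rightOut_fst] using this)
      simp [D.leftOut_ne_rightOut, this, hc]
  have e : D.conservation (Pi.single p 1) c =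
      (Pi.single p (1 : ℂ) : D.Passage → ℂ) (D.leftIn c) +
      (Pi.single p 1 : D.Passage → ℂ) (D.rightIn c) -
      ((Pi.single p (1 : ℂ) : D.Passage → ℂ) (D.leftOut c) +
      (Pi.single p 1 : D.Passage → ℂ) (D.rightOut c)) := rfl
  rw [e, hin, hout]
  rfl

/-- A functional that kills all boundaries takes the same value at all crossings, because the knot
runs through all of them. So the boundary map has corank at most one, and its kernel has dimension
at most `2n - (n - 1)`. -/
lemma finrank_cyclesOver_le (hn : D.n ≠ 0) : Module.finrank ℂ (D.cyclesOver ℂ) ≤ D.n + 1 := by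
  let p₀ : D.Passage := (⟨0, Nat.pos_of_ne_zero hn⟩, true)
  let f : LinearMap.ker D.conservation.dualMap →ₗ[ℂ] ℂ :=
    (Module.Dual.eval ℂ _ (Pi.single p₀.1 1)).comp (LinearMap.ker D.conservation.dualMap).subtype
  have hf : Function.Injective f := by
    rw [← LinearMap.ker_eq_bot, LinearMap.ker_eq_bot']
    rintro ⟨ψ, hψ⟩ h0
    have h0 : ψ (Pi.single p₀.1 1) = 0 := h0
    have hstep : ∀ p : D.Passage, ψ (Pi.single (D.next p).1 1) = ψ (Pi.single p.1 1) := fun p => by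
      have := LinearMap.congr_fun (LinearMap.mem_ker.1 hψ) (Pi.single p 1)
      rw [LinearMap.dualMap_apply, conservation_single, map_sub] at this
      exact sub_eq_zero.1 this
    have hall := D.passage_induction (P := fun p => ψ (Pi.single p.1 1) = 0) p₀ h0
      (fun p hp => by rw [hstep, hp])
    refine Subtype.ext (LinearMap.pi_ext' fun c => LinearMap.ext_ring ?_)
    exact hall (c, true)
  have h1 := LinearMap.finrank_le_finrank_of_injective hf
  rw [Module.finrank_self] at h1
  have h2 := LinearMap.finrank_range_add_finrank_ker D.conservation.dualMap
  have h3 := LinearMap.finrank_range_add_finrank_ker D.conservation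
  rw [LinearMap.finrank_range_dualMap_eq_finrank_range, Subspace.dual_finrank_eq] at h2
  rw [← ker_conservation]
  simp only [Module.finrank_fintype_fun_eq_card, Fintype.card_prod, Fintype.card_fin,
    Fintype.card_bool] at h2 h3
  omega

/-- In a planar diagram, all cycles are boundaries. -/
lemma exists_faceDiff_eq (h : D.Planar) (hn : D.n ≠ 0) {x : D.Passage → ℂ}
    (hx : x ∈ D.cyclesOver ℂ) : ∃ k ∈ D.faceFun ℂ, D.faceDiff ℂ k = x := by
  let p₀ : D.Passage := (⟨0, Nat.pos_of_ne_zero hn⟩, true)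
  let f : D.faceFun ℂ →ₗ[ℂ] (D.Passage → ℂ) := (D.faceDiff ℂ).comp (D.faceFun ℂ).subtype
  have hle : LinearMap.range f ≤ D.cyclesOver ℂ := by
    rintro _ ⟨k, rfl⟩
    exact D.faceDiff_mem k.2
  -- A face function without differences is constant, again by walking along the knot.
  have hker : ∀ k ∈ D.faceFun ℂ, D.faceDiff ℂ k = 0 → ∀ p b, k p b = k p₀ true := by
    intro k hk hkf
    have hd : ∀ p, k p true = k p false := fun p => sub_eq_zero.1 (congrFun hkf p)
    have hall := D.passage_induction' (P := fun p => k p true = k p₀ true) p₀ rfl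
      (fun c hc => by
        obtain ⟨h1, h2, h3, h4⟩ := hk c
        rw [← h3, ← hd, ← h1, hc])
      (fun c hc => by
        obtain ⟨h1, h2, h3, h4⟩ := hk c
        rw [← h1, hd, h2, hc])
    intro p b
    cases b
    · exact (hd p).symm.trans (hall p)
    · exact hall p
  have h1 : Module.finrank ℂ (LinearMap.ker f) ≤ 1 := by
    refine finrank_le_one ⟨⟨fun _ _ => 1, fun c => ⟨rfl, rfl, rfl, rfl⟩⟩, ?_⟩ ?_
    · exact LinearMap.mem_ker.2 (funext fun p => sub_self _)
    · rintro ⟨⟨k, hk⟩, hkf⟩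
      refine ⟨k p₀ true, Subtype.ext (Subtype.ext (funext fun p => funext fun b => ?_))⟩
      exact (mul_one (k p₀ true)).trans (hker k hk hkf p b).symm
  have h2 := LinearMap.finrank_range_add_finrank_ker f
  rw [D.finrank_faceFun h hn] at h2
  have h3 := D.finrank_cyclesOver_le hn
  -- There are `n + 2` faces and a kernel of dimension at most one, so the boundaries have dimension
  -- at least `n + 1`, the upper bound for the cycles.
  have heq := Submodule.eq_of_le_of_finrank_le hle (by omega)
  rw [← heq] at hx
  obtain ⟨k, hk⟩ := hx
  exact ⟨k.1, k.2, hk⟩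

/-- The Alexander numbering of the faces: it increases by one from the right to the left of every
edge. -/
lemma exists_numbering (h : D.Planar) (hn : D.n ≠ 0) :
    ∃ ι ∈ D.faceFun ℤ, ∀ p, ι p true = ι p false + 1 := by
  let p₀ : D.Passage := (⟨0, Nat.pos_of_ne_zero hn⟩, true)
  -- The knot itself is a cycle with multiplicity one on every edge. Its complex potential has
  -- integral differences from the base value, and these form the numbering.
  obtain ⟨k, hk, hd⟩ := D.exists_faceDiff_eq h hn (x := fun _ => 1) (fun c => rfl)
  have hd : ∀ p, k p true = k p false + 1 := fun p => by
    have : k p true - k p false = 1 := congrFun hd p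
    linear_combination this
  have hall := D.passage_induction' (P := fun p => ∃ n : ℤ, k p false = k p₀ false + n) p₀
    ⟨0, by simp⟩
    (fun c ⟨n, hc⟩ => ⟨n - 1, by
      obtain ⟨h1, h2, h3, h4⟩ := hk c
      have := hd (D.rightIn c)
      push_cast
      rw [← h4]
      linear_combination hc - h2 - this⟩)
    (fun c ⟨n, hc⟩ => ⟨n + 1, by
      obtain ⟨h1, h2, h3, h4⟩ := hk c
      have := hd (D.rightOut c)
      push_cast
      rw [h3, this, ← h4, hc]
      ring⟩)
  choose ν hν using hall
  let ι : D.Passage → Bool → ℤ := fun p b => if b then ν p + 1 else ν p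
  have hι : ∀ p b, k p b = k p₀ false + ι p b := fun p b => by
    cases b
    · simp [ι, hν p]
    · rw [hd, hν p]
      simp [ι]
      ring
  have hinj : ∀ {p b q b'}, k p b = k q b' → ι p b = ι q b' := fun {p b q b'} he => by
    rw [hι p b, hι q b'] at he
    exact_mod_cast add_left_cancel he
  refine ⟨ι, fun c => ?_, fun p => by simp [ι]⟩
  obtain ⟨h1, h2, h3, h4⟩ := hk c
  exact ⟨hinj h1, hinj h2, hinj h3, hinj h4⟩

/-- The total flow of a cycle vanishes. -/
lemma sum_flow (h : D.Planar) {x : D.Passage → ℂ} (hx : x ∈ D.cyclesOver ℂ) :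
    ∑ c, D.flow ℂ x c = 0 := by
  by_cases hn : D.n = 0
  · have : IsEmpty (Fin D.n) := by rw [hn]; infer_instance
    simp
  obtain ⟨ι, hι, hd⟩ := D.exists_numbering h hn
  -- Summation by parts, weighted with the number of the face to the left of each edge. At a
  -- crossing this number is one less for the right edges than for the left ones, which leaves
  -- exactly the flow through the band.
  have e1 := D.sum_in (fun p => (ι p true : ℂ) * x p)
  rw [← D.sum_out, ← sub_eq_zero, ← Finset.sum_sub_distrib] at e1
  rw [← e1]
  refine Finset.sum_congr rfl fun c _ => ?_
  obtain ⟨h1, h2, h3, h4⟩ := hι c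
  have hc := hx c
  have i1 : ι (D.rightIn c) true = ι (D.leftOut c) true - 1 := by rw [← h2, ← h1, hd]; ring
  have i2 : ι (D.rightOut c) true = ι (D.leftOut c) true - 1 := by rw [← h3, hd (D.leftOut c)]; ring
  rw [h1, i1, i2, flow_apply]
  push_cast
  linear_combination (-(ι (D.leftOut c) true : ℂ) + 1) * hc

end GaussCode

namespace GaussCode

variable (D : GaussCode)

/-! ## The weighted Seifert form and its radical -/

/-- The Seifert form with an arbitrary weight at every crossing. The weight is `0` at a positive
crossing and `1` at a negative one. -/
def weightedForm (w : Fin D.n → ℂ) (x y : D.Passage → ℂ) : ℂ :=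
  ∑ c, (x (D.leftOut c) + w c * D.flow ℂ x c) * D.flow ℂ y c

/-- The colour relation at a crossing. -/
def IsDehn (t u : ℂ) (lI lO rI rO : Bool → ℂ) : Prop :=
  IsCorner lI lO rI rO ∧ lI true + t * rO false = u * lI false + (1 + t - u) * lO false

/-- The colourings of the faces that satisfy the relation at every crossing. -/
def IsColoring (t : ℂ) (u : Fin D.n → ℂ) (k : D.Passage → Bool → ℂ) : Prop :=
  ∀ c, IsDehn t (u c) (k (D.leftIn c)) (k (D.leftOut c)) (k (D.rightIn c)) (k (D.rightOut c))

/-- Cycles in the radical of the form `t B - Bᵀ` have no flow through the bands. -/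
def IsNondegenerate (t : ℂ) (w : Fin D.n → ℂ) : Prop :=
  ∀ x ∈ D.cyclesOver ℂ, (∀ y ∈ D.cyclesOver ℂ,
    t * D.weightedForm w x y = D.weightedForm w y x) → D.flow ℂ x = 0

/-- A colouring that vanishes at one edge vanishes everywhere. -/
def IsRigid (t : ℂ) (u : Fin D.n → ℂ) (p : D.Passage) : Prop :=
  ∀ k, D.IsColoring t u k → k p = 0 → k = 0

variable {D}

lemma IsColoring.mem_faceFun {t : ℂ} {u : Fin D.n → ℂ} {k : D.Passage → Bool → ℂ}
    (h : D.IsColoring t u k) : k ∈ D.faceFun ℂ := fun c => (h c).1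

lemma IsColoring.sub {t : ℂ} {u : Fin D.n → ℂ} {k k' : D.Passage → Bool → ℂ}
    (h : D.IsColoring t u k) (h' : D.IsColoring t u k') : D.IsColoring t u (k - k') := fun c =>
  ⟨(D.faceFun ℂ).sub_mem h.mem_faceFun h'.mem_faceFun c, by
    have h1 := (h c).2
    have h2 := (h' c).2
    simp only [Pi.sub_apply]
    linear_combination h1 - h2⟩

/-- The defect of the colour relation, for the numbered colours. -/
def defect (t : ℂ) (w : Fin D.n → ℂ) (k : D.Passage → Bool → ℂ) (c : Fin D.n) : ℂ :=
  k (D.rightOut c) false - k (D.leftIn c) false + t * (k (D.leftIn c) true - k (D.leftOut c) false)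
    + (t - 1) * w c * (k (D.leftOut c) false - k (D.leftIn c) false)

/-- Summation by parts with the colour to the right of each edge. When `x` is a boundary, membership
in the radical thus becomes a condition on the local quantity `defect`. -/
lemma weightedForm_sub_eq {t : ℂ} {w : Fin D.n → ℂ} {k : D.Passage → Bool → ℂ}
    (hk : k ∈ D.faceFun ℂ) {y : D.Passage → ℂ} (hy : y ∈ D.cyclesOver ℂ) :
    t * D.weightedForm w (D.faceDiff ℂ k) y - D.weightedForm w y (D.faceDiff ℂ k) =
      ∑ c, defect t w k c * D.flow ℂ y c := by
  have e1 := D.sum_in (fun p => k p false * y p)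
  rw [← D.sum_out, ← sub_eq_zero, ← Finset.sum_sub_distrib] at e1
  rw [weightedForm, weightedForm, Finset.mul_sum, ← Finset.sum_sub_distrib, ← sub_zero (∑ c, _),
    ← e1, ← Finset.sum_sub_distrib]
  refine Finset.sum_congr rfl fun c _ => ?_
  obtain ⟨h1, h2, h3, h4⟩ := hk c
  have hc := hy c
  simp only [flow_apply, faceDiff_apply, defect]
  rw [h1, h4]
  linear_combination (-k (D.rightOut c) false) * hc

lemma weightedForm_eq_zero_right {w : Fin D.n → ℂ} {x y : D.Passage → ℂ}
    (hy : D.flow ℂ y = 0) : D.weightedForm w x y = 0 := by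
  simp [weightedForm, hy]

/-- The form reads its left argument on an edge, not only through its flow, so this is less obvious
than the statement on the right. With the second cycle written as a boundary, the case `t = 0` of
the summation by parts expresses the form by the flow of `x`. Hence the form descends to homology.
-/
lemma weightedForm_eq_zero_left (h : D.Planar) {w : Fin D.n → ℂ} {x y : D.Passage → ℂ}
    (hx : x ∈ D.cyclesOver ℂ) (hy : y ∈ D.cyclesOver ℂ)
    (hx0 : D.flow ℂ x = 0) : D.weightedForm w x y = 0 := by
  by_cases hn : D.n = 0
  · have : IsEmpty (Fin D.n) := by rw [hn]; infer_instance
    simp [weightedForm]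
  obtain ⟨k, hk, rfl⟩ := D.exists_faceDiff_eq h hn hy
  have := weightedForm_sub_eq (t := 0) (w := w) hk hx
  rw [hx0] at this
  simpa using this

/-- These are the powers of `t` with the Alexander numbering as exponent. They convert numbered
colours into colours that satisfy a numbering-free relation. -/
lemma exists_exponential (h : D.Planar) (hn : D.n ≠ 0) {t : ℂ} (ht : t ≠ 0) :
    ∃ τ ∈ D.faceFun ℂ, (∀ p b, τ p b ≠ 0) ∧ ∀ p, τ p true = t * τ p false := by
  obtain ⟨ι, hι, hd⟩ := D.exists_numbering h hn
  refine ⟨fun p b => t ^ ι p b, fun c => ?_, fun p b => zpow_ne_zero _ ht, fun p => ?_⟩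
  · obtain ⟨h1, h2, h3, h4⟩ := hι c
    simp only [IsCorner, h1, h2, h3, h4, and_self]
  · simp only [hd, zpow_add_one₀ ht]
    ring

/-- There are colourings with arbitrary values at an edge and without flow. -/
lemma exists_trivial_coloring (h : D.Planar) (hn : D.n ≠ 0) {t : ℂ} (ht : t ≠ 0)
    (u : Fin D.n → ℂ) (p : D.Passage) (a : Bool → ℂ) :
    ∃ k, D.IsColoring t u k ∧ k p = a ∧ ∀ c, k (D.leftIn c) false = k (D.leftOut c) false := by
  -- For `t = 1` the exponential solution is constant. Affine functions of the numbering take its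
  -- place.
  by_cases h1 : t = 1
  · subst h1
    obtain ⟨ι, hι, hd⟩ := D.exists_numbering h hn
    refine ⟨fun q b => a false + (a true - a false) * (ι q b - ι p false), fun c => ?_,
      funext fun b => ?_, fun c => ?_⟩
    · obtain ⟨h1, h2, h3, h4⟩ := hι c
      have i1 : ι (D.rightOut c) false = ι (D.leftOut c) false - 1 := by rw [h3, hd]; ring
      have i2 : ι (D.leftIn c) false = ι (D.leftOut c) false := by
        have := hd (D.leftIn c)
        rw [h1, hd] at this
        linarith
      refine ⟨by simp only [IsCorner, h1, h2, h3, h4, and_self], ?_⟩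
      simp only [h1, hd (D.leftOut c), i1, i2]
      push_cast
      ring
    · cases b
      · simp
      · simp only [hd]
        push_cast
        ring
    · obtain ⟨h1, h2, h3, h4⟩ := hι c
      have i2 : ι (D.leftIn c) false = ι (D.leftOut c) false := by
        have := hd (D.leftIn c)
        rw [h1, hd] at this
        linarith
      simp only [i2]
  · obtain ⟨τ, hτ, hne, hd⟩ := exists_exponential h hn ht
    have h1' : t - 1 ≠ 0 := sub_ne_zero.2 h1
    set β := (a true - a false) / ((t - 1) * τ p false) with hβ
    have hβ' : β * ((t - 1) * τ p false) = a true - a false := by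
      rw [hβ]
      exact div_mul_cancel₀ _ (mul_ne_zero h1' (hne _ _))
    have hTB : ∀ c, τ (D.leftIn c) false = τ (D.leftOut c) false := fun c => by
      obtain ⟨h1, h2, h3, h4⟩ := hτ c
      have := hd (D.leftIn c)
      rw [h1, hd] at this
      exact (mul_left_cancel₀ ht this).symm
    refine ⟨fun q b => a false + β * (τ q b - τ p false), fun c => ?_, funext fun b => ?_,
      fun c => by simp only [hTB]⟩
    · obtain ⟨h1, h2, h3, h4⟩ := hτ c
      refine ⟨by simp only [IsCorner, h1, h2, h3, h4, and_self], ?_⟩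
      have i1 : t * τ (D.rightOut c) false = τ (D.leftOut c) false := by rw [h3, hd]
      simp only [h1, hd (D.leftOut c), hTB]
      linear_combination β * i1
    · cases b
      · simp
      · simp only [hd]
        linear_combination hβ'

/-- A function on the crossings that annihilates all flows is a difference of values on the
Seifert circles. -/
lemma exists_seifert_potential {E : Fin D.n → ℂ}
    (hE : ∀ y ∈ D.cyclesOver ℂ, ∑ c, E c * D.flow ℂ y c = 0) :
    ∃ m : D.Passage → ℂ, ∀ c, m (D.leftIn c) = m (D.leftOut c) ∧
      m (D.rightIn c) = m (D.rightOut c) ∧ E c = m (D.leftIn c) - m (D.rightIn c) := by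
  let φ : Module.Dual ℂ (D.Passage → ℂ) :=
    (Fintype.linearCombination ℂ E).comp (D.flow ℂ)
  have hφa : ∀ y, φ y = ∑ c, E c * D.flow ℂ y c := fun y => by
    simp [φ, Fintype.linearCombination_apply, mul_comm]
  -- A functional that vanishes on the kernel of the boundary map factors through that map. The
  -- factor `ψ` is a potential on the crossings.
  have hφ : φ ∈ LinearMap.range D.conservation.dualMap := by
    rw [LinearMap.range_dualMap_eq_dualAnnihilator_ker, Submodule.mem_dualAnnihilator]
    intro y hy
    rw [ker_conservation] at hy
    rw [hφa]
    exact hE y hy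
  obtain ⟨ψ, hψ⟩ := hφ
  let g : Fin D.n → ℂ := fun c => ψ (Pi.single c 1)
  have hp : ∀ p : D.Passage, (∑ c, E c * (Pi.single p 1 : D.Passage → ℂ) (D.leftIn c)) -
      g (D.next p).1 = (∑ c, E c * (Pi.single p 1 : D.Passage → ℂ) (D.leftOut c)) - g p.1 :=
    fun p => by
      have h1 := LinearMap.congr_fun hψ (Pi.single p 1)
      rw [LinearMap.dualMap_apply, conservation_single, map_sub, hφa] at h1
      simp only [flow_apply, mul_sub, Finset.sum_sub_distrib] at h1
      linear_combination -h1
  -- By `hp` the value computed at the head of an edge agrees with the one computed at its tail.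
  -- This makes `m` constant along Seifert circles.
  let m : D.Passage → ℂ := fun p =>
    (∑ c, E c * (Pi.single p 1 : D.Passage → ℂ) (D.leftIn c)) - g (D.next p).1
  have m1 : ∀ c, m (D.leftIn c) = E c - g c := fun c => by
    simp only [m, next_leftIn, rightOut_fst]
    congr 1
    rw [Finset.sum_eq_single c]
    · simp
    · intro b _ hb
      simp [D.leftIn_injective.eq_iff, hb]
    · simp
  have m2 : ∀ c, m (D.rightIn c) = -g c := fun c => by
    simp only [m, next_rightIn, leftOut_fst]
    rw [Finset.sum_eq_zero, zero_sub]
    intro b _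
    simp [D.leftIn_ne_rightIn]
  have m3 : ∀ c, m (D.leftOut c) = E c - g c := fun c => by
    simp only [m, hp, leftOut_fst]
    congr 1
    rw [Finset.sum_eq_single c]
    · simp
    · intro b _ hb
      simp [D.leftOut_injective.eq_iff, hb]
    · simp
  have m4 : ∀ c, m (D.rightOut c) = -g c := fun c => by
    simp only [m, hp, rightOut_fst]
    rw [Finset.sum_eq_zero, zero_sub]
    intro b _
    simp [D.leftOut_ne_rightOut]
  exact ⟨m, fun c => ⟨by rw [m1, m3], by rw [m2, m4], by rw [m1, m2]; ring⟩⟩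

/-- The parameter of the colour relation that belongs to a weight. -/
def colorParam (t : ℂ) (w : Fin D.n → ℂ) (c : Fin D.n) : ℂ := 1 + (t - 1) * w c

/-- Dividing a colouring by the exponential turns the colour relations into vanishing of `defect`,
so its boundary lies in the radical and has no flow. Without flow the colours beside one edge
determine those beside the next, and the zero at `p` spreads along the knot. -/
lemma IsNondegenerate.isRigid (h : D.Planar) {t : ℂ} (ht : t ≠ 0) {w : Fin D.n → ℂ}
    (hN : D.IsNondegenerate t w) (p : D.Passage) : D.IsRigid t (colorParam t w) p := by
  intro k hk hp
  have hn : D.n ≠ 0 := fun hn => by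
    have := p.1.2
    omega
  obtain ⟨τ, hτ, hne, hd⟩ := exists_exponential h hn ht
  let φ : D.Passage → Bool → ℂ := fun q b => (τ q b)⁻¹ * k q b
  have hφ : φ ∈ D.faceFun ℂ := fun c => by
    obtain ⟨h1, h2, h3, h4⟩ := hτ c
    obtain ⟨k1, k2, k3, k4⟩ := (hk c).1
    simp only [φ, IsCorner, h1, h2, h3, h4, k1, k2, k3, k4, and_self]
  have hTB : ∀ c, τ (D.leftIn c) false = τ (D.leftOut c) false := fun c => by
    obtain ⟨h1, h2, h3, h4⟩ := hτ c
    have := hd (D.leftIn c)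
    rw [h1, hd] at this
    exact (mul_left_cancel₀ ht this).symm
  have hdef : ∀ c, defect t w φ c = 0 := fun c => by
    obtain ⟨h1, h2, h3, h4⟩ := hτ c
    have hk2 := (hk c).2
    have i1 : τ (D.rightOut c) false = τ (D.leftOut c) false / t := by
      rw [eq_div_iff ht, h3, hd, mul_comm]
    simp only [colorParam] at hk2
    simp only [defect, φ, i1, hTB, h1, hd (D.leftOut c)]
    have := hne (D.leftOut c) false
    field_simp
    linear_combination hk2
  have hflow := hN _ (D.faceDiff_mem hφ) fun y hy => by
    rw [← sub_eq_zero, weightedForm_sub_eq hφ hy]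
    simp [hdef]
  have hkTB : ∀ c, k (D.leftIn c) false = k (D.leftOut c) false := fun c => by
    have h1 := congrFun hflow c
    simp only [flow_apply, faceDiff_apply, Pi.zero_apply] at h1
    rw [(hφ c).1] at h1
    simp only [φ, hTB] at h1
    have h2 : (τ (D.leftOut c) false)⁻¹ * (k (D.leftIn c) false - k (D.leftOut c) false) = 0 := by
      linear_combination -h1
    exact sub_eq_zero.1 ((mul_eq_zero.1 h2).resolve_left (inv_ne_zero (hne _ _)))
  have hall := D.passage_induction' (P := fun q => k q true = 0 ∧ k q false = 0) p
    ⟨congrFun hp true, congrFun hp false⟩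
    (fun c ⟨a1, a2⟩ => by
      obtain ⟨k1, k2, k3, k4⟩ := (hk c).1
      have hk2 := (hk c).2
      rw [← hkTB, a1, a2] at hk2
      have : k (D.rightOut c) false = 0 := by
        have : t * k (D.rightOut c) false = 0 := by linear_combination hk2
        exact (mul_eq_zero.1 this).resolve_left ht
      exact ⟨by rw [← k3, ← hkTB, a2], this⟩)
    (fun c ⟨a1, a2⟩ => by
      obtain ⟨k1, k2, k3, k4⟩ := (hk c).1
      have hk2 := (hk c).2
      rw [← hkTB, k2, a1, ← k4, a2, k1] at hk2
      exact ⟨by linear_combination hk2, by rw [← hkTB, k2, a1]⟩)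
  exact funext fun q => funext fun b => by
    cases b
    · exact (hall q).2
    · exact (hall q).1

/-- A radical cycle is the boundary of some `φ` whose defect is a potential difference `m` between
Seifert circles. The flow-free correction `ν` with boundary `τ m` turns `τ φ` into a colouring. By
rigidity this equals the flow-free colouring with the same values at `p`, so `φ` has no flow either.
-/
lemma IsRigid.isNondegenerate (h : D.Planar) {t : ℂ} (ht : t ≠ 0) {w : Fin D.n → ℂ}
    {p : D.Passage} (hR : D.IsRigid t (colorParam t w) p) : D.IsNondegenerate t w := by
  intro x hx hrad
  have hn : D.n ≠ 0 := fun hn => by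
    have := p.1.2
    omega
  obtain ⟨τ, hτ, hne, hd⟩ := exists_exponential h hn ht
  have hTB : ∀ c, τ (D.leftIn c) false = τ (D.leftOut c) false := fun c => by
    obtain ⟨h1, h2, h3, h4⟩ := hτ c
    have := hd (D.leftIn c)
    rw [h1, hd] at this
    exact (mul_left_cancel₀ ht this).symm
  obtain ⟨φ, hφ, rfl⟩ := D.exists_faceDiff_eq h hn hx
  obtain ⟨m, hm⟩ := exists_seifert_potential (E := defect t w φ) fun y hy => by
    rw [← weightedForm_sub_eq hφ hy, sub_eq_zero]
    exact hrad y hy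
  have hM : (fun q => τ q false * m q) ∈ D.cyclesOver ℂ := fun c => by
    obtain ⟨h1, h2, h3, h4⟩ := hτ c
    simp only [hTB, (hm c).1, h4, (hm c).2.1]
  obtain ⟨ν, hν, hνM⟩ := D.exists_faceDiff_eq h hn hM
  have hνM : ∀ q, ν q true - ν q false = τ q false * m q := fun q => congrFun hνM q
  have hνTB : ∀ c, ν (D.leftIn c) false = ν (D.leftOut c) false := fun c => by
    have e1 := hνM (D.leftIn c)
    have e2 := hνM (D.leftOut c)
    rw [hTB, (hm c).1, ← e2, (hν c).1] at e1
    linear_combination -e1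
  have hη : D.IsColoring t (colorParam t w) (fun q b => τ q b * φ q b - ν q b) := fun c => by
    obtain ⟨h1, h2, h3, h4⟩ := hτ c
    obtain ⟨f1, f2, f3, f4⟩ := hφ c
    obtain ⟨n1, n2, n3, n4⟩ := hν c
    refine ⟨by simp only [IsCorner, h1, h2, h3, h4, f1, f2, f3, f4, n1, n2, n3, n4, and_self], ?_⟩
    have hE := (hm c).2.2
    have i1 : t * τ (D.rightOut c) false = τ (D.leftOut c) false := by rw [h3, hd]
    have e1 := hνM (D.leftOut c)
    have e2 := hνM (D.rightOut c)
    rw [← n3, ← (hm c).2.1] at e2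
    rw [← (hm c).1, n1.symm] at e1
    simp only [defect] at hE
    simp only [colorParam, hTB, hνTB, h1, hd (D.leftOut c)]
    rw [hνTB] at n2
    rw [← hTB] at i1
    rw [← hTB] at e1
    rw [← hTB]
    linear_combination (τ (D.leftIn c) false) * hE + (φ (D.rightOut c) false + m (D.rightIn c)) * i1 - e1 +
      t * e2
  obtain ⟨κ, hκ, hκp, hκTB⟩ := exists_trivial_coloring h hn ht (colorParam t w) p
    (fun b => τ p b * φ p b - ν p b)
  have h0 := hR _ (hη.sub hκ) (by rw [Pi.sub_apply, hκp, sub_self])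
  have heq : ∀ q b, τ q b * φ q b - ν q b = κ q b := fun q b =>
    sub_eq_zero.1 (congrFun (congrFun h0 q) b)
  ext c
  have e1 := heq (D.leftIn c) false
  rw [hκTB, ← heq, hTB, hνTB] at e1
  have e2 : φ (D.leftIn c) false = φ (D.leftOut c) false :=
    mul_left_cancel₀ (hne (D.leftOut c) false) (by linear_combination e1)
  simp only [flow_apply, faceDiff_apply, Pi.zero_apply]
  rw [e2, (hφ c).1, sub_self]

/-- At `t = 1` the weights drop out, and the relation says that the difference across a strand is
the same before and after a crossing. It vanishes at `p`, hence everywhere, and then all colours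
agree. This is what makes the form nonsingular at angle zero. -/
lemma isRigid_one (w : Fin D.n → ℂ) (p : D.Passage) :
    D.IsRigid 1 (colorParam 1 w) p := by
  intro k hk hp
  have hrel : ∀ c, k (D.leftIn c) true + k (D.rightOut c) false =
      k (D.leftIn c) false + k (D.leftOut c) false := fun c => by
    have := (hk c).2
    simp only [colorParam] at this
    linear_combination this
  have hd := D.passage_induction' (P := fun q => k q true = k q false) p
    (by rw [hp]; rfl)
    (fun c hc => by
      obtain ⟨k1, k2, k3, k4⟩ := (hk c).1
      linear_combination hc - hrel c - k3)
    (fun c hc => by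
      obtain ⟨k1, k2, k3, k4⟩ := (hk c).1
      linear_combination (hrel c) - k1 + k2 + hc + k4)
  have hall := D.passage_induction' (P := fun q => k q false = 0) p (congrFun hp false)
    (fun c hc => by
      obtain ⟨k1, k2, k3, k4⟩ := (hk c).1
      rw [← k4, ← hd, ← k2, hc])
    (fun c hc => by
      obtain ⟨k1, k2, k3, k4⟩ := (hk c).1
      rw [← hd, ← k1, hd, k2, hd, hc])
  exact funext fun q => funext fun b => by
    cases b
    · exact hall q
    · exact (hd q).trans (hall q)

end GaussCode

namespace GaussCode

variable (D : GaussCode)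

/-! ## The matrix of the weighted Seifert form -/

lemma seifertCycle_mem (i : Fin D.seifertRank) : D.seifertCycle i ∈ D.cycles :=
  (Classical.choose_spec (D.seifertBasis i).2).1

lemma bandFlow_seifertCycle (i : Fin D.seifertRank) :
    D.bandFlow (D.seifertCycle i) = D.seifertBasis i :=
  (Classical.choose_spec (D.seifertBasis i).2).2

/-- The flows of the basis cycles through the band at a crossing. -/
def flowVec (c : Fin D.n) (i : Fin D.seifertRank) : ℝ := D.bandFlow (D.seifertCycle i) c

/-- The matrix of the weighted Seifert form. -/
def wMatrix (w : Fin D.n → ℝ) : Matrix (Fin D.seifertRank) (Fin D.seifertRank) ℝ :=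
  Matrix.of fun i j => ∑ c, ((D.seifertCycle i (D.leftOut c) : ℝ) +
    w c * D.bandFlow (D.seifertCycle i) c) * D.bandFlow (D.seifertCycle j) c

/-- The weights that belong to the signs of the crossings. -/
def baseWeight (c : Fin D.n) : ℝ := if D.sign c = 1 then 0 else 1

/-- Weight `0` reads the left cycle on `leftOut`. Adding the flow once reads it on `leftIn`. These
are the two cases of `leftUnderEdge`. -/
lemma wMatrix_baseWeight : D.wMatrix D.baseWeight = D.seifertMatrix.map (Int.cast : ℤ → ℝ) := by
  ext i j
  simp only [wMatrix, seifertMatrix, seifertForm, Matrix.of_apply, Matrix.map_apply, Int.cast_sum]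
  refine Finset.sum_congr rfl fun c _ => ?_
  unfold baseWeight leftUnderEdge
  split_ifs
  · push_cast
    ring
  · have : D.bandFlow (D.seifertCycle i) c =
      D.seifertCycle i (D.leftIn c) - D.seifertCycle i (D.leftOut c) := rfl
    rw [this]
    push_cast
    ring

/-- A weight multiplies the product of the flows through its band. Varying weights is therefore a
rank one perturbation in the sense of `perturb`. -/
lemma wMatrix_add_sum {J : Type*} [Fintype J] (f : J → Fin D.n) (w : Fin D.n → ℝ) (v : J → ℝ) :
    D.wMatrix (w + ∑ j, v j • Pi.single (f j) 1) =
      D.wMatrix w + ∑ j, v j • Matrix.vecMulVec (D.flowVec (f j)) (D.flowVec (f j)) := by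
  ext a b
  simp only [wMatrix, Matrix.of_apply, Matrix.add_apply, Matrix.sum_apply, Matrix.smul_apply,
    Matrix.vecMulVec_apply, Pi.add_apply, Finset.sum_apply, Pi.smul_apply, smul_eq_mul, flowVec]
  have e : ∑ j, v j * ((D.bandFlow (D.seifertCycle a) (f j) : ℝ) *
      D.bandFlow (D.seifertCycle b) (f j)) =
      ∑ c, (∑ j, v j * (Pi.single (f j) 1 : Fin D.n → ℝ) c) * D.bandFlow (D.seifertCycle a) c *
        D.bandFlow (D.seifertCycle b) c := by
    simp only [Finset.sum_mul]
    rw [Finset.sum_comm]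
    refine Finset.sum_congr rfl fun j _ => ?_
    rw [Finset.sum_eq_single (f j)]
    · simp
      ring_nf
    · intro c _ hc
      simp [hc]
    · simp
  rw [e, ← Finset.sum_add_distrib]
  exact Finset.sum_congr rfl fun c _ => by ring

/-- The complex cycle with given coordinates. -/
def cycleOf : (Fin D.seifertRank → ℂ) →ₗ[ℂ] (D.Passage → ℂ) :=
  Fintype.linearCombination ℂ fun i p => (D.seifertCycle i p : ℂ)

lemma cycleOf_apply (u : Fin D.seifertRank → ℂ) (p : D.Passage) :
    D.cycleOf u p = ∑ i, u i * D.seifertCycle i p := by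
  simp [cycleOf, Fintype.linearCombination_apply]

lemma castCycle_mem {x : D.Passage → ℤ} (hx : x ∈ D.cycles) :
    (fun p => (x p : ℂ)) ∈ D.cyclesOver ℂ := fun c => by
  have := D.mem_cycles_iff.1 hx c
  dsimp only
  exact_mod_cast this

lemma cycleOf_mem (u : Fin D.seifertRank → ℂ) : D.cycleOf u ∈ D.cyclesOver ℂ := by
  rw [cycleOf, Fintype.linearCombination_apply]
  exact Submodule.sum_mem _ fun i _ =>
    Submodule.smul_mem _ _ (D.castCycle_mem (D.seifertCycle_mem i))

lemma flow_castCycle (x : D.Passage → ℤ) (c : Fin D.n) :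
    D.flow ℂ (fun p => (x p : ℂ)) c = D.bandFlow x c := by
  have : D.bandFlow x c = x (D.leftIn c) - x (D.leftOut c) := rfl
  rw [this, flow_apply]
  push_cast
  rfl

lemma flow_cycleOf (u : Fin D.seifertRank → ℂ) (c : Fin D.n) :
    D.flow ℂ (D.cycleOf u) c = pairing (D.flowVec c) u := by
  rw [cycleOf, Fintype.linearCombination_apply, map_sum, pairing_apply, Finset.sum_apply]
  refine Finset.sum_congr rfl fun i _ => ?_
  rw [map_smul, Pi.smul_apply, flow_castCycle, smul_eq_mul, mul_comm]
  simp [flowVec]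

/-- The flows through the bands separate the coordinate vectors. -/
lemma eq_zero_of_pairing_flowVec {u : Fin D.seifertRank → ℂ}
    (h : ∀ c, pairing (D.flowVec c) u = 0) : u = 0 := by
  let A : Matrix (Fin D.seifertRank) (Fin D.n) ℤ :=
    Matrix.of fun i c => D.bandFlow (D.seifertCycle i) c
  have hA : ∀ v, v ᵥ* A = 0 → v = 0 := fun v hv => by
    have h1 : ∑ i, v i • D.seifertBasis i = 0 := by
      apply Subtype.ext
      rw [Submodule.coe_sum]
      ext c
      have := congrFun hv c
      rw [Finset.sum_apply]
      simpa [Matrix.vecMul, dotProduct, A, bandFlow_seifertCycle] using this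
    exact funext (Fintype.linearIndependent_iff.1 D.seifertBasis.linearIndependent v h1)
  -- Independence over the integers makes the integral Gram determinant nonzero. It stays nonzero
  -- over the complex numbers, where positivity of the bilinear square is not available.
  have hdet : (A * Aᵀ).det ≠ 0 := fun h0 => by
    obtain ⟨v, hv, hv0⟩ := Matrix.exists_vecMul_eq_zero_iff.2 h0
    refine hv (hA v ?_)
    rw [← dotProduct_self_eq_zero]
    conv_lhs => rw [← Matrix.mulVec_transpose A v, Matrix.dotProduct_mulVec,
      Matrix.mulVec_transpose, Matrix.vecMul_vecMul, hv0]
    exact zero_dotProduct v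
  let B : Matrix (Fin D.seifertRank) (Fin D.n) ℂ := A.map (Int.castRingHom ℂ)
  have hdet' : (B * Bᵀ).det ≠ 0 := by
    have e : B * Bᵀ = (A * Aᵀ).map (Int.castRingHom ℂ) := by
      rw [Matrix.map_mul, Matrix.transpose_map]
    have := RingHom.map_det (Int.castRingHom ℂ) (A * Aᵀ)
    rw [RingHom.mapMatrix_apply, ← e] at this
    rw [← this]
    simpa using hdet
  by_contra hu
  refine hdet' (Matrix.exists_mulVec_eq_zero_iff.1 ⟨u, hu, ?_⟩)
  have : Bᵀ *ᵥ u = 0 := by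
    ext c
    have := h c
    rw [pairing_apply] at this
    simpa [Matrix.mulVec, dotProduct, B, A, flowVec] using this
  rw [← Matrix.mulVec_mulVec, this, Matrix.mulVec_zero]

lemma flow_int_mem_range {x : D.Passage → ℤ} (hx : x ∈ D.cycles) :
    ∃ u, D.flow ℂ (D.cycleOf u) = D.flow ℂ fun p => (x p : ℂ) := by
  let b : D.seifertHomology := ⟨D.bandFlow x, x, hx, rfl⟩
  refine ⟨fun i => (D.seifertBasis.repr b i : ℂ), ?_⟩
  ext c
  have h1 := congrArg (fun y : D.seifertHomology => y.1 c) (D.seifertBasis.sum_repr b)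
  simp only [Submodule.coe_sum, Finset.sum_apply, Submodule.coe_smul, Pi.smul_apply,
    smul_eq_mul] at h1
  rw [flow_castCycle, flow_cycleOf, pairing_apply]
  have h2 : D.bandFlow x c = (b : Fin D.n → ℤ) c := rfl
  rw [h2, ← h1]
  push_cast
  exact Finset.sum_congr rfl fun i _ => by rw [← bandFlow_seifertCycle, mul_comm]; simp [flowVec]

variable {D}

/-- The flows of the basis cycles span the flows of all complex cycles. -/
lemma exists_flow_cycleOf_eq (h : D.Planar) {y : D.Passage → ℂ} (hy : y ∈ D.cyclesOver ℂ) :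
    ∃ u, D.flow ℂ (D.cycleOf u) = D.flow ℂ y := by
  classical
  by_cases hn : D.n = 0
  · have : IsEmpty (Fin D.n) := by rw [hn]; infer_instance
    exact ⟨0, Subsingleton.elim _ _⟩
  obtain ⟨k, hk, rfl⟩ := D.exists_faceDiff_eq h hn hy
  have := Fintype.ofFinite D.Face
  let g : (D.Face → ℂ) →ₗ[ℂ] (Fin D.n → ℂ) :=
    (D.flow ℂ).comp ((D.faceDiff ℂ).comp
      ((D.faceFun ℂ).subtype.comp (D.faceFunEquiv ℂ).symm.toLinearMap))
  have hg : D.flow ℂ (D.faceDiff ℂ k) = g (D.faceFunEquiv ℂ ⟨k, hk⟩) := rfl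
  -- Indicator functions of single faces span, and their boundaries are integral cycles.
  have hmem : ∀ κ, g κ ∈ LinearMap.range ((D.flow ℂ).comp D.cycleOf) := fun κ => by
    rw [LinearMap.pi_apply_eq_sum_univ g κ]
    refine Submodule.sum_mem _ fun f _ => Submodule.smul_mem _ _ ?_
    let s : D.faceFun ℤ := (D.faceFunEquiv ℤ).symm fun f' => if f = f' then 1 else 0
    obtain ⟨u, hu⟩ := D.flow_int_mem_range (D.mem_cycles_iff.2 (D.faceDiff_mem s.2))
    refine ⟨u, hu.trans ?_⟩
    change _ = (D.flow ℂ) (D.faceDiff ℂ _)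
    congr 1
    ext p
    simp only [faceDiff_apply]
    push_cast
    simp [s, faceFunEquiv]
  obtain ⟨u, hu⟩ := hmem (D.faceFunEquiv ℂ ⟨k, hk⟩)
  exact ⟨u, hu.trans hg.symm⟩

lemma weightedForm_sub_left (w : Fin D.n → ℂ) (x x' y : D.Passage → ℂ) :
    D.weightedForm w (x - x') y = D.weightedForm w x y - D.weightedForm w x' y := by
  simp only [weightedForm, map_sub, Pi.sub_apply, ← Finset.sum_sub_distrib]
  exact Finset.sum_congr rfl fun c _ => by ring

lemma weightedForm_sub_right (w : Fin D.n → ℂ) (x y y' : D.Passage → ℂ) :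
    D.weightedForm w x (y - y') = D.weightedForm w x y - D.weightedForm w x y' := by
  simp only [weightedForm, map_sub, Pi.sub_apply, ← Finset.sum_sub_distrib]
  exact Finset.sum_congr rfl fun c _ => by ring

/-- Representing cycles were chosen arbitrarily. The form depends on them only through their flows.
-/
lemma weightedForm_congr (h : D.Planar) {w : Fin D.n → ℂ} {x x' y y' : D.Passage → ℂ}
    (hx : x ∈ D.cyclesOver ℂ) (hx' : x' ∈ D.cyclesOver ℂ) (hy : y ∈ D.cyclesOver ℂ)
    (hxx : D.flow ℂ x = D.flow ℂ x') (hyy : D.flow ℂ y = D.flow ℂ y') :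
    D.weightedForm w x y = D.weightedForm w x' y' := by
  have h1 := weightedForm_eq_zero_left h (w := w) (Submodule.sub_mem _ hx hx') hy
    (by rw [map_sub, hxx, sub_self])
  have h2 := weightedForm_eq_zero_right (w := w) (x := x') (y := y - y')
    (by rw [map_sub, hyy, sub_self])
  rw [weightedForm_sub_left] at h1
  rw [weightedForm_sub_right] at h2
  linear_combination h1 + h2

lemma wMatrix_apply_eq (w : Fin D.n → ℝ) (i j : Fin D.seifertRank) :
    ((D.wMatrix w i j : ℝ) : ℂ) = D.weightedForm (fun c => (w c : ℂ))
      (fun p => (D.seifertCycle i p : ℂ)) (fun p => (D.seifertCycle j p : ℂ)) := by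
  simp only [wMatrix, Matrix.of_apply, weightedForm, flow_castCycle]
  push_cast
  rfl

lemma weightedForm_cycleOf_left (w : Fin D.n → ℂ) (u : Fin D.seifertRank → ℂ)
    (y : D.Passage → ℂ) : D.weightedForm w (D.cycleOf u) y =
      ∑ i, u i * D.weightedForm w (fun p => (D.seifertCycle i p : ℂ)) y := by
  simp only [weightedForm, flow_cycleOf, cycleOf_apply, pairing_apply, flow_castCycle,
    Finset.mul_sum (s := (Finset.univ : Finset (Fin D.n)))]
  rw [Finset.sum_comm]
  refine Finset.sum_congr rfl fun c _ => ?_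
  rw [Finset.mul_sum, ← Finset.sum_add_distrib, Finset.sum_mul]
  refine Finset.sum_congr rfl fun i _ => ?_
  simp only [flowVec]
  push_cast
  ring

lemma weightedForm_cycleOf_right (w : Fin D.n → ℂ) (u : Fin D.seifertRank → ℂ)
    (y : D.Passage → ℂ) : D.weightedForm w y (D.cycleOf u) =
      ∑ i, u i * D.weightedForm w y (fun p => (D.seifertCycle i p : ℂ)) := by
  simp only [weightedForm, flow_cycleOf, pairing_apply, flow_castCycle,
    Finset.mul_sum (s := (Finset.univ : Finset (Fin D.n)))]
  rw [Finset.sum_comm]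
  refine Finset.sum_congr rfl fun c _ => ?_
  rw [Finset.mul_sum]
  refine Finset.sum_congr rfl fun i _ => ?_
  simp only [flowVec]
  push_cast
  ring

lemma vecMul_twist_wMatrix (θ : ℝ) (w : Fin D.n → ℝ) (u : Fin D.seifertRank → ℂ)
    (j : Fin D.seifertRank) : ∃ a : ℂ, a ≠ 0 ∧ (u ᵥ* twist θ (D.wMatrix w)) j =
      a * (Complex.exp (θ * Complex.I) *
        D.weightedForm (fun c => (w c : ℂ)) (D.cycleOf u) (fun p => (D.seifertCycle j p : ℂ)) -
        D.weightedForm (fun c => (w c : ℂ)) (fun p => (D.seifertCycle j p : ℂ)) (D.cycleOf u)) := by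
  refine ⟨-Complex.I * Complex.exp (-(θ / 2) * Complex.I),
    mul_ne_zero (neg_ne_zero.2 Complex.I_ne_zero) (Complex.exp_ne_zero _), ?_⟩
  rw [weightedForm_cycleOf_left, weightedForm_cycleOf_right, Finset.mul_sum,
    ← Finset.sum_sub_distrib, Finset.mul_sum]
  simp only [Matrix.vecMul, dotProduct, twist_apply, wMatrix_apply_eq]
  refine Finset.sum_congr rfl fun i _ => ?_
  ring_nf

/-- Kernel vectors of the matrix are the flows of radical cycles. The result no longer mentions the
chosen homology basis, which two diagrams cannot share. -/
lemma det_twist_wMatrix_ne_zero_iff (h : D.Planar) (θ : ℝ) (w : Fin D.n → ℝ) :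
    (twist θ (D.wMatrix w)).det ≠ 0 ↔
      D.IsNondegenerate (Complex.exp (θ * Complex.I)) fun c => (w c : ℂ) := by
  constructor
  · intro hdet x hx hrad
    obtain ⟨u, hu⟩ := exists_flow_cycleOf_eq h hx
    have : u = 0 := by
      by_contra hne
      refine hdet (Matrix.exists_vecMul_eq_zero_iff.1 ⟨u, hne, ?_⟩)
      ext j
      obtain ⟨a, -, e⟩ := vecMul_twist_wMatrix θ w u j
      have hj := D.castCycle_mem (D.seifertCycle_mem j)
      rw [e, weightedForm_congr h (D.cycleOf_mem u) hx hj hu rfl,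
        weightedForm_congr h hj hj (D.cycleOf_mem u) rfl hu, hrad _ hj]
      simp
    rw [← hu, this, map_zero, map_zero]
  · intro hN hdet
    obtain ⟨u, hne, hu⟩ := Matrix.exists_vecMul_eq_zero_iff.2 hdet
    have hrad : ∀ j, Complex.exp (θ * Complex.I) *
        D.weightedForm (fun c => (w c : ℂ)) (D.cycleOf u) (fun p => (D.seifertCycle j p : ℂ)) =
        D.weightedForm (fun c => (w c : ℂ)) (fun p => (D.seifertCycle j p : ℂ)) (D.cycleOf u) :=
      fun j => by
        obtain ⟨a, ha, e⟩ := vecMul_twist_wMatrix θ w u j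
        rw [hu] at e
        exact sub_eq_zero.1 ((mul_eq_zero.1 e.symm).resolve_left ha)
    have h0 := hN _ (D.cycleOf_mem u) fun y hy => by
      obtain ⟨v, hv⟩ := exists_flow_cycleOf_eq h hy
      have hv' := D.cycleOf_mem v
      have hu' := D.cycleOf_mem u
      rw [← weightedForm_congr h hu' hu' hv' rfl hv, ← weightedForm_congr h hv' hy hu' hv rfl,
        weightedForm_cycleOf_left _ v, weightedForm_cycleOf_right _ v, Finset.mul_sum]
      refine Finset.sum_congr rfl fun i _ => ?_
      rw [← hrad]
      ring
    exact hne (D.eq_zero_of_pairing_flowVec fun c => by rw [← flow_cycleOf, h0]; rfl)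

/-- The Hermitian form of a diagram is nonsingular at the angle zero. -/
lemma det_twist_zero_ne_zero (h : D.Planar) (w : Fin D.n → ℝ) :
    (twist 0 (D.wMatrix w)).det ≠ 0 := by
  rw [det_twist_wMatrix_ne_zero_iff h]
  by_cases hn : D.n = 0
  · have : IsEmpty (Fin D.n) := by rw [hn]; infer_instance
    exact fun x _ _ => Subsingleton.elim _ _
  have e : Complex.exp ((0 : ℝ) * Complex.I) = 1 := by simp
  rw [e]
  exact (isRigid_one _ (⟨0, Nat.pos_of_ne_zero hn⟩, true)).isNondegenerate h one_ne_zero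

lemma twist_add_sum_rankOne {m : ℕ} {J : Type*} [Fintype J] (θ : ℝ)
    (V : Matrix (Fin m) (Fin m) ℝ) (v : J → ℝ) (q : J → Fin m → ℝ) :
    twist θ (V + ∑ j, v j • Matrix.vecMulVec (q j) (q j)) =
      perturb (twist θ V) q fun j => 2 * Real.sin (θ / 2) * v j := by
  classical
  rw [perturb]
  generalize (Finset.univ : Finset J) = s
  induction s using Finset.induction_on with
  | empty => simp
  | insert j s hj ih =>
    rw [Finset.sum_insert hj, Finset.sum_insert hj, add_comm (v j • _), ← add_assoc,
      twist_add_rankOne, ih, add_comm (_ • rankOne (q j)), ← add_assoc]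

/-- Inside the interval `2 sin(θ/2)` is nonzero, so every rank one perturbation in the directions
`flowVec` comes from a change of weights. -/
lemma perturb_twist_wMatrix {J : Type*} [Fintype J] {θ : ℝ} (hθ : θ ∈ Set.Ioo 0 (2 * Real.pi))
    (w : Fin D.n → ℝ) (f : J → Fin D.n) (v : J → ℝ) :
    perturb (twist θ (D.wMatrix w)) (fun j => D.flowVec (f j)) v =
      twist θ (D.wMatrix (w + ∑ j, (v j / (2 * Real.sin (θ / 2))) • Pi.single (f j) 1)) := by
  rw [wMatrix_add_sum, twist_add_sum_rankOne]
  congr 1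
  ext j
  have := (sin_half_pos hθ).ne'
  rw [mul_comm, div_mul_cancel₀ _ this]

end GaussCode

namespace GaussCode

/-! ## Comparison of two diagrams -/

/-- The Hermitian forms of the two diagrams are singular at the same angles, and have the same
signature elsewhere. -/
def SameSignature (D E : GaussCode) : Prop :=
  ∀ x ∈ Set.Ioo 0 (2 * Real.pi),
    ((twist x (D.wMatrix D.baseWeight)).det = 0 ↔ (twist x (E.wMatrix E.baseWeight)).det = 0) ∧
    ((twist x (D.wMatrix D.baseWeight)).det ≠ 0 →
      sigIdx (twist x (D.wMatrix D.baseWeight)) = sigIdx (twist x (E.wMatrix E.baseWeight)))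

variable {D E : GaussCode}

lemma SameSignature.symm (h : SameSignature D E) : SameSignature E D := fun x hx =>
  ⟨(h x hx).1.symm, fun h0 => ((h x hx).2 fun h1 => h0 ((h x hx).1.1 h1)).symm⟩

lemma SameSignature.trans {F : GaussCode} (h : SameSignature D E) (h' : SameSignature E F) :
    SameSignature D F := fun x hx =>
  ⟨(h x hx).1.trans (h' x hx).1, fun h0 =>
    ((h x hx).2 h0).trans ((h' x hx).2 fun h1 => h0 ((h x hx).1.2 h1))⟩

/-- For a parameter as in `exists_perturb_ker`, a kernel vector has no flow through any band and
hence vanishes. -/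
lemma exists_perturb_twist_det_ne_zero (x : ℝ) :
    ∃ v, (perturb (twist x (D.wMatrix D.baseWeight)) D.flowVec v).det ≠ 0 := by
  obtain ⟨v, hv⟩ := exists_perturb_ker (twist_isHermitian x (D.wMatrix D.baseWeight)) D.flowVec
  refine ⟨v, fun h0 => ?_⟩
  obtain ⟨u, hu, h0⟩ := Matrix.exists_mulVec_eq_zero_iff.2 h0
  exact hu (D.eq_zero_of_pairing_flowVec (hv u h0))

lemma sum_smul_single_apply {J : Type*} [Fintype J] {f : J → Fin D.n} (hf : Function.Injective f)
    (v : J → ℝ) (j : J) : (∑ i, v i • (Pi.single (f i) 1 : Fin D.n → ℝ)) (f j) = v j := by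
  classical
  rw [Finset.sum_apply, Finset.sum_eq_single j]
  · simp
  · intro b _ hb
    simp [hf.eq_iff, hb.symm]
  · simp

lemma sum_smul_single_apply_of_notMem {J : Type*} [Fintype J] {f : J → Fin D.n}
    (v : J → ℝ) {c : Fin D.n} (hc : c ∉ Set.range f) :
    (∑ i, v i • (Pi.single (f i) 1 : Fin D.n → ℝ)) c = 0 := by
  rw [Finset.sum_apply, Finset.sum_eq_zero]
  intro b _
  have : c ≠ f b := fun h => hc ⟨b, h.symm⟩
  simp [this]

/-- The weights at the crossings of `D` serve as common free parameters, and the additional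
crossings of `E` keep their actual weights. Some parameter is nonsingular at each angle, so the
comparison of families reaches the whole interval. -/
lemma sameSignature_of_isNondegenerate_iff (hD : D.Planar) (hE : E.Planar)
    {f : Fin D.n → Fin E.n} (hf : Function.Injective f) (hs : ∀ c, E.sign (f c) = D.sign c)
    (H : ∀ t ≠ 0, ∀ w : Fin E.n → ℂ, (∀ c ∉ Set.range f, w c = E.baseWeight c) →
      (D.IsNondegenerate t (w ∘ f) ↔ E.IsNondegenerate t w)) : SameSignature D E := by
  have key : ∀ θ ∈ Set.Ioo 0 (2 * Real.pi), ∀ v : Fin D.n → ℝ,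
      (perturb (twist θ (D.wMatrix D.baseWeight)) D.flowVec v).det = 0 ↔
      (perturb (twist θ (E.wMatrix E.baseWeight)) (fun j => E.flowVec (f j)) v).det = 0 := by
    intro θ hθ v
    have e : perturb (twist θ (D.wMatrix D.baseWeight)) D.flowVec v = _ :=
      perturb_twist_wMatrix hθ _ id _
    rw [perturb_twist_wMatrix hθ _ f, e, ← not_iff_not, ← ne_eq, ← ne_eq,
      det_twist_wMatrix_ne_zero_iff hD,
      det_twist_wMatrix_ne_zero_iff hE, ← H _ (Complex.exp_ne_zero _)]
    · refine iff_of_eq (congrArg _ (funext fun c => ?_))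
      rw [Function.comp_apply, Pi.add_apply, Pi.add_apply, sum_smul_single_apply hf,
        show (∑ j, (v j / (2 * Real.sin (θ / 2))) • (Pi.single (id j) 1 : Fin D.n → ℝ)) c = _ from
          sum_smul_single_apply Function.injective_id _ c]
      simp [baseWeight, hs]
    · intro c hc
      rw [Pi.add_apply, sum_smul_single_apply_of_notMem _ hc, add_zero]
  have h0 : ∀ {D : GaussCode} (V : Matrix (Fin D.seifertRank) (Fin D.seifertRank) ℂ)
      {J : Type} [Fintype J] (q : J → Fin D.seifertRank → ℝ), perturb V q 0 = V := by
    intros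
    simp [perturb]
  have hdet : ∀ θ ∈ Set.Ioo 0 (2 * Real.pi), (twist θ (D.wMatrix D.baseWeight)).det = 0 ↔
      (twist θ (E.wMatrix E.baseWeight)).det = 0 := fun θ hθ => by
    have := key θ hθ 0
    rwa [h0, h0] at this
  refine fun x hx => ⟨hdet x hx, fun hne => ?_⟩
  refine sigIdx_twist_eq (det_twist_zero_ne_zero hD _) (det_twist_zero_ne_zero hE _)
    (fun y hy => ?_) hx hne (fun h => hne ((hdet x hx).2 h))
  obtain ⟨v, hv⟩ := exists_perturb_twist_det_ne_zero (D := D) y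
  exact sigDiffConstAt_of_perturb (det_twist_zero_ne_zero hD _) _ _ key hy hv

/-! ## Erasing crossings -/

/-- The edges in `M` are the ones that are contained in the stretches of a move, and all passages
through the crossings in `S` are ends of such stretches. -/
structure IsStretch (E : GaussCode) (S : Set (Fin E.n)) (M : Set E.Passage) : Prop where
  mem_iff : ∀ p, p.1 ∈ S ↔ p ∈ M ∨ E.inEdge p ∈ M
  next_notMem : ∀ p ∈ M, E.next p ∉ M

open Classical in
/-- The colours, where the colour of an edge in `M` is replaced by the previous colour. -/
def passColor (E : GaussCode) (M : Set E.Passage) :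
    (E.Passage → Bool → ℂ) →ₗ[ℂ] (E.Passage → Bool → ℂ) where
  toFun k p := if p ∈ M then k (E.inEdge p) else k p
  map_add' k k' := by
    ext p b
    simp only [Pi.add_apply]
    split_ifs <;> rfl
  map_smul' r k := by
    ext p b
    simp only [Pi.smul_apply, RingHom.id_apply]
    split_ifs <;> rfl

section erasure

variable {S : Set (Fin E.n)} {M : Set E.Passage}

lemma passColor_of_notMem {k : E.Passage → Bool → ℂ} {p : E.Passage} (hp : p ∉ M) :
    E.passColor M k p = k p := if_neg hp

lemma passColor_of_mem {k : E.Passage → Bool → ℂ} {p : E.Passage} (hp : p ∈ M) :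
    E.passColor M k p = k (E.inEdge p) := if_pos hp

lemma next_inEdge (p : E.Passage) : E.next (E.inEdge p) = p := E.next.apply_symm_apply p

lemma inEdge_next (p : E.Passage) : E.inEdge (E.next p) = p := E.next.symm_apply_apply p

lemma IsStretch.passColor_inEdge (hM : E.IsStretch S M) {k : E.Passage → Bool → ℂ}
    (hk : ∀ p ∈ M, k (E.next p) = k (E.inEdge p)) {p : E.Passage} (hp : p.1 ∈ S) :
    E.passColor M k p = E.passColor M k (E.inEdge p) := by
  rcases (hM.mem_iff p).1 hp with h | h
  · rw [passColor_of_mem h, passColor_of_notMem]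
    intro h'
    have := hM.next_notMem _ h'
    rw [next_inEdge] at this
    exact this h
  · rw [passColor_of_mem h, passColor_of_notMem, ← hk _ h, next_inEdge]
    have := hM.next_notMem _ h
    rwa [next_inEdge] at this

lemma IsStretch.passColor_of_notMem (hM : E.IsStretch S M) {k : E.Passage → Bool → ℂ}
    {p : E.Passage} (hp : p.1 ∉ S) : E.passColor M k p = k p :=
  GaussCode.passColor_of_notMem fun h => hp ((hM.mem_iff p).2 (Or.inl h))

lemma IsStretch.passColor_inEdge_of_notMem (hM : E.IsStretch S M) {k : E.Passage → Bool → ℂ}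
    {p : E.Passage} (hp : p.1 ∉ S) : E.passColor M k (E.inEdge p) = k (E.inEdge p) :=
  GaussCode.passColor_of_notMem fun h => hp ((hM.mem_iff p).2 (Or.inr h))

/-- The colour relations at the crossings of `S`. -/
def dehnDefect (E : GaussCode) (S : Set (Fin E.n)) (t : ℂ) (u : Fin E.n → ℂ) :
    (E.Passage → Bool → ℂ) →ₗ[ℂ] (S → ℂ) where
  toFun k c := k (E.leftIn c) true + t * k (E.rightOut c) false -
    (u c * k (E.leftIn c) false + (1 + t - u c) * k (E.leftOut c) false)
  map_add' k k' := by
    ext c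
    simp only [Pi.add_apply]
    ring
  map_smul' r k := by
    ext c
    simp only [Pi.smul_apply, smul_eq_mul, RingHom.id_apply]
    ring

lemma isDehn_of_dehnDefect {t : ℂ} {u : Fin E.n → ℂ} {k : E.Passage → Bool → ℂ}
    (hk : k ∈ E.faceFun ℂ) (h : E.dehnDefect S t u k = 0) {c : Fin E.n} (hc : c ∈ S) :
    IsDehn t (u c) (k (E.leftIn c)) (k (E.leftOut c)) (k (E.rightIn c)) (k (E.rightOut c)) :=
  ⟨hk c, sub_eq_zero.1 (congrFun h ⟨c, hc⟩)⟩

lemma IsColoring.dehnDefect_eq_zero {t : ℂ} {u : Fin E.n → ℂ} {k : E.Passage → Bool → ℂ}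
    (hk : E.IsColoring t u k) : E.dehnDefect S t u k = 0 :=
  funext fun c => sub_eq_zero.2 (hk c).2

/-- The colour relations at the crossings in `S` imply that the colours do not change along the
stretches, and determine the colours inside. -/
structure IsTransparent (E : GaussCode) (S : Set (Fin E.n)) (M : Set E.Passage) (t : ℂ)
    (u : Fin E.n → ℂ) : Prop extends E.IsStretch S M where
  pass : ∀ k ∈ E.faceFun ℂ, E.dehnDefect S t u k = 0 → ∀ p ∈ M, k (E.next p) = k (E.inEdge p)
  inside : ∀ k ∈ E.faceFun ℂ, E.dehnDefect S t u k = 0 → (∀ p ∉ M, k p = 0) → k = 0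

/-- The colours of the edges after the erasure. -/
def restrictColor (M : Set E.Passage) (f : Fin D.n → Fin E.n) :
    (E.Passage → Bool → ℂ) →ₗ[ℂ] (D.Passage → Bool → ℂ) where
  toFun k p := E.passColor M k (f p.1, p.2)
  map_add' k k' := by rw [map_add]; rfl
  map_smul' r k := by rw [map_smul]; rfl

variable {t : ℂ} {u : Fin E.n → ℂ} {f : Fin D.n → Fin E.n}

lemma leftOut_map (hs : ∀ c, E.sign (f c) = D.sign c) (c : Fin D.n) :
    E.leftOut (f c) = (f (D.leftOut c).1, (D.leftOut c).2) := by
  unfold leftOut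
  rw [hs]
  split_ifs <;> rfl

lemma rightOut_map (hs : ∀ c, E.sign (f c) = D.sign c) (c : Fin D.n) :
    E.rightOut (f c) = (f (D.rightOut c).1, (D.rightOut c).2) := by
  unfold rightOut
  rw [hs]
  split_ifs <;> rfl

/-- The passed colour does not change at the erased crossings, so the edge entering the next
surviving crossing has the colour of the edge that replaces the whole stretch. -/
lemma IsTransparent.passColor_next (hT : E.IsTransparent S M t u) (hr : Set.range f = Sᶜ)
    (hnext : ∀ p : D.Passage, ∃ k : ℕ,
      (E.next ^ (k + 1)) (f p.1, p.2) = (f (D.next p).1, (D.next p).2) ∧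
      ∀ i < k, ((E.next ^ (i + 1)) (f p.1, p.2)).1 ∈ S)
    {k : E.Passage → Bool → ℂ} (hk : k ∈ E.faceFun ℂ) (hd : E.dehnDefect S t u k = 0)
    (p : D.Passage) :
    k (E.inEdge (f (D.next p).1, (D.next p).2)) = restrictColor M f k p := by
  obtain ⟨n, h1, h2⟩ := hnext p
  have hnS : (f (D.next p).1) ∉ S := by
    have : f (D.next p).1 ∈ Sᶜ := hr ▸ Set.mem_range_self _
    exact this
  rw [← hT.passColor_inEdge_of_notMem (k := k) (p := (f (D.next p).1, (D.next p).2)) hnS,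
      ← h1, pow_succ',
    Equiv.Perm.mul_apply, inEdge_next]
  have : ∀ i ≤ n, E.passColor M k ((E.next ^ i) (f p.1, p.2)) =
      E.passColor M k (f p.1, p.2) := fun i => by
    induction i with
    | zero => intro _; rfl
    | succ i ih =>
      intro hi
      rw [hT.passColor_inEdge (hT.pass k hk hd) (h2 i (by omega)), pow_succ',
        Equiv.Perm.mul_apply, inEdge_next]
      exact ih (by omega)
  exact this n le_rfl

lemma IsTransparent.restrictColor_apply (hT : E.IsTransparent S M t u) (hr : Set.range f = Sᶜ)
    (hs : ∀ c, E.sign (f c) = D.sign c)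
    (hnext : ∀ p : D.Passage, ∃ k : ℕ,
      (E.next ^ (k + 1)) (f p.1, p.2) = (f (D.next p).1, (D.next p).2) ∧
      ∀ i < k, ((E.next ^ (i + 1)) (f p.1, p.2)).1 ∈ S)
    {k : E.Passage → Bool → ℂ} (hk : k ∈ E.faceFun ℂ) (hd : E.dehnDefect S t u k = 0)
    (c : Fin D.n) :
    restrictColor M f k (D.leftIn c) = k (E.leftIn (f c)) ∧
    restrictColor M f k (D.leftOut c) = k (E.leftOut (f c)) ∧
    restrictColor M f k (D.rightIn c) = k (E.rightIn (f c)) ∧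
    restrictColor M f k (D.rightOut c) = k (E.rightOut (f c)) := by
  have hout : ∀ p : D.Passage, restrictColor M f k p = k (f p.1, p.2) := fun p => by
    refine hT.passColor_of_notMem (p := (f p.1, p.2)) ?_
    have : f p.1 ∈ Sᶜ := hr ▸ Set.mem_range_self _
    exact this
  refine ⟨?_, ?_, ?_, ?_⟩
  · rw [← hT.passColor_next hr hnext hk hd, next_leftIn, ← rightOut_map hs, ← next_leftIn,
      inEdge_next]
  · rw [hout, leftOut_map hs]
  · rw [← hT.passColor_next hr hnext hk hd, next_rightIn, ← leftOut_map hs, ← next_rightIn,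
      inEdge_next]
  · rw [hout, rightOut_map hs]

lemma IsTransparent.eq_zero (hT : E.IsTransparent S M t u) (hr : Set.range f = Sᶜ)
    {k : E.Passage → Bool → ℂ} (hk : k ∈ E.faceFun ℂ) (hd : E.dehnDefect S t u k = 0)
    (h0 : restrictColor M f k = 0) {p₀ : E.Passage} (hp₀ : E.passColor M k p₀ = 0) : k = 0 := by
  refine hT.inside k hk hd fun p hp => ?_
  rw [← GaussCode.passColor_of_notMem (k := k) hp]
  refine E.passage_induction (P := fun p => E.passColor M k p = 0) p₀ hp₀ (fun q hq => ?_) p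
  by_cases hS : (E.next q).1 ∈ S
  · rw [hT.passColor_inEdge (hT.pass k hk hd) hS, inEdge_next, hq]
  · have : (E.next q).1 ∈ Set.range f := hr ▸ hS
    obtain ⟨c, hc⟩ := this
    have h1 := congrFun h0 (c, (E.next q).2)
    change E.passColor M k (f c, (E.next q).2) = 0 at h1
    rwa [hc] at h1

/-- Restriction sends colourings of `E` to colourings of `D` injectively, which gives one direction.
For the other one colourings must be extended. This is done by counting dimensions instead of an
explicit construction. -/
lemma IsTransparent.isNondegenerate_iff (hD : D.Planar) (hE : E.Planar) (ht : t ≠ 0)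
    {w : Fin E.n → ℂ} (hT : E.IsTransparent S M t (colorParam t w)) (hf : Function.Injective f)
    (hr : Set.range f = Sᶜ) (hs : ∀ c, E.sign (f c) = D.sign c)
    (hnext : ∀ p : D.Passage, ∃ k : ℕ,
      (E.next ^ (k + 1)) (f p.1, p.2) = (f (D.next p).1, (D.next p).2) ∧
      ∀ i < k, ((E.next ^ (i + 1)) (f p.1, p.2)).1 ∈ S) :
    D.IsNondegenerate t (w ∘ f) ↔ E.IsNondegenerate t w := by
  classical
  by_cases hEn : E.n = 0
  · have : IsEmpty (Fin E.n) := by rw [hEn]; infer_instance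
    have : IsEmpty (Fin D.n) := ⟨fun c => isEmptyElim (f c)⟩
    exact ⟨fun _ _ _ _ => Subsingleton.elim _ _, fun _ _ _ _ => Subsingleton.elim _ _⟩
  -- A code without crossings has no edge at which to start. Rigidity of `E` is tested at an edge
  -- that is not inside a stretch.
  by_cases hDn : D.n = 0
  · have : IsEmpty (Fin D.n) := by rw [hDn]; infer_instance
    refine iff_of_true (fun _ _ _ => Subsingleton.elim _ _) ?_
    let q₀ : E.Passage := (⟨0, Nat.pos_of_ne_zero hEn⟩, true)
    obtain ⟨p₀, hp₀⟩ : ∃ p₀, p₀ ∉ M := by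
      by_cases h : q₀ ∈ M
      · exact ⟨_, hT.next_notMem _ h⟩
      · exact ⟨_, h⟩
    refine IsRigid.isNondegenerate hE ht (p := p₀) fun k hk hkp => ?_
    refine hT.eq_zero hr hk.mem_faceFun hk.dehnDefect_eq_zero (funext fun p => isEmptyElim p.1)
      (p₀ := p₀) ?_
    rw [passColor_of_notMem hp₀, hkp]
  let p₀ : D.Passage := (⟨0, Nat.pos_of_ne_zero hDn⟩, true)
  have hp₀ : ∀ k, restrictColor M f k p₀ = k (f p₀.1, p₀.2) := fun k => by
    refine hT.passColor_of_notMem (p := (f p₀.1, p₀.2)) ?_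
    have : f p₀.1 ∈ Sᶜ := hr ▸ Set.mem_range_self _
    exact this
  constructor
  · intro hN
    refine IsRigid.isNondegenerate hE ht (p := (f p₀.1, p₀.2)) fun k hk hkp => ?_
    have h0 := hN.isRigid hD ht p₀ (restrictColor M f k) (fun c => by
      obtain ⟨h1, h2, h3, h4⟩ := hT.restrictColor_apply hr hs hnext hk.mem_faceFun
        hk.dehnDefect_eq_zero c
      rw [h1, h2, h3, h4]
      exact hk (f c)) (by rw [hp₀, hkp])
    refine hT.eq_zero hr hk.mem_faceFun hk.dehnDefect_eq_zero h0 (p₀ := (f p₀.1, p₀.2)) ?_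
    exact congrFun h0 p₀
  · intro hN
    refine IsRigid.isNondegenerate hD ht (p := p₀) fun κ hκ hκp => ?_
    let g : E.faceFun ℂ →ₗ[ℂ] (S → ℂ) :=
      (E.dehnDefect S t (colorParam t w)).comp (E.faceFun ℂ).subtype
    let r : LinearMap.ker g →ₗ[ℂ] D.faceFun ℂ :=
      { toFun := fun k => ⟨restrictColor M f k.1.1, fun c => by
          obtain ⟨h1, h2, h3, h4⟩ := hT.restrictColor_apply hr hs hnext k.1.2
            (LinearMap.mem_ker.1 k.2) c
          rw [h1, h2, h3, h4]
          exact k.1.2 (f c)⟩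
        map_add' := fun k k' => Subtype.ext (map_add (restrictColor M f) k.1.1 k'.1.1)
        map_smul' := fun a k => Subtype.ext (map_smul (restrictColor M f) a k.1.1) }
    have hrinj : Function.Injective r := by
      intro k k' hkk
      have h1 : restrictColor M f k.1.1 = restrictColor M f k'.1.1 := congrArg Subtype.val hkk
      have h2 := hT.eq_zero hr (k := k.1.1 - k'.1.1) (Submodule.sub_mem _ k.1.2 k'.1.2)
        (by
          have e1 : E.dehnDefect S t (colorParam t w) k.1.1 = 0 := LinearMap.mem_ker.1 k.2
          have e2 : E.dehnDefect S t (colorParam t w) k'.1.1 = 0 := LinearMap.mem_ker.1 k'.2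
          rw [map_sub, e1, e2, sub_self])
        (by rw [map_sub, h1, sub_self]) (p₀ := (f p₀.1, p₀.2))
        (by
          have := congrFun h1 p₀
          rw [map_sub, Pi.sub_apply, sub_eq_zero]
          exact this)
      exact Subtype.ext (Subtype.ext (sub_eq_zero.1 h2))
    have hcard : Fintype.card S + D.n = E.n := by
      have h1 := Fintype.card_compl_set S
      have h2 := Set.card_range_of_injective hf
      have h3 : Fintype.card (Sᶜ : Set (Fin E.n)) = D.n := by
        rw [← Fintype.card_fin D.n, ← h2]
        exact Fintype.card_congr (Equiv.setCongr hr.symm)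
      have h4 := set_fintype_card_le_univ S
      rw [h3, Fintype.card_fin] at h1
      rw [Fintype.card_fin] at h4
      omega
    have hle := LinearMap.finrank_le_finrank_of_injective hrinj
    have hker := LinearMap.finrank_range_add_finrank_ker g
    have hrange := (LinearMap.range g).finrank_le
    rw [Module.finrank_fintype_fun_eq_card] at hrange
    rw [E.finrank_faceFun hE hEn] at hker
    rw [D.finrank_faceFun hD hDn] at hle
    have heq : Module.finrank ℂ (LinearMap.ker g) = Module.finrank ℂ (D.faceFun ℂ) := by
      rw [D.finrank_faceFun hD hDn]
      omega
    -- The relations at the crossings of `S` cut the `E.n + 2` dimensions by at most the number of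
    -- these crossings, leaving at least `D.n + 2`. An injection into a space of that dimension is
    -- onto.
    have hsurj : Function.Surjective r := by
      rw [← LinearMap.range_eq_top]
      exact Submodule.eq_top_of_finrank_eq ((LinearMap.finrank_range_of_inj hrinj).trans heq)
    obtain ⟨⟨⟨k, hk⟩, hkg⟩, hkκ⟩ := hsurj ⟨κ, hκ.mem_faceFun⟩
    have hkκ : restrictColor M f k = κ := congrArg Subtype.val hkκ
    have hkg : E.dehnDefect S t (colorParam t w) k = 0 := LinearMap.mem_ker.1 hkg
    have hkc : E.IsColoring t (colorParam t w) k := fun c => by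
      by_cases hc : c ∈ S
      · exact isDehn_of_dehnDefect hk hkg hc
      · have : c ∈ Set.range f := hr ▸ hc
        obtain ⟨c, rfl⟩ := this
        obtain ⟨h1, h2, h3, h4⟩ := hT.restrictColor_apply hr hs hnext hk hkg c
        rw [← h1, ← h2, ← h3, ← h4, hkκ]
        exact hκ c
    have h0 := hN.isRigid hE ht (f p₀.1, p₀.2) k hkc ((hp₀ k).symm.trans (by rw [hkκ, hκp]))
    rw [← hkκ, h0, map_zero]

end erasure

lemma IsErasure.sameSignature (hD : D.Planar) (hE : E.Planar) {S : Set (Fin E.n)}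
    {M : Set E.Passage} (h : E.IsErasure S D)
    (hT : ∀ t ≠ 0, ∀ w : Fin E.n → ℂ, (∀ c ∈ S, w c = E.baseWeight c) →
      E.IsTransparent S M t (colorParam t w)) : SameSignature D E := by
  obtain ⟨f, hf, hr, hs, hnext⟩ := h
  refine sameSignature_of_isNondegenerate_iff hD hE hf hs fun t ht w hw => ?_
  refine (hT t ht w fun c hc => hw c ?_).isNondegenerate_iff hD hE ht hf hr hs hnext
  rw [hr]
  exact fun h => h hc

end GaussCode

namespace GaussCode

variable {D E : GaussCode}

/-! ## The first two moves -/

lemma Renumbering.isErasure (h : D.Renumbering E) : E.IsErasure ∅ D := by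
  obtain ⟨e, hs, hn⟩ := h
  refine ⟨e, e.injective, by simp, hs, fun p => ⟨0, ?_, fun i hi => absurd hi (Nat.not_lt_zero _)⟩⟩
  simpa using hn p

lemma Renumbering.sameSignature (hD : D.Planar) (hE : E.Planar) (h : D.Renumbering E) :
    SameSignature D E :=
  h.isErasure.sameSignature (M := ∅) hD hE fun _ _ _ _ =>
    { mem_iff := fun p => by simp
      next_notMem := fun p hp => hp.elim
      pass := fun _ _ _ p hp => hp.elim
      inside := fun k _ _ h => funext fun p => h p (Set.notMem_empty p) }

/-- The colour relation at a crossing of sign `s`, for the colours of the incoming and outgoing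
edges of the over-strand and of the under-strand. -/
def IsCrossing (s : ℤˣ) (t u : ℂ) (oI oO uI uO : Bool → ℂ) : Prop :=
  if s = 1 then IsDehn t u oI uO uI oO else IsDehn t u uI oO oI uO

lemma isDehn_iff_isCrossing {t u : ℂ} {k : E.Passage → Bool → ℂ} (c : Fin E.n) :
    IsDehn t u (k (E.leftIn c)) (k (E.leftOut c)) (k (E.rightIn c)) (k (E.rightOut c)) ↔
      IsCrossing (E.sign c) t u (k (E.inEdge (c, true))) (k (c, true)) (k (E.inEdge (c, false)))
        (k (c, false)) := by
  unfold IsCrossing leftIn leftOut rightIn rightOut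
  split_ifs <;> rfl

/-- The parameter of the colour relation at a crossing of sign `s`. -/
def signParam (s : ℤˣ) (t : ℂ) : ℂ := if s = 1 then 1 else t

lemma colorParam_eq_signParam {t : ℂ} {w : Fin E.n → ℂ} {c : Fin E.n}
    (hw : w c = E.baseWeight c) : colorParam t w c = signParam (E.sign c) t := by
  rw [colorParam, hw, baseWeight, signParam]
  split_ifs <;> simp

lemma inEdge_eq {p q : E.Passage} (h : E.next p = q) : E.inEdge q = p :=
  (Equiv.symm_apply_eq _).2 h.symm

lemma eq_of_apply_true_of_apply_false {R : Type*} {f g : Bool → R} (ht : f true = g true)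
    (hf : f false = g false) : f = g :=
  funext fun b => by cases b <;> assumption

lemma isCrossing_of_dehnDefect {S : Set (Fin E.n)} {t : ℂ} {w : Fin E.n → ℂ}
    (hw : ∀ c ∈ S, w c = E.baseWeight c) {k : E.Passage → Bool → ℂ} (hk : k ∈ E.faceFun ℂ)
    (hd : E.dehnDefect S t (colorParam t w) k = 0) {c : Fin E.n} (hc : c ∈ S) :
    IsCrossing (E.sign c) t (signParam (E.sign c) t) (k (E.inEdge (c, true))) (k (c, true))
      (k (E.inEdge (c, false))) (k (c, false)) := by
  rw [← colorParam_eq_signParam (hw c hc), ← isDehn_iff_isCrossing]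
  exact isDehn_of_dehnDefect hk hd hc

/-- The alternatives are a kink that is first passed on the over-strand and one first passed on the
under-strand. In both, the edge `M` of the loop is outgoing once and incoming once. -/
lemma IsCrossing.kink {s : ℤˣ} {t : ℂ} (ht : t ≠ 0) {I M O : Bool → ℂ}
    (h : IsCrossing s t (signParam s t) I M M O ∨ IsCrossing s t (signParam s t) M O I M) :
    O = I ∧ (O = 0 → I = 0 → M = 0) := by
  rcases Int.units_eq_one_or s with rfl | rfl <;>
    simp only [IsCrossing, signParam, if_true, show (-1 : ℤˣ) ≠ 1 by decide, if_false, IsDehn,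
      IsCorner] at h
  all_goals
    refine ⟨eq_of_apply_true_of_apply_false ?_ ?_, ?_⟩
    · grind
    · grind
    · rintro rfl rfl
      simp only [Pi.zero_apply] at h
      refine eq_of_apply_true_of_apply_false ?_ ?_ <;> simp only [Pi.zero_apply] <;> grind

/-- Crossings of opposite sign with the parameters belonging to their signs impose inverse colour
changes, so the strands leave the bigon with the colours they brought. -/
lemma IsCrossing.parallel_bigon {s : ℤˣ} {t : ℂ} (ht : t ≠ 0) {I M O I' M' O' : Bool → ℂ}
    (ha : IsCrossing s t (signParam s t) I M I' M')
    (hb : IsCrossing (-s) t (signParam (-s) t) M O M' O') :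
    O = I ∧ O' = I' ∧ (O = 0 → I = 0 → O' = 0 → I' = 0 → M = 0 ∧ M' = 0) := by
  rcases Int.units_eq_one_or s with rfl | rfl <;>
    simp only [IsCrossing, signParam, neg_neg, if_true, show (-1 : ℤˣ) ≠ 1 by decide, if_false,
      IsDehn, IsCorner] at ha hb
  all_goals
    refine ⟨eq_of_apply_true_of_apply_false ?_ ?_, eq_of_apply_true_of_apply_false ?_ ?_, ?_⟩
    · grind
    · grind
    · grind
    · grind
    · rintro rfl rfl rfl rfl
      simp only [Pi.zero_apply] at ha hb
      refine ⟨eq_of_apply_true_of_apply_false ?_ ?_, eq_of_apply_true_of_apply_false ?_ ?_⟩ <;>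
        simp only [Pi.zero_apply] <;> grind

lemma IsCrossing.antiparallel_bigon {s : ℤˣ} {t : ℂ} (ht : t ≠ 0) {I M O I' M' O' : Bool → ℂ}
    (ha : IsCrossing s t (signParam s t) I M M' O')
    (hb : IsCrossing (-s) t (signParam (-s) t) M O I' M') :
    O = I ∧ O' = I' ∧ (O = 0 → I = 0 → O' = 0 → I' = 0 → M = 0 ∧ M' = 0) := by
  rcases Int.units_eq_one_or s with rfl | rfl <;>
    simp only [IsCrossing, signParam, neg_neg, if_true, show (-1 : ℤˣ) ≠ 1 by decide, if_false,
      IsDehn, IsCorner] at ha hb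
  all_goals
    refine ⟨eq_of_apply_true_of_apply_false ?_ ?_, eq_of_apply_true_of_apply_false ?_ ?_, ?_⟩
    · grind
    · grind
    · grind
    · grind
    · rintro rfl rfl rfl rfl
      simp only [Pi.zero_apply] at ha hb
      refine ⟨eq_of_apply_true_of_apply_false ?_ ?_, eq_of_apply_true_of_apply_false ?_ ?_⟩ <;>
        simp only [Pi.zero_apply] <;> grind

lemma Move1.sameSignature (hD : D.Planar) (hE : E.Planar) (h : D.Move1 E) :
    SameSignature D E := by
  obtain ⟨c, b, hn, h⟩ := h
  have hin := inEdge_eq hn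
  have hne : ((c, b) : E.Passage) ≠ (c, !b) := by simp
  refine h.sameSignature (M := {(c, b)}) hD hE fun t ht w hw => ?_
  have facts : ∀ k ∈ E.faceFun ℂ, E.dehnDefect {c} t (colorParam t w) k = 0 →
      (k (c, !b) = k (E.inEdge (c, b))) ∧
      (k (c, !b) = 0 → k (E.inEdge (c, b)) = 0 → k (c, b) = 0) := by
    intro k hk hd
    have h := isCrossing_of_dehnDefect hw hk hd (Set.mem_singleton c)
    refine IsCrossing.kink (s := E.sign c) ht ?_
    cases b
    · rw [Bool.not_false] at *
      rw [hin] at h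
      exact Or.inr h
    · rw [Bool.not_true] at *
      rw [hin] at h
      exact Or.inl h
  have hne' : E.inEdge (c, b) ≠ (c, b) := fun h => by
    have := congrArg E.next h
    rw [next_inEdge, hn] at this
    exact hne this
  exact
    { mem_iff := fun p => by
        rw [Set.mem_singleton_iff, Set.mem_singleton_iff, Set.mem_singleton_iff]
        constructor
        · intro hp
          by_cases hb : p.2 = b
          · exact Or.inl (Prod.ext hp hb)
          · have : p = (c, !b) := Prod.ext hp (Bool.eq_not_of_ne hb)
            exact Or.inr (by rw [this, hin])
        · rintro (rfl | hp)
          · rfl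
          · have := congrArg E.next hp
            rw [next_inEdge, hn] at this
            rw [this]
      next_notMem := fun p hp => by
        rw [Set.mem_singleton_iff] at hp
        rw [hp, hn, Set.mem_singleton_iff]
        exact hne.symm
      pass := fun k hk hd p hp => by
        rw [Set.mem_singleton_iff] at hp
        rw [hp, hn]
        exact (facts k hk hd).1
      inside := fun k hk hd h0 => by
        funext p
        by_cases hp : p = (c, b)
        · rw [hp]
          exact (facts k hk hd).2 (h0 _ hne.symm) (h0 _ hne')
        · exact h0 p hp }

lemma Move2.sameSignature (hD : D.Planar) (hE : E.Planar) (h : D.Move2 E) :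
    SameSignature D E := by
  obtain ⟨a, b, hab, hs, ho, hu, h⟩ := h
  have hs : E.sign b = -E.sign a := by rw [hs, neg_neg]
  -- The names `x`, `y` give the order of the two crossings on the under-strand, so that both
  -- directions share the same stretches.
  have hu : ∃ x y, E.next (x, false) = (y, false) ∧ ((x = a ∧ y = b) ∨ (x = b ∧ y = a)) := by
    rcases hu with hu | hu
    · exact ⟨a, b, hu, Or.inl ⟨rfl, rfl⟩⟩
    · exact ⟨b, a, hu, Or.inr ⟨rfl, rfl⟩⟩
  obtain ⟨x, y, hu, hxy⟩ := hu
  have hyx : y ≠ x := by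
    rcases hxy with ⟨rfl, rfl⟩ | ⟨rfl, rfl⟩
    · exact hab.symm
    · exact hab
  have hio := inEdge_eq ho
  have hiu := inEdge_eq hu
  have ha : a ∈ ({a, b} : Set (Fin E.n)) := Or.inl rfl
  have hb : b ∈ ({a, b} : Set (Fin E.n)) := Or.inr rfl
  refine h.sameSignature (M := {(a, true), (x, false)}) hD hE fun t ht w hw => ?_
  have facts : ∀ k ∈ E.faceFun ℂ, E.dehnDefect {a, b} t (colorParam t w) k = 0 →
      k (b, true) = k (E.inEdge (a, true)) ∧ k (y, false) = k (E.inEdge (x, false)) ∧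
      (k (b, true) = 0 → k (E.inEdge (a, true)) = 0 → k (y, false) = 0 →
        k (E.inEdge (x, false)) = 0 → k (a, true) = 0 ∧ k (x, false) = 0) := by
    intro k hk hd
    have h1 := isCrossing_of_dehnDefect hw hk hd ha
    have h2 := isCrossing_of_dehnDefect hw hk hd hb
    rw [hs] at h2
    rcases hxy with ⟨rfl, rfl⟩ | ⟨rfl, rfl⟩
    · rw [hio, hiu] at h2
      exact h1.parallel_bigon ht h2
    · rw [hiu] at h1
      rw [hio] at h2
      exact h1.antiparallel_bigon ht h2
  have hM : ∀ {p : E.Passage}, p ∈ ({(a, true), (x, false)} : Set E.Passage) ↔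
      p = (a, true) ∨ p = (x, false) := Iff.rfl
  have hne : ∀ {p q : E.Passage}, E.next p = q →
      ((q = (b, true) ∨ q = (y, false)) ↔
        p ∈ ({(a, true), (x, false)} : Set E.Passage)) := fun {p q} hpq => by
    rw [hM, ← hpq, ← ho, ← hu, E.next.injective.eq_iff, E.next.injective.eq_iff]
  have hnot : ∀ {q : E.Passage}, (q = (b, true) ∨ q = (y, false)) →
      q ∉ ({(a, true), (x, false)} : Set E.Passage) := by
    rintro q (rfl | rfl) (h | h) <;> simp_all
  have hnin : ∀ {q : E.Passage}, (q = (a, true) ∨ q = (x, false)) →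
      E.inEdge q ∉ ({(a, true), (x, false)} : Set E.Passage) := fun {q} hq h => by
    have := (hne (next_inEdge q)).2 h
    exact hnot this (hM.2 hq)
  exact
    { mem_iff := fun p => by
        rw [hM, ← hne (next_inEdge p)]
        obtain ⟨c, o⟩ := p
        rcases hxy with ⟨rfl, rfl⟩ | ⟨rfl, rfl⟩ <;> cases o <;>
          simp [Set.mem_insert_iff, or_comm]
      next_notMem := fun p hp => hnot ((hne rfl).2 hp)
      pass := fun k hk hd p hp => by
        obtain ⟨f1, f2, -⟩ := facts k hk hd
        rcases hM.1 hp with rfl | rfl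
        · rw [ho, f1]
        · rw [hu, f2]
      inside := fun k hk hd h0 => by
        obtain ⟨-, -, f3⟩ := facts k hk hd
        obtain ⟨g1, g2⟩ := f3 (h0 _ (hnot (Or.inl rfl))) (h0 _ (hnin (Or.inl rfl)))
          (h0 _ (hnot (Or.inr rfl))) (h0 _ (hnin (Or.inr rfl)))
        funext p
        by_cases hp : p = (a, true) ∨ p = (x, false)
        · rcases hp with rfl | rfl
          · exact g1
          · exact g2
        · exact h0 p hp }

end GaussCode

/-! ### Colour relations around a triangle -/

namespace GaussCode

/-- The colour of the edge that enters the first crossing (if `s = 1`) or the second crossing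
(if `s = -1`) of a strand with colours `I`, `M`, `O`. -/
def strandIn (s : ℤˣ) (I M : Bool → ℂ) : Bool → ℂ := if s = 1 then I else M

/-- The colour of the edge that leaves the first crossing (if `s = 1`) or the second crossing
(if `s = -1`) of a strand with colours `I`, `M`, `O`. -/
def strandOut (s : ℤˣ) (M O : Bool → ℂ) : Bool → ℂ := if s = 1 then M else O

/-- The colour relations at the three crossings of a triangle with orientation `τ`. The strands
have directions `s`, `v`, `w` and colours `I j`, `M j`, `O j`. -/
structure IsTriangle (τ s v w : ℤˣ) (t x y z : ℂ) (I M O : Fin 3 → Bool → ℂ) : Prop where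
  a : IsCrossing (τ * s * v) t x (strandIn s (I 0) (M 0)) (strandOut s (M 0) (O 0))
    (strandIn v (I 1) (M 1)) (strandOut v (M 1) (O 1))
  b : IsCrossing (τ * s * w) t y (strandIn (-s) (I 0) (M 0)) (strandOut (-s) (M 0) (O 0))
    (strandIn w (I 2) (M 2)) (strandOut w (M 2) (O 2))
  c : IsCrossing (τ * v * w) t z (strandIn (-v) (I 1) (M 1)) (strandOut (-v) (M 1) (O 1))
    (strandIn (-w) (I 2) (M 2)) (strandOut (-w) (M 2) (O 2))

/-- The colours of the middle edges after the move, if the new triangle has colour `X`. -/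
def newMiddle (τ s v w : ℤˣ) (I O : Fin 3 → Bool → ℂ) (X : ℂ) (j : Fin 3) (d : Bool) : ℂ :=
  if j = 0 then if d = decide (τ * s = 1) then strandIn v (O 1) (I 1) (decide (τ * v = 1)) else X
  else if j = 1 then
    if d = decide (τ * v = -1) then strandIn w (I 2) (O 2) (decide (τ * w = -1)) else X
  else if d = decide (τ * w = 1) then strandIn s (I 0) (O 0) (decide (τ * s = -1)) else X

lemma exists_add_eq (b c : ℂ) : ∃ X : ℂ, X + b = c := ⟨c - b, by ring⟩

lemma exists_eq_add (b c : ℂ) : ∃ X : ℂ, c = X + b := ⟨c - b, by ring⟩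

lemma exists_mul_add_eq {t : ℂ} (ht : t ≠ 0) (b c : ℂ) : ∃ X : ℂ, b + t * X = c :=
  ⟨(c - b) / t, by field_simp; ring⟩

variable {τ s v w : ℤˣ} {t x y z : ℂ} {I M O : Fin 3 → Bool → ℂ}

/-- After the move the outer edges fix all colours except that of the new triangle. The relation at
`c` can be solved for it, because with a sign parameter its coefficient is `1` or `t` up to sign. -/
lemma IsTriangle.exists_newMiddle_c (ht : t ≠ 0)
    (h : IsTriangle τ s v w t x y (signParam (τ * v * w) t) I M O) :
    ∃ X, IsCrossing (τ * -v * -w) t (signParam (τ * v * w) t)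
      (strandIn (- -v) (I 1) (newMiddle τ s v w I O X 1))
      (strandOut (- -v) (newMiddle τ s v w I O X 1) (O 1))
      (strandIn (- -w) (I 2) (newMiddle τ s v w I O X 2))
      (strandOut (- -w) (newMiddle τ s v w I O X 2) (O 2)) := by
  obtain ⟨h1, h2, h3⟩ := h
  rcases Int.units_eq_one_or τ with rfl | rfl <;>
    rcases Int.units_eq_one_or s with rfl | rfl <;>
    rcases Int.units_eq_one_or v with rfl | rfl <;>
    rcases Int.units_eq_one_or w with rfl | rfl <;>
    simp only [newMiddle, IsCrossing, strandIn, strandOut, signParam, mul_one, one_mul, mul_neg,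
      neg_neg, if_true, show (-1 : ℤˣ) ≠ 1 by decide, show (1 : ℤˣ) ≠ -1 by decide,
      if_false, IsDehn, IsCorner, decide_true, decide_false, Fin.isValue, one_ne_zero,
      show (2 : Fin 3) ≠ 0 by decide, show (2 : Fin 3) ≠ 1 by decide, reduceCtorEq,
      add_sub_cancel_left, add_sub_cancel_right, true_and, and_true, exists_and_left] at * <;>
    refine ⟨by grind, ?_⟩ <;>
    first
    | exact exists_add_eq _ _
    | exact exists_eq_add _ _
    | exact exists_mul_add_eq ht _ _
    | exact (exists_mul_add_eq ht _ _).imp fun _ h => h.symm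
    | exact (exists_mul_add_eq ht _ _).imp fun _ h => h.symm.trans (add_comm _ _)
    | exact (exists_add_eq _ _).imp fun _ h => h.symm.trans (add_comm _ _)

lemma IsTriangle.exists_newMiddle_a (ht : t ≠ 0)
    (h : IsTriangle τ s v w t (signParam (τ * s * v) t) y z I M O) :
    ∃ X, IsCrossing (τ * -s * -v) t (signParam (τ * s * v) t)
      (strandIn (-s) (I 0) (newMiddle τ s v w I O X 0))
      (strandOut (-s) (newMiddle τ s v w I O X 0) (O 0))
      (strandIn (-v) (I 1) (newMiddle τ s v w I O X 1))
      (strandOut (-v) (newMiddle τ s v w I O X 1) (O 1)) := by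
  obtain ⟨h1, h2, h3⟩ := h
  rcases Int.units_eq_one_or τ with rfl | rfl <;>
    rcases Int.units_eq_one_or s with rfl | rfl <;>
    rcases Int.units_eq_one_or v with rfl | rfl <;>
    rcases Int.units_eq_one_or w with rfl | rfl <;>
    simp only [newMiddle, IsCrossing, strandIn, strandOut, signParam, mul_one, one_mul, mul_neg,
      neg_neg, if_true, show (-1 : ℤˣ) ≠ 1 by decide, show (1 : ℤˣ) ≠ -1 by decide,
      if_false, IsDehn, IsCorner, decide_true, decide_false, Fin.isValue, one_ne_zero,
      reduceCtorEq,
      add_sub_cancel_left, add_sub_cancel_right, true_and, and_true, exists_and_left] at * <;>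
    refine ⟨by grind, ?_⟩ <;>
    first
    | exact exists_add_eq _ _
    | exact exists_eq_add _ _
    | exact exists_mul_add_eq ht _ _
    | exact (exists_mul_add_eq ht _ _).imp fun _ h => h.symm
    | exact (exists_mul_add_eq ht _ _).imp fun _ h => h.symm.trans (add_comm _ _)
    | exact (exists_add_eq _ _).imp fun _ h => h.symm.trans (add_comm _ _)

/-- Invariance when the crossing `a` has an arbitrary weight. -/
lemma IsTriangle.move_a (ht : t ≠ 0)
    (h : IsTriangle τ s v w t x (signParam (τ * s * w) t) (signParam (τ * v * w) t) I M O) :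
    ∃ M', IsTriangle τ (-s) (-v) (-w) t x (signParam (τ * s * w) t) (signParam (τ * v * w) t) I M' O := by
  obtain ⟨X, hX⟩ := h.exists_newMiddle_c ht
  obtain ⟨h1, h2, h3⟩ := h
  refine ⟨newMiddle τ s v w I O X, ?_, ?_, hX⟩ <;>
  -- Once the new triangle colour is chosen, the remaining relations are checked for each of the
  -- sixteen choices of orientation and directions.
  · rcases Int.units_eq_one_or τ with rfl | rfl <;>
      rcases Int.units_eq_one_or s with rfl | rfl <;>
      rcases Int.units_eq_one_or v with rfl | rfl <;>
      rcases Int.units_eq_one_or w with rfl | rfl <;>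
      simp only [newMiddle, IsCrossing, strandIn, strandOut, signParam, mul_one, one_mul, mul_neg,
        neg_neg, if_true, show (-1 : ℤˣ) ≠ 1 by decide, show (1 : ℤˣ) ≠ -1 by decide,
        if_false, IsDehn, IsCorner, decide_true, decide_false, Fin.isValue, one_ne_zero,
        show (2 : Fin 3) ≠ 0 by decide, show (2 : Fin 3) ≠ 1 by decide, reduceCtorEq,
        true_and, and_true] at * <;> grind

/-- Invariance when the crossing `b` has an arbitrary weight. -/
lemma IsTriangle.move_b (ht : t ≠ 0)
    (h : IsTriangle τ s v w t (signParam (-(τ * s * v)) t) y (signParam (τ * v * w) t) I M O) :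
    ∃ M', IsTriangle τ (-s) (-v) (-w) t (signParam (-(τ * s * v)) t) y (signParam (τ * v * w) t) I M' O := by
  obtain ⟨X, hX⟩ := h.exists_newMiddle_c ht
  obtain ⟨h1, h2, h3⟩ := h
  refine ⟨newMiddle τ s v w I O X, ?_, ?_, hX⟩ <;>
  · rcases Int.units_eq_one_or τ with rfl | rfl <;>
      rcases Int.units_eq_one_or s with rfl | rfl <;>
      rcases Int.units_eq_one_or v with rfl | rfl <;>
      rcases Int.units_eq_one_or w with rfl | rfl <;>
      simp only [newMiddle, IsCrossing, strandIn, strandOut, signParam, mul_one, one_mul, mul_neg,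
        neg_neg, if_true, show (-1 : ℤˣ) ≠ 1 by decide, show (1 : ℤˣ) ≠ -1 by decide,
        if_false, IsDehn, IsCorner, decide_true, decide_false, Fin.isValue, one_ne_zero,
        show (2 : Fin 3) ≠ 0 by decide, show (2 : Fin 3) ≠ 1 by decide, reduceCtorEq,
        true_and, and_true] at * <;> grind

/-- Invariance when the crossing `c` has an arbitrary weight. -/
lemma IsTriangle.move_c (ht : t ≠ 0)
    (h : IsTriangle τ s v w t (signParam (τ * s * v) t) (signParam (τ * s * w) t) z I M O) :
    ∃ M', IsTriangle τ (-s) (-v) (-w) t (signParam (τ * s * v) t) (signParam (τ * s * w) t) z I M' O := by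
  obtain ⟨X, hX⟩ := h.exists_newMiddle_a ht
  obtain ⟨h1, h2, h3⟩ := h
  refine ⟨newMiddle τ s v w I O X, hX, ?_, ?_⟩ <;>
  · rcases Int.units_eq_one_or τ with rfl | rfl <;>
      rcases Int.units_eq_one_or s with rfl | rfl <;>
      rcases Int.units_eq_one_or v with rfl | rfl <;>
      rcases Int.units_eq_one_or w with rfl | rfl <;>
      simp only [newMiddle, IsCrossing, strandIn, strandOut, signParam, mul_one, one_mul, mul_neg,
        neg_neg, if_true, show (-1 : ℤˣ) ≠ 1 by decide, show (1 : ℤˣ) ≠ -1 by decide,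
        if_false, IsDehn, IsCorner, decide_true, decide_false, Fin.isValue, one_ne_zero,
        show (2 : Fin 3) ≠ 0 by decide, show (2 : Fin 3) ≠ 1 by decide, reduceCtorEq,
        true_and, and_true] at * <;> grind

/-- With vanishing outer colours only the colour of the triangle is left, and the relation at `c`
kills it, its coefficient being `1` or `t` up to sign. -/
lemma IsTriangle.middle_eq_zero_c (ht : t ≠ 0)
    (h : IsTriangle τ s v w t x y (signParam (τ * v * w) t) I M O) (hI : I = 0) (hO : O = 0) :
    M = 0 := by
  obtain ⟨h1, h2, h3⟩ := h
  subst hI hO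
  have key : (M 0 true = 0 ∧ M 0 false = 0) ∧ (M 1 true = 0 ∧ M 1 false = 0) ∧
      M 2 true = 0 ∧ M 2 false = 0 := by
    rcases Int.units_eq_one_or τ with rfl | rfl <;>
      rcases Int.units_eq_one_or s with rfl | rfl <;>
      rcases Int.units_eq_one_or v with rfl | rfl <;>
      rcases Int.units_eq_one_or w with rfl | rfl <;>
      simp only [IsCrossing, strandIn, strandOut, signParam, mul_one, one_mul, mul_neg,
        neg_neg, if_true, show (-1 : ℤˣ) ≠ 1 by decide,
        if_false, IsDehn, IsCorner, Fin.isValue,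
        Pi.zero_apply] at * <;> grind
  funext j
  fin_cases j
  · exact eq_of_apply_true_of_apply_false key.1.1 key.1.2
  · exact eq_of_apply_true_of_apply_false key.2.1.1 key.2.1.2
  · exact eq_of_apply_true_of_apply_false key.2.2.1 key.2.2.2

lemma IsTriangle.middle_eq_zero_a (ht : t ≠ 0)
    (h : IsTriangle τ s v w t (signParam (τ * s * v) t) y z I M O) (hI : I = 0) (hO : O = 0) :
    M = 0 := by
  obtain ⟨h1, h2, h3⟩ := h
  subst hI hO
  have key : (M 0 true = 0 ∧ M 0 false = 0) ∧ (M 1 true = 0 ∧ M 1 false = 0) ∧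
      M 2 true = 0 ∧ M 2 false = 0 := by
    rcases Int.units_eq_one_or τ with rfl | rfl <;>
      rcases Int.units_eq_one_or s with rfl | rfl <;>
      rcases Int.units_eq_one_or v with rfl | rfl <;>
      rcases Int.units_eq_one_or w with rfl | rfl <;>
      simp only [IsCrossing, strandIn, strandOut, signParam, mul_one, one_mul, mul_neg,
        neg_neg, if_true, show (-1 : ℤˣ) ≠ 1 by decide,
        if_false, IsDehn, IsCorner, Fin.isValue,
        Pi.zero_apply] at * <;> grind
  funext j
  fin_cases j
  · exact eq_of_apply_true_of_apply_false key.1.1 key.1.2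
  · exact eq_of_apply_true_of_apply_false key.2.1.1 key.2.1.2
  · exact eq_of_apply_true_of_apply_false key.2.2.1 key.2.2.2

end GaussCode

namespace GaussCode

variable {D E : GaussCode}

/-! ## The third move -/

/-- The third move, with the correspondence `φ` between the edges. -/
structure IsTriangleMove (D E : GaussCode) (e : Fin D.n ≃ Fin E.n) (φ : D.Passage ≃ E.Passage)
    (a b c : Fin D.n) (τ s v w : ℤˣ) : Prop where
  ab : a ≠ b
  ac : a ≠ c
  bc : b ≠ c
  next : ∀ p, E.next (φ p) = φ (D.next p)
  sign : ∀ x, E.sign (e x) = D.sign x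
  sign_a : D.sign a = τ * s * v
  sign_b : D.sign b = τ * s * w
  sign_c : D.sign c = τ * v * w
  top : D.Consecutive s (a, true) (b, true)
  middle : D.Consecutive v (a, false) (c, true)
  bottom : D.Consecutive w (b, false) (c, false)
  top_a : φ (a, true) = (e b, true)
  top_b : φ (b, true) = (e a, true)
  mid_a : φ (a, false) = (e c, true)
  mid_c : φ (c, true) = (e a, false)
  bot_b : φ (b, false) = (e c, false)
  bot_c : φ (c, false) = (e b, false)
  other : ∀ x, x ≠ a → x ≠ b → x ≠ c → ∀ o, φ (x, o) = (e x, o)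

lemma consecutive_neg {D : GaussCode} {s : ℤˣ} {p q : D.Passage} :
    D.Consecutive (-s) p q ↔ D.Consecutive s q p := by
  rcases Int.units_eq_one_or s with rfl | rfl <;> simp [Consecutive]

/-- The orientation of the triangle is recovered from the sign at `a` as `sign a * (s v)`. The sign
conditions of the move make it agree at the other two crossings. -/
lemma Move3.exists_isTriangleMove (h : D.Move3 E) :
    ∃ e φ a b c τ s v w, IsTriangleMove D E e φ a b c τ s v w := by
  obtain ⟨a, b, c, s, v, w, ab, ac, bc, h1, h2, h3, s1, s2, e, he, hn⟩ := h
  have hu : ∀ x s v : ℤˣ, x = x * (s * v) * s * v := fun x s v => by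
    rcases Int.units_eq_one_or s with rfl | rfl <;>
      rcases Int.units_eq_one_or v with rfl | rfl <;> simp
  refine ⟨e, (Equiv.swap (a, true) (b, true) * Equiv.swap (a, false) (c, true) *
          Equiv.swap (b, false) (c, false)).trans (e.prodCongr (Equiv.refl Bool)),
    a, b, c, D.sign a * (s * v), s, v, w,
    { ab := ab
      ac := ac
      bc := bc
      next := fun p => ?_
      sign := he
      sign_a := hu _ _ _
      sign_b := by rw [s1]; exact hu _ _ _
      sign_c := by rw [s1, s2]; exact hu _ _ _
      top := h1
      middle := h2
      bottom := h3
      top_a := ?_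
      top_b := ?_
      mid_a := ?_
      mid_c := ?_
      bot_b := ?_
      bot_c := ?_
      other := fun x xa xb xc o => ?_ }⟩
  · have := hn ((Equiv.swap (a, true) (b, true) * Equiv.swap (a, false) (c, true) *
          Equiv.swap (b, false) (c, false) : Equiv.Perm D.Passage) p)
    refine this.trans ?_
    simp [Prod.map]
  all_goals
    first
    | simp [Equiv.swap_apply_of_ne_of_ne, xa, xb, xc]
    | simp [Equiv.swap_apply_of_ne_of_ne, ab, ac, bc, ab.symm, ac.symm, bc.symm]

/-- Exchanging the two crossings on each strand reverses all three directions, while the orientation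
`τ` and the signs persist. So only one implication has to be proved for the move. -/
lemma IsTriangleMove.symm {e : Fin D.n ≃ Fin E.n} {φ : D.Passage ≃ E.Passage} {a b c : Fin D.n}
    {τ s v w : ℤˣ} (h : IsTriangleMove D E e φ a b c τ s v w) :
    IsTriangleMove E D e.symm φ.symm (e a) (e b) (e c) τ (-s) (-v) (-w) where
  ab := e.injective.ne h.ab
  ac := e.injective.ne h.ac
  bc := e.injective.ne h.bc
  next p := by
    rw [Equiv.eq_symm_apply, ← h.next, Equiv.apply_symm_apply]
  sign x := by rw [← h.sign, Equiv.apply_symm_apply]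
  sign_a := by rw [h.sign, h.sign_a]; simp
  sign_b := by rw [h.sign, h.sign_b]; simp
  sign_c := by rw [h.sign, h.sign_c]; simp
  top := by
    have := h.top
    rw [consecutive_neg, ← h.top_a, ← h.top_b]
    unfold Consecutive at *
    rw [h.next, h.next]
    split_ifs at * <;> rw [this]
  middle := by
    have := h.middle
    rw [consecutive_neg, ← h.mid_a, ← h.mid_c]
    unfold Consecutive at *
    rw [h.next, h.next]
    split_ifs at * <;> rw [this]
  bottom := by
    have := h.bottom
    rw [consecutive_neg, ← h.bot_b, ← h.bot_c]
    unfold Consecutive at *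
    rw [h.next, h.next]
    split_ifs at * <;> rw [this]
  top_a := by rw [Equiv.symm_apply_eq, Equiv.symm_apply_apply, h.top_b]
  top_b := by rw [Equiv.symm_apply_eq, Equiv.symm_apply_apply, h.top_a]
  mid_a := by rw [Equiv.symm_apply_eq, Equiv.symm_apply_apply, h.mid_c]
  mid_c := by rw [Equiv.symm_apply_eq, Equiv.symm_apply_apply, h.mid_a]
  bot_b := by rw [Equiv.symm_apply_eq, Equiv.symm_apply_apply, h.bot_c]
  bot_c := by rw [Equiv.symm_apply_eq, Equiv.symm_apply_apply, h.bot_b]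
  other x xa xb xc o := by
    obtain ⟨x, rfl⟩ := e.surjective x
    rw [Equiv.symm_apply_eq, Equiv.symm_apply_apply, h.other x]
    · exact fun h => xa (by rw [h])
    · exact fun h => xb (by rw [h])
    · exact fun h => xc (by rw [h])

section local_move

variable {s : ℤˣ}

/-- The first of two passages that are passed in the direction `s`. -/
def firstOf {α : Type*} (s : ℤˣ) (p q : α) : α := if s = 1 then p else q

lemma Consecutive.next_firstOf {p q : D.Passage} (h : D.Consecutive s p q) :
    D.next (firstOf s p q) = firstOf s q p := by
  unfold Consecutive at h
  unfold firstOf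
  split_ifs at * <;> exact h

lemma strand_left {p q : D.Passage} {κ : D.Passage → Bool → ℂ} {I M O : Bool → ℂ}
    (h : D.Consecutive s p q)
    (hI : κ (D.inEdge (firstOf s p q)) = I) (hM : κ (firstOf s p q) = M)
    (hO : κ (firstOf s q p) = O) :
    κ (D.inEdge p) = strandIn s I M ∧ κ p = strandOut s M O := by
  unfold Consecutive at h
  unfold firstOf at *
  unfold strandIn strandOut
  split_ifs at * with hs
  · exact ⟨hI, hM⟩
  · rw [inEdge_eq h]
    exact ⟨hM, hO⟩

lemma strand_right {p q : D.Passage} {κ : D.Passage → Bool → ℂ} {I M O : Bool → ℂ}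
    (h : D.Consecutive s p q)
    (hI : κ (D.inEdge (firstOf s p q)) = I) (hM : κ (firstOf s p q) = M)
    (hO : κ (firstOf s q p) = O) :
    κ (D.inEdge q) = strandIn (-s) I M ∧ κ q = strandOut (-s) M O := by
  have e : ∀ {α : Type} (x y : α), firstOf (-s) x y = firstOf s y x := fun x y => by
    rcases Int.units_eq_one_or s with rfl | rfl <;> simp [firstOf]
  refine strand_left (consecutive_neg.2 h) ?_ ?_ ?_ <;> rwa [e]

end local_move

end GaussCode

namespace GaussCode

variable {D E : GaussCode}

section triangle

variable {e : Fin D.n ≃ Fin E.n} {φ : D.Passage ≃ E.Passage} {a b c : Fin D.n} {τ s v w : ℤˣ}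

/-- The first passages on the three strands of a triangle. -/
def triangleFirst (a b c : Fin D.n) (s v w : ℤˣ) : Fin 3 → D.Passage :=
  ![firstOf s (a, true) (b, true), firstOf v (a, false) (c, true), firstOf w (b, false) (c, false)]

/-- The second passages on the three strands of a triangle. -/
def triangleSecond (a b c : Fin D.n) (s v w : ℤˣ) : Fin 3 → D.Passage :=
  ![firstOf s (b, true) (a, true), firstOf v (c, true) (a, false), firstOf w (c, false) (b, false)]

lemma IsTriangleMove.next_triangleFirst (h : IsTriangleMove D E e φ a b c τ s v w) (j : Fin 3) :
    D.next (triangleFirst a b c s v w j) = triangleSecond a b c s v w j := by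
  fin_cases j
  · exact h.top.next_firstOf
  · exact h.middle.next_firstOf
  · exact h.bottom.next_firstOf

lemma IsTriangleMove.triangleFirst_injective (h : IsTriangleMove D E e φ a b c τ s v w) :
    Function.Injective (triangleFirst a b c s v w) := by
  have ab := h.ab
  have ac := h.ac
  have bc := h.bc
  intro i j hij
  rcases Int.units_eq_one_or s with rfl | rfl <;> rcases Int.units_eq_one_or v with rfl | rfl <;>
    rcases Int.units_eq_one_or w with rfl | rfl <;> fin_cases i <;> fin_cases j <;>
    simp_all [triangleFirst, firstOf, eq_comm]

lemma IsTriangleMove.triangleSecond_ne (h : IsTriangleMove D E e φ a b c τ s v w) (i j : Fin 3) :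
    triangleSecond a b c s v w i ≠ triangleFirst a b c s v w j := by
  have ab := h.ab
  have ac := h.ac
  have bc := h.bc
  intro hij
  rcases Int.units_eq_one_or s with rfl | rfl <;> rcases Int.units_eq_one_or v with rfl | rfl <;>
    rcases Int.units_eq_one_or w with rfl | rfl <;> fin_cases i <;> fin_cases j <;>
    simp_all [triangleFirst, triangleSecond, firstOf, eq_comm]

lemma IsTriangleMove.fst_mem (h : IsTriangleMove D E e φ a b c τ s v w) (j : Fin 3) :
    ((triangleFirst a b c s v w j).1 = a ∨ (triangleFirst a b c s v w j).1 = b ∨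
      (triangleFirst a b c s v w j).1 = c) ∧ ((triangleSecond a b c s v w j).1 = a ∨
      (triangleSecond a b c s v w j).1 = b ∨ (triangleSecond a b c s v w j).1 = c) := by
  rcases Int.units_eq_one_or s with rfl | rfl <;> rcases Int.units_eq_one_or v with rfl | rfl <;>
    rcases Int.units_eq_one_or w with rfl | rfl <;> fin_cases j <;>
    simp [triangleFirst, triangleSecond, firstOf]

/-- The colours at the triangle, before the move. -/
lemma IsTriangleMove.isTriangle (h : IsTriangleMove D E e φ a b c τ s v w) {t : ℂ}
    {u : Fin D.n → ℂ} {k : D.Passage → Bool → ℂ} (hk : D.IsColoring t u k) :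
    IsTriangle τ s v w t (u a) (u b) (u c) (fun j => k (D.inEdge (triangleFirst a b c s v w j)))
      (fun j => k (triangleFirst a b c s v w j)) (fun j => k (triangleSecond a b c s v w j)) where
  a := by
    have h1 := (isDehn_iff_isCrossing a).1 (hk a)
    obtain ⟨e1, e2⟩ := strand_left h.top (κ := k) rfl rfl rfl
    obtain ⟨e3, e4⟩ := strand_left h.middle (κ := k) rfl rfl rfl
    rw [e1, e2, e3, e4,
      h.sign_a] at h1
    exact h1
  b := by
    have h1 := (isDehn_iff_isCrossing b).1 (hk b)
    obtain ⟨e1, e2⟩ := strand_right h.top (κ := k) rfl rfl rfl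
    obtain ⟨e3, e4⟩ := strand_left h.bottom (κ := k) rfl rfl rfl
    rw [e1, e2, e3, e4,
      h.sign_b] at h1
    exact h1
  c := by
    have h1 := (isDehn_iff_isCrossing c).1 (hk c)
    obtain ⟨e1, e2⟩ := strand_right h.middle (κ := k) rfl rfl rfl
    obtain ⟨e3, e4⟩ := strand_right h.bottom (κ := k) rfl rfl rfl
    rw [e1, e2, e3, e4,
      h.sign_c] at h1
    exact h1

lemma IsTriangleMove.inEdge_map (h : IsTriangleMove D E e φ a b c τ s v w) (p : D.Passage) :
    E.inEdge (φ p) = φ (D.inEdge p) :=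
  inEdge_eq (by rw [h.next, next_inEdge])

/-- The colour relations after the move. -/
lemma IsTriangleMove.isColoring (h : IsTriangleMove D E e φ a b c τ s v w) {t : ℂ}
    {u : Fin D.n → ℂ} {k κ : D.Passage → Bool → ℂ} (hk : D.IsColoring t u k)
    (hκ : ∀ p, (∀ j, p ≠ triangleFirst a b c s v w j) → κ p = k p)
    (hT : IsTriangle τ (-s) (-v) (-w) t (u a) (u b) (u c)
      (fun j => k (D.inEdge (triangleFirst a b c s v w j)))
      (fun j => κ (triangleFirst a b c s v w j)) (fun j => k (triangleSecond a b c s v w j))) :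
    E.IsColoring t (u ∘ e.symm) (κ ∘ φ.symm) := by
  have hin : ∀ {p q}, φ p = q → (κ ∘ φ.symm) (E.inEdge q) = κ (D.inEdge p) ∧
      (κ ∘ φ.symm) q = κ p := by
    rintro p _ rfl
    rw [h.inEdge_map]
    simp
  -- The outer edges of the triangle are not middle edges, so they keep their colours.
  have hI : ∀ j, κ (D.inEdge (triangleFirst a b c s v w j)) =
      k (D.inEdge (triangleFirst a b c s v w j)) := fun j => hκ _ fun i hi => by
    have := congrArg D.next hi
    rw [next_inEdge, h.next_triangleFirst] at this
    exact h.triangleSecond_ne _ _ this.symm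
  have hO : ∀ j, κ (triangleSecond a b c s v w j) = k (triangleSecond a b c s v w j) :=
    fun j => hκ _ fun i => h.triangleSecond_ne _ _
  obtain ⟨ta, tb, tc⟩ := hT
  intro x
  rw [isDehn_iff_isCrossing, h.symm.sign |> fun h' => (h' x).symm]
  obtain ⟨x, rfl⟩ := e.surjective x
  rw [Function.comp_apply, Equiv.symm_apply_apply]
  by_cases xa : x = a
  · subst xa
    obtain ⟨e1, e2⟩ := strand_right h.top (κ := κ) (hI 0) rfl (hO 0)
    obtain ⟨e3, e4⟩ := strand_right h.middle (κ := κ) (hI 1) rfl (hO 1)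
    rw [(hin h.top_b).1, (hin h.top_b).2, (hin h.mid_c).1, (hin h.mid_c).2, e1, e2, e3, e4,
      h.sign_a]
    rw [mul_neg, mul_neg, neg_mul, neg_neg] at ta
    exact ta
  by_cases xb : x = b
  · subst xb
    obtain ⟨e1, e2⟩ := strand_left h.top (κ := κ) (hI 0) rfl (hO 0)
    obtain ⟨e3, e4⟩ := strand_right h.bottom (κ := κ) (hI 2) rfl (hO 2)
    rw [(hin h.top_a).1, (hin h.top_a).2, (hin h.bot_c).1, (hin h.bot_c).2, e1, e2, e3, e4,
      h.sign_b]
    rw [mul_neg, mul_neg, neg_mul, neg_neg, neg_neg] at tb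
    exact tb
  by_cases xc : x = c
  · subst xc
    obtain ⟨e1, e2⟩ := strand_left h.middle (κ := κ) (hI 1) rfl (hO 1)
    obtain ⟨e3, e4⟩ := strand_left h.bottom (κ := κ) (hI 2) rfl (hO 2)
    rw [(hin h.mid_a).1, (hin h.mid_a).2, (hin h.bot_b).1, (hin h.bot_b).2, e1, e2, e3, e4,
      h.sign_c]
    rw [mul_neg, mul_neg, neg_mul, neg_neg, neg_neg, neg_neg] at tc
    exact tc
  have hne : ∀ o j, (x, o) ≠ triangleFirst a b c s v w j ∧
      D.inEdge (x, o) ≠ triangleFirst a b c s v w j := fun o j => by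
    constructor
    · intro hx
      have := (h.fst_mem j).1
      rw [← hx] at this
      tauto
    · intro hx
      have := (h.fst_mem j).2
      rw [← h.next_triangleFirst, ← hx, next_inEdge] at this
      tauto
  have ho := fun o => hin (h.other x xa xb xc o)
  rw [(ho _).1, (ho _).1, (ho _).2, (ho _).2, hκ _ fun j => (hne _ j).1, hκ _ fun j => (hne _ j).2,
    hκ _ fun j => (hne _ j).1, hκ _ fun j => (hne _ j).2, ← isDehn_iff_isCrossing]
  exact hk x

/-- If the colours of the middle edges can be adapted to the move, nondegeneracy is preserved. -/
lemma IsTriangleMove.isNondegenerate (h : IsTriangleMove D E e φ a b c τ s v w)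
    (hD : D.Planar) (hE : E.Planar) {t : ℂ} (ht : t ≠ 0) {r : Fin D.n → ℂ}
    (hmove : ∀ I M O, IsTriangle τ s v w t (colorParam t r a) (colorParam t r b)
      (colorParam t r c) I M O → ∃ M', IsTriangle τ (-s) (-v) (-w) t (colorParam t r a)
        (colorParam t r b) (colorParam t r c) I M' O)
    (hzero : ∀ M, IsTriangle τ s v w t (colorParam t r a) (colorParam t r b)
      (colorParam t r c) 0 M 0 → M = 0)
    (hN : E.IsNondegenerate t (r ∘ e.symm)) : D.IsNondegenerate t r := by
  classical
  -- Rigidity may be tested at any edge. The chosen one leaves the triangle, so its colour is not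
  -- affected by the move.
  refine IsRigid.isNondegenerate hD ht (p := triangleSecond a b c s v w 0) fun k hk hk0 => ?_
  have hT := h.isTriangle hk
  obtain ⟨M', hM'⟩ := hmove _ _ _ hT
  -- Only the three middle edges are recoloured, with the values `M'` supplied by the local move.
  let κ : D.Passage → Bool → ℂ := fun p =>
    if hp : ∃ j, p = triangleFirst a b c s v w j then M' hp.choose else k p
  have hκ : ∀ p, (∀ j, p ≠ triangleFirst a b c s v w j) → κ p = k p := fun p hp =>
    dif_neg (not_exists.2 hp)
  have hκ' : ∀ j, κ (triangleFirst a b c s v w j) = M' j := fun j => by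
    have hp : ∃ i, triangleFirst a b c s v w j = triangleFirst a b c s v w i := ⟨j, rfl⟩
    have h1 : κ (triangleFirst a b c s v w j) = M' hp.choose := dif_pos hp
    rw [h1, ← h.triangleFirst_injective hp.choose_spec]
  have hcol := h.isColoring hk hκ (by simpa only [hκ'] using hM')
  have h0 := hN.isRigid hE ht (φ (triangleSecond a b c s v w 0)) _ hcol (by
    rw [Function.comp_apply, Equiv.symm_apply_apply, hκ _ fun i => h.triangleSecond_ne _ _, hk0])
  have hκ0 : ∀ p, κ p = 0 := fun p => by
    have := congrFun h0 (φ p)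
    rwa [Function.comp_apply, Equiv.symm_apply_apply] at this
  have hout : ∀ p, (∀ j, p ≠ triangleFirst a b c s v w j) → k p = 0 := fun p hp => by
    rw [← hκ p hp, hκ0]
  have hI : (fun j => k (D.inEdge (triangleFirst a b c s v w j))) = 0 := funext fun j =>
    hout _ fun i hi => by
      have := congrArg D.next hi
      rw [next_inEdge, h.next_triangleFirst] at this
      exact h.triangleSecond_ne _ _ this.symm
  have hO : (fun j => k (triangleSecond a b c s v w j)) = 0 := funext fun j =>
    hout _ fun i => h.triangleSecond_ne _ _
  rw [hI, hO] at hT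
  have hM := hzero _ hT
  funext p
  by_cases hp : ∃ j, p = triangleFirst a b c s v w j
  · obtain ⟨j, rfl⟩ := hp
    exact congrFun hM j
  · exact hout p (not_exists.1 hp)

end triangle

end GaussCode

/-! ### Weights compatible with the third move -/

namespace GaussCode

variable {D E : GaussCode}

section triangle

variable {e : Fin D.n ≃ Fin E.n} {φ : D.Passage ≃ E.Passage} {a b c : Fin D.n} {τ s v w : ℤˣ}

lemma colorParam_eq_signParam_neg {t : ℂ} {r : Fin D.n → ℂ} {x : Fin D.n}
    (hr : r x = 1 - D.baseWeight x) : colorParam t r x = signParam (-D.sign x) t := by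
  rw [colorParam, hr, baseWeight, signParam]
  rcases Int.units_eq_one_or (D.sign x) with h | h <;>
    simp [h, show (-1 : ℤˣ) ≠ 1 by decide]

/-- The weights for which the third move preserves nondegeneracy: one crossing of the triangle may
have an arbitrary weight. -/
def IsTriangleWeight (a b c : Fin D.n) (r : Fin D.n → ℂ) : Prop :=
  (r b = D.baseWeight b ∧ r c = D.baseWeight c) ∨
  (r a = 1 - D.baseWeight a ∧ r c = D.baseWeight c) ∨
  (r a = D.baseWeight a ∧ r b = D.baseWeight b)

/-- In the second alternative the free crossing is `b`, and the local move then needs the parameter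
of the opposite sign at `a`. This is why the weight at `a` is toggled in the comparison of
signatures. -/
lemma IsTriangleMove.isNondegenerate_of_isTriangleWeight
    (h : IsTriangleMove D E e φ a b c τ s v w) (hD : D.Planar) (hE : E.Planar) {t : ℂ}
    (ht : t ≠ 0) {r : Fin D.n → ℂ} (hr : IsTriangleWeight a b c r)
    (hN : E.IsNondegenerate t (r ∘ e.symm)) : D.IsNondegenerate t r := by
  rcases hr with ⟨h1, h2⟩ | ⟨h1, h2⟩ | ⟨h1, h2⟩
  · refine h.isNondegenerate hD hE ht ?_ ?_ hN <;>
      rw [colorParam_eq_signParam h1, colorParam_eq_signParam h2, h.sign_b, h.sign_c]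
    · exact fun I M O hT => hT.move_a ht
    · exact fun M hT => hT.middle_eq_zero_c ht rfl rfl
  · refine h.isNondegenerate hD hE ht ?_ ?_ hN <;>
      rw [colorParam_eq_signParam_neg h1, colorParam_eq_signParam h2, h.sign_a, h.sign_c]
    · exact fun I M O hT => hT.move_b ht
    · exact fun M hT => hT.middle_eq_zero_c ht rfl rfl
  · refine h.isNondegenerate hD hE ht ?_ ?_ hN <;>
      rw [colorParam_eq_signParam h1, colorParam_eq_signParam h2, h.sign_a, h.sign_b]
    · exact fun I M O hT => hT.move_c ht
    · exact fun M hT => hT.middle_eq_zero_a ht rfl rfl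

lemma IsTriangleMove.baseWeight_eq (h : IsTriangleMove D E e φ a b c τ s v w) (x : Fin D.n) :
    E.baseWeight (e x) = D.baseWeight x := by
  rw [baseWeight, baseWeight, h.sign]

lemma IsTriangleMove.isNondegenerate_iff (h : IsTriangleMove D E e φ a b c τ s v w)
    (hD : D.Planar) (hE : E.Planar) {t : ℂ} (ht : t ≠ 0) {r : Fin D.n → ℂ}
    (hr : IsTriangleWeight a b c r) :
    D.IsNondegenerate t r ↔ E.IsNondegenerate t (r ∘ e.symm) := by
  refine ⟨fun hN => ?_, h.isNondegenerate_of_isTriangleWeight hD hE ht hr⟩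
  refine h.symm.isNondegenerate_of_isTriangleWeight hE hD ht ?_ ?_
  · simpa only [IsTriangleWeight, Function.comp_apply, Equiv.symm_apply_apply, h.baseWeight_eq]
      using hr
  · convert hN using 1
    ext x
    simp

lemma comp_add_sum_single {J : Type*} [Fintype J] (f : J → Fin D.n) (r : Fin D.n → ℝ)
    (z : J → ℝ) (e : Fin D.n ≃ Fin E.n) :
    r ∘ e.symm + ∑ j, z j • (Pi.single (e (f j)) 1 : Fin E.n → ℝ) =
      (r + ∑ j, z j • Pi.single (f j) 1) ∘ e.symm := by
  ext x
  obtain ⟨x, rfl⟩ := e.surjective x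
  simp [Pi.single_apply]

lemma IsTriangleMove.perturb_det_iff (h : IsTriangleMove D E e φ a b c τ s v w)
    (hD : D.Planar) (hE : E.Planar) {J : Type*} [Fintype J] (f : J → Fin D.n) (r : Fin D.n → ℝ)
    (hr : ∀ z : J → ℝ, IsTriangleWeight a b c
      fun x => (((r + ∑ j, z j • Pi.single (f j) 1 : Fin D.n → ℝ) x : ℝ) : ℂ))
    {θ : ℝ} (hθ : θ ∈ Set.Ioo 0 (2 * Real.pi)) (z : J → ℝ) :
    (perturb (twist θ (D.wMatrix r)) (fun j => D.flowVec (f j)) z).det = 0 ↔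
    (perturb (twist θ (E.wMatrix (r ∘ e.symm))) (fun j => E.flowVec (e (f j))) z).det = 0 := by
  rw [perturb_twist_wMatrix hθ, perturb_twist_wMatrix hθ _ fun j => e (f j), comp_add_sum_single,
    ← not_iff_not, ← ne_eq, ← ne_eq,
      det_twist_wMatrix_ne_zero_iff hD,
    det_twist_wMatrix_ne_zero_iff hE, h.isNondegenerate_iff hD hE (Complex.exp_ne_zero _) (hr _)]
  rfl

/-- At a parameter as in `exists_perturb_ker` a kernel vector pairs to zero with all directions. The
perturbation then acts trivially on it, so it already lies in the kernel of `A`. -/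
lemma exists_ker_of_det_perturb_eq_zero {J : Type*} [Fintype J]
    {A : Matrix (Fin D.seifertRank) (Fin D.seifertRank) ℂ} (hA : A.IsHermitian) (f : J → Fin D.n)
    (h : ∀ z, (perturb A (fun j => D.flowVec (f j)) z).det = 0) :
    ∃ u ≠ 0, A *ᵥ u = 0 ∧ ∀ j, pairing (D.flowVec (f j)) u = 0 := by
  obtain ⟨z, hz⟩ := exists_perturb_ker hA fun j => D.flowVec (f j)
  obtain ⟨u, hu, hu0⟩ := Matrix.exists_mulVec_eq_zero_iff.2 (h z)
  refine ⟨u, hu, ?_, hz u hu0⟩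
  have h0 := hu0
  rw [perturb, Matrix.add_mulVec, Matrix.sum_mulVec, Finset.sum_eq_zero, add_zero] at h0
  · exact h0
  · intro j _
    rw [Matrix.smul_mulVec, rankOne_mulVec, hz u hu0, zero_smul, smul_zero]

lemma sum_pairing_flowVec (hD : D.Planar) (u : Fin D.seifertRank → ℂ) :
    ∑ x, pairing (D.flowVec x) u = 0 := by
  simp only [← flow_cycleOf]
  exact D.sum_flow hD (D.cycleOf_mem u)

lemma pairing_add_eq_zero (hD : D.Planar) {u : Fin D.seifertRank → ℂ} {x y : Fin D.n}
    (hxy : x ≠ y) (h : ∀ z, z ≠ x → z ≠ y → pairing (D.flowVec z) u = 0) :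
    pairing (D.flowVec x) u + pairing (D.flowVec y) u = 0 := by
  rw [← sum_pairing_flowVec hD u, Fintype.sum_eq_add x y hxy fun z hz => h z hz.1 hz.2]

/-- A weight toggled at the crossing `a`. -/
def toggleWeight (D : GaussCode) (a : Fin D.n) : Fin D.n → ℝ :=
  D.baseWeight + (1 - 2 * D.baseWeight a) • Pi.single a 1

lemma toggleWeight_self : D.toggleWeight a a = 1 - D.baseWeight a := by
  simp [toggleWeight]
  ring

lemma toggleWeight_of_ne {x : Fin D.n} (hx : x ≠ a) : D.toggleWeight a x = D.baseWeight x := by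
  simp [toggleWeight, hx]

lemma one_sub_two_mul_baseWeight_ne_zero (x : Fin D.n) : 1 - 2 * D.baseWeight x ≠ 0 := by
  rw [baseWeight]
  split_ifs <;> norm_num

lemma twist_toggleWeight (θ : ℝ) (a : Fin D.n) : twist θ (D.wMatrix (D.toggleWeight a)) =
    twist θ (D.wMatrix D.baseWeight) +
      ((2 * Real.sin (θ / 2) * (1 - 2 * D.baseWeight a) : ℝ) : ℂ) • rankOne (D.flowVec a) := by
  have := D.wMatrix_add_sum (fun _ : Unit => a) D.baseWeight fun _ => 1 - 2 * D.baseWeight a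
  simp only [Finset.univ_unique, Finset.sum_singleton] at this
  rw [toggleWeight, this, twist_add_rankOne]

/-- Kernel vectors with flows through two crossings only, for three pairs of crossings. -/
lemma false_of_triangle_kernels (hD : D.Planar) {θ : ℝ} (hθ : θ ∈ Set.Ioo 0 (2 * Real.pi))
    (hab : a ≠ b) (hac : a ≠ c) (hbc : b ≠ c) {u₁ u₂ u₃ : Fin D.seifertRank → ℂ}
    (n₁ : u₁ ≠ 0) (n₂ : u₂ ≠ 0) (n₃ : u₃ ≠ 0)
    (k₁ : twist θ (D.wMatrix D.baseWeight) *ᵥ u₁ = 0)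
    (k₂ : twist θ (D.wMatrix D.baseWeight) *ᵥ u₂ = 0)
    (k₃ : twist θ (D.wMatrix (D.toggleWeight a)) *ᵥ u₃ = 0)
    (z₁ : ∀ x, x ≠ b → x ≠ c → pairing (D.flowVec x) u₁ = 0)
    (z₂ : ∀ x, x ≠ a → x ≠ b → pairing (D.flowVec x) u₂ = 0)
    (z₃ : ∀ x, x ≠ a → x ≠ c → pairing (D.flowVec x) u₃ = 0) : False := by
  have e₁ := pairing_add_eq_zero hD hbc z₁
  have e₂ := pairing_add_eq_zero hD hab z₂
  have e₃ := pairing_add_eq_zero hD hac z₃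
  set β := pairing (D.flowVec b) u₁
  set γ := pairing (D.flowVec a) u₂
  set δ := pairing (D.flowVec a) u₃
  have hβ : β ≠ 0 := fun hβ => n₁ (D.eq_zero_of_pairing_flowVec fun x => by
    by_cases xb : x = b
    · rw [xb]; exact hβ
    by_cases xc : x = c
    · rw [xc]; simpa [hβ] using e₁
    exact z₁ x xb xc)
  have hγ : γ ≠ 0 := fun hγ => n₂ (D.eq_zero_of_pairing_flowVec fun x => by
    by_cases xb : x = a
    · rw [xb]; exact hγ
    by_cases xc : x = b
    · rw [xc]; simpa [hγ] using e₂
    exact z₂ x xb xc)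
  have hδ : δ ≠ 0 := fun hδ => n₃ (D.eq_zero_of_pairing_flowVec fun x => by
    by_cases xb : x = a
    · rw [xb]; exact hδ
    by_cases xc : x = c
    · rw [xc]; simpa [hδ] using e₃
    exact z₃ x xb xc)
  -- Total flow zero makes the flows of `u₁`, `u₂`, `u₃` multiples of `e_b - e_c`, `e_a - e_b`, `e_a
  -- - e_c`. The last one is the sum of the other two, with coefficients scaled to match `u₃`.
  have hu : u₃ - ((δ / γ) • u₂ + (δ / β) • u₁) = 0 := by
    refine D.eq_zero_of_pairing_flowVec fun x => ?_
    rw [map_sub, map_add, map_smul, map_smul, smul_eq_mul, smul_eq_mul]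
    by_cases xa : x = a
    · rw [xa, z₁ a hab hac]
      change δ - (δ / γ * γ + δ / β * 0) = 0
      field_simp
      ring
    by_cases xb : x = b
    · rw [xb, z₃ b hab.symm hbc, eq_neg_of_add_eq_zero_right e₂]
      change 0 - (δ / γ * -γ + δ / β * β) = 0
      field_simp
      ring
    by_cases xc : x = c
    · rw [xc, z₂ c hac.symm hbc.symm, eq_neg_of_add_eq_zero_right e₁,
        eq_neg_of_add_eq_zero_right e₃]
      field_simp
      ring
    rw [z₁ x xb xc, z₂ x xa xb, z₃ x xa xc]
    ring
  -- Thus `u₃` lies in the kernel before and after toggling `a`. The rank one difference annihilates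
  -- `u₃`, although its flow `δ` through `a` is nonzero, so `flowVec a` would vanish.
  have hker : twist θ (D.wMatrix D.baseWeight) *ᵥ u₃ = 0 := by
    rw [sub_eq_zero.1 hu, Matrix.mulVec_add, Matrix.mulVec_smul, Matrix.mulVec_smul, k₁, k₂]
    simp
  rw [twist_toggleWeight, Matrix.add_mulVec, hker, zero_add, Matrix.smul_mulVec,
    rankOne_mulVec] at k₃
  have hq : ∀ i, D.flowVec a i = 0 := fun i => by
    have := congrFun k₃ i
    simp only [Pi.smul_apply, smul_eq_mul, Pi.zero_apply, mul_eq_zero] at this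
    have h1 : ((2 * Real.sin (θ / 2) * (1 - 2 * D.baseWeight a) : ℝ) : ℂ) ≠ 0 :=
      Complex.ofReal_ne_zero.2
        (mul_ne_zero (sin_half_pos hθ).ne' (one_sub_two_mul_baseWeight_ne_zero a))
    have h2 := (this.resolve_left h1).resolve_left hδ
    exact_mod_cast h2
  apply hδ
  change pairing (D.flowVec a) u₃ = 0
  rw [pairing_apply]
  simp [hq]

end triangle

end GaussCode

namespace GaussCode

variable {D E : GaussCode}

section triangle

variable {e : Fin D.n ≃ Fin E.n} {φ : D.Passage ≃ E.Passage} {a b c : Fin D.n} {τ s v w : ℤˣ}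

lemma weight_add_apply_of_not {x : Fin D.n} {P : Fin D.n → Prop} [Fintype {i // P i}]
    (hx : ¬ P x) (r : Fin D.n → ℝ) (z : {i // P i} → ℝ) :
    (((r + ∑ j, z j • (Pi.single (j : Fin D.n) 1 : Fin D.n → ℝ)) x : ℝ) : ℂ) = r x := by
  rw [Pi.add_apply, sum_smul_single_apply_of_notMem, add_zero]
  rintro ⟨j, rfl⟩
  exact hx j.2

lemma IsTriangleMove.comp_baseWeight (h : IsTriangleMove D E e φ a b c τ s v w) :
    D.baseWeight ∘ e.symm = E.baseWeight := by
  ext x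
  rw [Function.comp_apply, ← h.baseWeight_eq, Equiv.apply_symm_apply]

/-- Toggling `a` moves one coordinate of the family in which `a` is free. The signature difference
is therefore the same before and after toggling at all nearby angles where both forms are
nonsingular. -/
lemma IsTriangleMove.sigDiffConstAt_of_toggle (h : IsTriangleMove D E e φ a b c τ s v w)
    (hD : D.Planar) {x : ℝ} (hx : x ∈ Set.Ioo 0 (2 * Real.pi))
    (key : ∀ θ ∈ Set.Ioo 0 (2 * Real.pi), ∀ z,
      (perturb (twist θ (D.wMatrix D.baseWeight))
        (fun j : {i // i ≠ b ∧ i ≠ c} => D.flowVec j) z).det = 0 ↔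
      (perturb (twist θ (E.wMatrix (D.baseWeight ∘ e.symm)))
        (fun j : {i // i ≠ b ∧ i ≠ c} => E.flowVec (e j)) z).det = 0)
    (hS : SigDiffConstAt (D.wMatrix (D.toggleWeight a)) (E.wMatrix (D.toggleWeight a ∘ e.symm)) x) :
    SigDiffConstAt (D.wMatrix D.baseWeight) (E.wMatrix (D.baseWeight ∘ e.symm)) x := by
  obtain ⟨C, hC⟩ := hS
  refine ⟨C, ?_⟩
  filter_upwards [hC, eventually_det_twist_ne_zero (D.det_twist_zero_ne_zero hD D.baseWeight) x,
    eventually_det_twist_ne_zero (D.det_twist_zero_ne_zero hD (D.toggleWeight a)) x,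
    nhdsWithin_le_nhds (isOpen_Ioo.mem_nhds hx)] with θ h1 h2 h3 hθ
  let j₀ : {i // i ≠ b ∧ i ≠ c} := ⟨a, h.ab, h.ac⟩
  let z : {i // i ≠ b ∧ i ≠ c} → ℝ :=
    Pi.single j₀ (2 * Real.sin (θ / 2) * (1 - 2 * D.baseWeight a))
  have hz : D.baseWeight + ∑ j, (z j / (2 * Real.sin (θ / 2))) • Pi.single (j : Fin D.n) 1 =
      D.toggleWeight a := by
    rw [toggleWeight, Finset.sum_eq_single j₀]
    · simp only [z, Pi.single_eq_same]
      rw [mul_div_cancel_left₀ _ (sin_half_pos hθ).ne']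
    · intro j _ hj
      simp [z, hj]
    · simp
  have e1 : perturb (twist θ (D.wMatrix D.baseWeight))
      (fun j : {i // i ≠ b ∧ i ≠ c} => D.flowVec j) z =
      twist θ (D.wMatrix (D.toggleWeight a)) := by
    rw [perturb_twist_wMatrix hθ, hz]
  have e2 : perturb (twist θ (E.wMatrix (D.baseWeight ∘ e.symm)))
      (fun j : {i // i ≠ b ∧ i ≠ c} => E.flowVec (e j)) z =
      twist θ (E.wMatrix (D.toggleWeight a ∘ e.symm)) := by
    refine (perturb_twist_wMatrix hθ _ (fun j : {i // i ≠ b ∧ i ≠ c} => e (j : Fin D.n)) z).trans ?_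
    rw [comp_add_sum_single (fun j : {i // i ≠ b ∧ i ≠ c} => (j : Fin D.n)), hz]
  have h0 : ∀ {m : ℕ} (A : Matrix (Fin m) (Fin m) ℂ) (q : {i // i ≠ b ∧ i ≠ c} → Fin m → ℝ),
      perturb A q 0 = A := fun A q => by simp [perturb]
  have := sigIdx_perturb_sub_eq (twist_isHermitian θ _) (twist_isHermitian θ _) _ _ (key θ hθ)
    (w := 0) (w' := z) (by rwa [h0]) (by rwa [e1])
  rw [h0, h0, e1, e2] at this
  rw [this, h1]

/-- At each angle one of three families has a nonsingular member: free weights off `b, c`, off `a,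
b`, or off `a, c` with `a` toggled. In the last case the result is transferred back to the actual
weights. -/
lemma IsTriangleMove.sameSignature (h : IsTriangleMove D E e φ a b c τ s v w)
    (hD : D.Planar) (hE : E.Planar) : SameSignature D E := by
  have key₁ := fun θ (hθ : θ ∈ Set.Ioo 0 (2 * Real.pi)) z => h.perturb_det_iff hD hE
    (fun j : {i // i ≠ b ∧ i ≠ c} => (j : Fin D.n)) D.baseWeight (fun z => Or.inl
      ⟨weight_add_apply_of_not (by simp) _ _,
        weight_add_apply_of_not (by simp) _ _⟩) hθ z
  have key₂ := fun θ (hθ : θ ∈ Set.Ioo 0 (2 * Real.pi)) z => h.perturb_det_iff hD hE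
    (fun j : {i // i ≠ a ∧ i ≠ b} => (j : Fin D.n)) D.baseWeight (fun z => Or.inr (Or.inr
      ⟨weight_add_apply_of_not (by simp) _ _,
        weight_add_apply_of_not (by simp) _ _⟩)) hθ z
  have key₃ := fun θ (hθ : θ ∈ Set.Ioo 0 (2 * Real.pi)) z => h.perturb_det_iff hD hE
    (fun j : {i // i ≠ a ∧ i ≠ c} => (j : Fin D.n)) (D.toggleWeight a) (fun z => Or.inr (Or.inl
      ⟨(weight_add_apply_of_not (by simp) _ _).trans (by rw [toggleWeight_self]; simp),
        (weight_add_apply_of_not (by simp) _ _).trans (by rw [toggleWeight_of_ne h.ac.symm])⟩)) hθ z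
  have h0 : ∀ {m : ℕ} (A : Matrix (Fin m) (Fin m) ℂ) (q : {i // i ≠ b ∧ i ≠ c} → Fin m → ℝ),
      perturb A q 0 = A := fun A q => by simp [perturb]
  have hsig : ∀ y ∈ Set.Ioo 0 (2 * Real.pi),
      SigDiffConstAt (D.wMatrix D.baseWeight) (E.wMatrix (D.baseWeight ∘ e.symm)) y := by
    intro y hy
    by_cases h₁ : ∃ z, (perturb (twist y (D.wMatrix D.baseWeight))
        (fun j : {i // i ≠ b ∧ i ≠ c} => D.flowVec j) z).det ≠ 0
    · obtain ⟨z, hz⟩ := h₁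
      exact sigDiffConstAt_of_perturb (det_twist_zero_ne_zero hD _) _ _ key₁ hy hz
    by_cases h₂ : ∃ z, (perturb (twist y (D.wMatrix D.baseWeight))
        (fun j : {i // i ≠ a ∧ i ≠ b} => D.flowVec j) z).det ≠ 0
    · obtain ⟨z, hz⟩ := h₂
      exact sigDiffConstAt_of_perturb (det_twist_zero_ne_zero hD _) _ _ key₂ hy hz
    by_cases h₃ : ∃ z, (perturb (twist y (D.wMatrix (D.toggleWeight a)))
        (fun j : {i // i ≠ a ∧ i ≠ c} => D.flowVec j) z).det ≠ 0
    · obtain ⟨z, hz⟩ := h₃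
      exact h.sigDiffConstAt_of_toggle hD hy key₁
        (sigDiffConstAt_of_perturb (det_twist_zero_ne_zero hD _) _ _ key₃ hy hz)
    -- If all three families were singular, each would yield a kernel vector with flow only through
    -- its two fixed crossings.
    push Not at h₁ h₂ h₃
    obtain ⟨u₁, n₁, k₁, z₁⟩ := exists_ker_of_det_perturb_eq_zero (twist_isHermitian _ _) _ h₁
    obtain ⟨u₂, n₂, k₂, z₂⟩ := exists_ker_of_det_perturb_eq_zero (twist_isHermitian _ _) _ h₂
    obtain ⟨u₃, n₃, k₃, z₃⟩ := exists_ker_of_det_perturb_eq_zero (twist_isHermitian _ _) _ h₃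
    exact (false_of_triangle_kernels hD hy h.ab h.ac h.bc n₁ n₂ n₃ k₁ k₂ k₃
      (fun x h h' => z₁ ⟨x, h, h'⟩) (fun x h h' => z₂ ⟨x, h, h'⟩)
      (fun x h h' => z₃ ⟨x, h, h'⟩)).elim
  have hdet : ∀ θ ∈ Set.Ioo 0 (2 * Real.pi), (twist θ (D.wMatrix D.baseWeight)).det = 0 ↔
      (twist θ (E.wMatrix (D.baseWeight ∘ e.symm))).det = 0 := fun θ hθ => by
    have := key₁ θ hθ 0
    rwa [h0, h0] at this
  intro x hx
  rw [← h.comp_baseWeight]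
  exact ⟨hdet x hx, fun hne => sigIdx_twist_eq (det_twist_zero_ne_zero hD _)
    (det_twist_zero_ne_zero hE _) hsig hx hne fun h0 => hne ((hdet x hx).2 h0)⟩

end triangle

end GaussCode

/-! ### Independence of the diagram -/

lemma ReidemeisterMove.sameSignature {D E : KnotDiagram} (h : ReidemeisterMove D E) :
    GaussCode.SameSignature D.toGaussCode E.toGaussCode := by
  rcases h with h | h | h | h
  · exact h.sameSignature D.planar E.planar
  · exact h.sameSignature D.planar E.planar
  · exact h.sameSignature D.planar E.planar
  · obtain ⟨e, φ, a, b, c, τ, s, v, w, h⟩ := h.exists_isTriangleMove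
    exact h.sameSignature D.planar E.planar

lemma KnotDiagram.sameSignature {D E : KnotDiagram} (h : D.knot = E.knot) :
    GaussCode.SameSignature D.toGaussCode E.toGaussCode := by
  have h' : Relation.EqvGen ReidemeisterMove D E := Quot.eqvGen_exact h
  clear h
  induction h' with
  | rel D E h => exact h.sameSignature
  | refl D => exact fun x _ => ⟨Iff.rfl, fun _ => rfl⟩
  | symm D E _ ih => exact ih.symm
  | trans D E F _ _ ih1 ih2 => exact ih1.trans ih2

namespace GaussCode

variable {D E : GaussCode}

/-! ## Diagrams with the same smoothing -/

/-- The correspondence `φ` of the edges preserves the smoothed diagram, but possibly not the signs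
of the crossings. -/
structure IsRelabelling (D E : GaussCode) (e : Fin D.n ≃ Fin E.n) (φ : D.Passage ≃ E.Passage) :
    Prop where
  leftIn : ∀ x, E.leftIn (e x) = φ (D.leftIn x)
  leftOut : ∀ x, E.leftOut (e x) = φ (D.leftOut x)
  rightIn : ∀ x, E.rightIn (e x) = φ (D.rightIn x)
  rightOut : ∀ x, E.rightOut (e x) = φ (D.rightOut x)

namespace IsRelabelling

variable {e : Fin D.n ≃ Fin E.n} {φ : D.Passage ≃ E.Passage}

lemma mem_cycles_iff (h : IsRelabelling D E e φ) {x : E.Passage → ℤ} :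
    x ∈ E.cycles ↔ x ∘ φ ∈ D.cycles := by
  rw [GaussCode.mem_cycles_iff, GaussCode.mem_cycles_iff]
  refine (e.forall_congr fun c => ?_).symm
  rw [h.leftIn, h.leftOut, h.rightIn, h.rightOut]
  rfl

lemma bandFlow_comp (h : IsRelabelling D E e φ) (x : E.Passage → ℤ) (c : Fin D.n) :
    D.bandFlow (x ∘ φ) c = E.bandFlow x (e c) := by
  rw [← flow_eq_bandFlow, ← flow_eq_bandFlow, flow_apply, flow_apply, h.leftIn, h.leftOut]
  rfl

lemma map_seifertHomology (h : IsRelabelling D E e φ) :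
    E.seifertHomology.map (LinearEquiv.funCongrLeft ℤ ℤ e).toLinearMap = D.seifertHomology := by
  ext y
  constructor
  · rintro ⟨_, ⟨x, hx, rfl⟩, rfl⟩
    exact ⟨x ∘ φ, h.mem_cycles_iff.1 hx, funext fun c => h.bandFlow_comp x c⟩
  · rintro ⟨x, hx, rfl⟩
    have e1 : (x ∘ φ.symm) ∘ φ = x := by
      ext p
      simp
    refine ⟨_, ⟨x ∘ φ.symm, h.mem_cycles_iff.2 (by rwa [e1]), rfl⟩, funext fun c => ?_⟩
    have := (h.bandFlow_comp (x ∘ φ.symm) c).symm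
    rwa [e1] at this

/-- The basis of the homology, carried over to the other diagram. -/
def basis (h : IsRelabelling D E e φ) : Module.Basis (Fin E.seifertRank) ℤ D.seifertHomology :=
  E.seifertBasis.map (((LinearEquiv.funCongrLeft ℤ ℤ e).submoduleMap _).trans
    (LinearEquiv.ofEq _ _ h.map_seifertHomology))

lemma basis_apply (h : IsRelabelling D E e φ) (i : Fin E.seifertRank) (c : Fin D.n) :
    (h.basis i : Fin D.n → ℤ) c = D.bandFlow (E.seifertCycle i ∘ φ) c := by
  rw [h.bandFlow_comp, bandFlow_seifertCycle]
  rfl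

/-- The base change matrix. -/
def matrix (h : IsRelabelling D E e φ) : Matrix (Fin E.seifertRank) (Fin D.seifertRank) ℤ :=
  (D.seifertBasis.toMatrix h.basis)ᵀ

lemma exists_matrix_inverse (h : IsRelabelling D E e φ) :
    ∃ Q : Matrix (Fin D.seifertRank) (Fin E.seifertRank) ℤ, h.matrix * Q = 1 ∧ Q * h.matrix = 1 := by
  refine ⟨(h.basis.toMatrix D.seifertBasis)ᵀ, ?_, ?_⟩ <;>
    rw [matrix, ← Matrix.transpose_mul, Module.Basis.toMatrix_mul_toMatrix_flip,
      Matrix.transpose_one]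

/-- The weighted form refers only to the smoothed diagram and the weights. Corresponding cycles with
equal flows have equal values, so the two matrices differ by a base change. -/
lemma wMatrix_eq (h : IsRelabelling D E e φ) (hD : D.Planar) (w : Fin E.n → ℝ) :
    E.wMatrix w = h.matrix.map (Int.cast : ℤ → ℝ) * D.wMatrix (w ∘ e) *
      (h.matrix.map (Int.cast : ℤ → ℝ))ᵀ := by
  ext i j
  apply Complex.ofReal_injective
  let z : Fin E.seifertRank → D.Passage → ℂ := fun i p => (E.seifertCycle i (φ p) : ℂ)
  let P : Fin E.seifertRank → Fin D.seifertRank → ℂ := fun i k => (h.matrix i k : ℂ)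
  have hz : ∀ i, z i ∈ D.cyclesOver ℂ := fun i => D.castCycle_mem
    (h.mem_cycles_iff.1 (E.seifertCycle_mem i))
  have hflow : ∀ i, D.flow ℂ (z i) = D.flow ℂ (D.cycleOf (P i)) := fun i => by
    ext c
    have h1 := congrArg (fun y : D.seifertHomology => y.1 c)
      (D.seifertBasis.sum_repr (h.basis i))
    simp only [Submodule.coe_sum, Finset.sum_apply, Submodule.coe_smul, Pi.smul_apply,
      smul_eq_mul] at h1
    have h2 := D.flow_castCycle (E.seifertCycle i ∘ φ) c
    refine h2.trans ?_
    rw [flow_cycleOf, pairing_apply, ← h.basis_apply, ← h1]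
    push_cast
    refine Finset.sum_congr rfl fun k _ => ?_
    rw [← bandFlow_seifertCycle, mul_comm]
    simp [flowVec, P, matrix, Module.Basis.toMatrix_apply]
  have h1 : ((E.wMatrix w i j : ℝ) : ℂ) = D.weightedForm (fun c => (w (e c) : ℂ)) (z i) (z j) := by
    rw [wMatrix_apply_eq, weightedForm, weightedForm, ← Equiv.sum_comp e]
    refine Finset.sum_congr rfl fun c _ => ?_
    rw [flow_apply, flow_apply, flow_apply, flow_apply, h.leftIn, h.leftOut]
  rw [h1, weightedForm_congr hD (hz i) (D.cycleOf_mem (P i)) (hz j) (hflow i) (hflow j),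
    weightedForm_cycleOf_left]
  have h2 := fun k l => D.wMatrix_apply_eq (w ∘ e) k l
  simp only [Function.comp_apply] at h2
  simp only [weightedForm_cycleOf_right, ← h2, Matrix.mul_apply, Matrix.transpose_apply,
    Matrix.map_apply]
  push_cast
  simp only [Finset.sum_mul, Finset.mul_sum]
  rw [Finset.sum_comm]
  refine Finset.sum_congr rfl fun k _ => Finset.sum_congr rfl fun l _ => ?_
  simp only [P]
  ring

lemma seifertRank_eq (h : IsRelabelling D E e φ) : E.seifertRank = D.seifertRank := by
  have h1 := Module.finrank_eq_card_basis h.basis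
  have h2 := Module.finrank_eq_card_basis D.seifertBasis
  rw [h1, Fintype.card_fin, Fintype.card_fin] at h2
  exact h2

lemma sigIdx_twist_eq (h : IsRelabelling D E e φ) (hD : D.Planar) (w : Fin E.n → ℝ) (θ : ℝ) :
    sigIdx (twist θ (E.wMatrix w)) = sigIdx (twist θ (D.wMatrix (w ∘ e))) ∧
    ((twist θ (E.wMatrix w)).det ≠ 0 ↔ (twist θ (D.wMatrix (w ∘ e))).det ≠ 0) := by
  obtain ⟨Q, hPQ, hQP⟩ := h.exists_matrix_inverse
  let g := Int.castRingHom ℂ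
  have e1 : ∀ {m k : ℕ} (A : Matrix (Fin m) (Fin k) ℤ),
      ((A.map (Int.cast : ℤ → ℝ)).map Complex.ofReal)ᵀ = (A.map g)ᵀ := fun A => by
    ext
    simp [g]
  have h1 : (h.matrix.map g)ᵀ * (Q.map g)ᵀ = 1 := by
    rw [← Matrix.transpose_mul, ← Matrix.map_mul, hQP]
    simp
  have h2 : (Q.map g)ᵀ * (h.matrix.map g)ᵀ = 1 := by
    rw [← Matrix.transpose_mul, ← Matrix.map_mul, hPQ]
    simp
  have hpos : posIdx (twist θ (E.wMatrix w)) = posIdx (twist θ (D.wMatrix (w ∘ e))) := by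
    rw [h.wMatrix_eq hD, twist_congr, e1]
    exact posIdx_congr _ _ _ h2 h1
  have hneg : posIdx (-twist θ (E.wMatrix w)) = posIdx (-twist θ (D.wMatrix (w ∘ e))) := by
    rw [h.wMatrix_eq hD, twist_congr, e1, ← Matrix.neg_mul, ← Matrix.mul_neg]
    exact posIdx_congr _ _ _ h2 h1
  refine ⟨by rw [sigIdx, sigIdx, hpos, hneg], ?_⟩
  rw [det_ne_zero_iff_posIdx (twist_isHermitian _ _),
    det_ne_zero_iff_posIdx (twist_isHermitian _ _), hpos, hneg, h.seifertRank_eq]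

end IsRelabelling

/-! ## Crossing changes -/

variable (D) (c₀ : Fin D.n)

lemma flip_of_ne {x : Fin D.n} (hx : x ≠ c₀) (b : Bool) : D.flip c₀ (x, b) = (x, b) :=
  Equiv.swap_apply_of_ne_of_ne (by simp [hx]) (by simp [hx])

lemma flip_self (b : Bool) : D.flip c₀ (c₀, b) = (c₀, !b) := by
  cases b <;> simp [flip]

/-- The crossings after a crossing change. -/
def changeEquiv : Fin D.n ≃ Fin (D.crossingChange c₀).n := Equiv.refl _

/-- The edges after a crossing change. -/
def changeFlip : D.Passage ≃ (D.crossingChange c₀).Passage := D.flip c₀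

lemma sign_changeEquiv (x : Fin D.n) : (D.crossingChange c₀).sign (D.changeEquiv c₀ x) =
    Function.update D.sign c₀ (-D.sign c₀) x := rfl

lemma sign_changeEquiv_self :
    (D.crossingChange c₀).sign (D.changeEquiv c₀ c₀) = -D.sign c₀ := by
  rw [sign_changeEquiv, Function.update_self]

lemma sign_changeEquiv_of_ne {x : Fin D.n} (hx : x ≠ c₀) :
    (D.crossingChange c₀).sign (D.changeEquiv c₀ x) = D.sign x := by
  rw [sign_changeEquiv, Function.update_of_ne hx]

lemma changeFlip_of_ne {x : Fin D.n} (hx : x ≠ c₀) (b : Bool) :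
    D.changeFlip c₀ (x, b) = (D.changeEquiv c₀ x, b) := D.flip_of_ne c₀ hx b

lemma changeFlip_self (b : Bool) : D.changeFlip c₀ (c₀, b) = (D.changeEquiv c₀ c₀, !b) :=
  D.flip_self c₀ b

lemma next_changeFlip (p : D.Passage) :
    (D.crossingChange c₀).next (D.changeFlip c₀ p) = D.changeFlip c₀ (D.next p) := by
  change (D.flip c₀ * D.next * (D.flip c₀)⁻¹) (D.flip c₀ p) = D.flip c₀ (D.next p)
  simp

/-- At the changed crossing the over- and under-passage and the sign are exchanged together, so the
left and right edges stay in place. Only the weight at the crossing changes. -/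
lemma crossingChange_isRelabelling :
    IsRelabelling D (D.crossingChange c₀) (D.changeEquiv c₀) (D.changeFlip c₀) := by
  have hl : ∀ x, (D.crossingChange c₀).leftOut (D.changeEquiv c₀ x) =
      D.changeFlip c₀ (D.leftOut x) := fun x => by
    unfold leftOut
    by_cases hx : x = c₀
    · subst hx
      rw [sign_changeEquiv_self]
      rcases Int.units_eq_one_or (D.sign x) with h | h <;> rw [h]
      · rw [if_neg (by decide), if_pos rfl, changeFlip_self, Bool.not_false]
      · rw [if_pos (by decide), if_neg (by decide), changeFlip_self, Bool.not_true]
    · rw [sign_changeEquiv_of_ne _ _ hx]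
      split_ifs <;> rw [changeFlip_of_ne _ _ hx]
  have hr : ∀ x, (D.crossingChange c₀).rightOut (D.changeEquiv c₀ x) =
      D.changeFlip c₀ (D.rightOut x) := fun x => by
    unfold rightOut
    by_cases hx : x = c₀
    · subst hx
      rw [sign_changeEquiv_self]
      rcases Int.units_eq_one_or (D.sign x) with h | h <;> rw [h]
      · rw [if_neg (by decide), if_pos rfl, changeFlip_self, Bool.not_true]
      · rw [if_pos (by decide), if_neg (by decide), changeFlip_self, Bool.not_false]
    · rw [sign_changeEquiv_of_ne _ _ hx]
      split_ifs <;> rw [changeFlip_of_ne _ _ hx]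
  refine ⟨fun x => ?_, hl, fun x => ?_, hr⟩
  · apply (D.crossingChange c₀).next.injective
    rw [next_leftIn, next_changeFlip, next_leftIn, hr]
  · apply (D.crossingChange c₀).next.injective
    rw [next_rightIn, next_changeFlip, next_rightIn, hl]

lemma crossingChange_baseWeight :
    (D.crossingChange c₀).baseWeight ∘ D.changeEquiv c₀ = D.toggleWeight c₀ := by
  ext x
  rw [Function.comp_apply]
  by_cases hx : x = c₀
  · subst hx
    rw [toggleWeight_self]
    unfold baseWeight
    rw [sign_changeEquiv_self]
    rcases Int.units_eq_one_or (D.sign x) with h | h <;>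
      simp [h, show (-1 : ℤˣ) ≠ 1 by decide]
  · rw [toggleWeight_of_ne hx]
    unfold baseWeight
    rw [sign_changeEquiv_of_ne _ _ hx]

/-- The form after a crossing change. -/
lemma sigIdx_twist_crossingChange (hD : D.Planar) (θ : ℝ) :
    sigIdx (twist θ ((D.crossingChange c₀).wMatrix (D.crossingChange c₀).baseWeight)) =
      sigIdx (twist θ (D.wMatrix (D.toggleWeight c₀))) ∧
    ((twist θ ((D.crossingChange c₀).wMatrix (D.crossingChange c₀).baseWeight)).det ≠ 0 ↔
      (twist θ (D.wMatrix (D.toggleWeight c₀))).det ≠ 0) := by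
  have := (D.crossingChange_isRelabelling c₀).sigIdx_twist_eq hD
    (D.crossingChange c₀).baseWeight θ
  rwa [crossingChange_baseWeight] at this

end GaussCode

/-! ## The Alexander polynomial on the unit circle -/

namespace GaussCode

/-- The Hermitian form of a diagram. -/
def form (D : GaussCode) (θ : ℝ) : Matrix (Fin D.seifertRank) (Fin D.seifertRank) ℂ :=
  twist θ (D.wMatrix D.baseWeight)

lemma form_isHermitian (D : GaussCode) (θ : ℝ) : (D.form θ).IsHermitian := twist_isHermitian _ _

lemma form_eq_smul (D : GaussCode) (θ : ℝ) :
    D.form θ = (-Complex.I * Complex.exp (-(Complex.I * (θ / 2)))) •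
      (Complex.exp (Complex.I * θ) • D.seifertMatrix.map (Int.cast : ℤ → ℂ) -
        (D.seifertMatrix.map (Int.cast : ℤ → ℂ))ᵀ) := by
  have : cplx (D.wMatrix D.baseWeight) = D.seifertMatrix.map (Int.cast : ℤ → ℂ) := by
    rw [wMatrix_baseWeight]
    ext i j
    simp [cplx]
  rw [form, twist_eq_smul, this]

/-- With `t = e^{iθ}` one has `1 - t = 2 sin(θ/2) · (-i e^{iθ/2})`, and the other coefficient is its
conjugate. -/
lemma tristramMatrix_exp (D : GaussCode) (θ : ℝ) :
    tristramMatrix D.seifertMatrix (Circle.exp θ) =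
      ((2 * Real.sin (θ / 2) : ℝ) : ℂ) • D.form θ := by
  have h1 : ((2 * Real.sin (θ / 2) : ℝ) : ℂ) =
      Complex.I * (Complex.exp (-(Complex.I * (θ / 2))) - Complex.exp (Complex.I * (θ / 2))) := by
    push_cast
    rw [Complex.sin]
    rw [show -(↑θ / 2) * Complex.I = -(Complex.I * (↑θ / 2)) by ring,
      show (↑θ / 2) * Complex.I = Complex.I * (↑θ / 2) by ring]
    ring
  have h2 : Complex.exp (Complex.I * θ) = Complex.exp (Complex.I * (θ / 2)) ^ 2 := by
    rw [← Complex.exp_nat_mul]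
    congr 1
    push_cast
    ring
  have h3 : ((Circle.exp θ : Circle) : ℂ) = Complex.exp (Complex.I * (θ / 2)) ^ 2 := by
    rw [Circle.coe_exp, ← h2, mul_comm]
  have h4 : star ((Circle.exp θ : Circle) : ℂ) = Complex.exp (-(Complex.I * (θ / 2))) ^ 2 := by
    rw [Complex.star_def, ← Circle.coe_inv_eq_conj, ← Circle.exp_neg, Circle.coe_exp,
      ← Complex.exp_nat_mul]
    congr 1
    push_cast
    ring
  have h5 : Complex.exp (Complex.I * (θ / 2)) * Complex.exp (-(Complex.I * (θ / 2))) = 1 := by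
    rw [← Complex.exp_add, add_neg_cancel, Complex.exp_zero]
  rw [form_eq_smul, h1, h2, tristramMatrix, h4, h3]
  ext i j
  simp only [Matrix.add_apply, Matrix.smul_apply, Matrix.sub_apply, Matrix.transpose_apply,
    smul_eq_mul]
  generalize (D.seifertMatrix.map (Int.cast : ℤ → ℂ)) i j = x
  generalize (D.seifertMatrix.map (Int.cast : ℤ → ℂ)) j i = y
  generalize Complex.exp (Complex.I * (θ / 2)) = a at *
  generalize Complex.exp (-(Complex.I * (θ / 2))) = b at *
  linear_combination ((b ^ 2 - a * b) * (a ^ 2 * x - y)) * Complex.I_sq -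
    ((1 + a * b - a ^ 2) * x + y) * h5

end GaussCode

lemma KnotDiagram.det_form_zero_ne_zero (D : KnotDiagram) : (D.form 0).det ≠ 0 :=
  GaussCode.det_twist_zero_ne_zero D.planar _

lemma KnotDiagram.even_seifertRank (D : KnotDiagram) : Even D.seifertRank :=
  even_of_det_twist_zero_ne_zero D.det_form_zero_ne_zero

namespace Knot

variable (K : Knot)

lemma aeval_alexanderPolynomial (t : ℂ) : Polynomial.aeval t K.alexanderPolynomial =
    (t • K.seifertMatrix.map (Int.cast : ℤ → ℂ) -
      (K.seifertMatrix.map (Int.cast : ℤ → ℂ))ᵀ).det := by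
  rw [alexanderPolynomial, AlgHom.map_det]
  congr 1
  ext i j
  simp

/-- The scalar `-i e^{-iθ/2}` is raised to the size `2g`, which gives `(-1)^g e^{-igθ}`, the
symmetrizing factor up to a sign. -/
lemma det_form_eq (θ : ℝ) : (K.diagram.form θ).det =
    (-1) ^ (K.diagram.seifertRank / 2) * K.alexander (Circle.exp θ) := by
  obtain ⟨g, hg⟩ := K.diagram.even_seifertRank
  have hg2 : K.diagram.seifertRank / 2 = g := by omega
  have h3 : ((Circle.exp θ : Circle) : ℂ) = Complex.exp (Complex.I * θ) := by
    rw [Circle.coe_exp, mul_comm]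
  rw [alexander, aeval_alexanderPolynomial, GaussCode.form_eq_smul, Matrix.det_smul,
    Fintype.card_fin, hg2, h3, ← mul_assoc]
  congr 1
  rw [hg, ← two_mul, pow_mul, mul_pow, neg_sq, Complex.I_sq, mul_pow]
  congr 1
  rw [← pow_mul, ← Complex.exp_nat_mul, zpow_neg, zpow_natCast, ← Complex.exp_nat_mul,
    ← Complex.exp_neg]
  congr 1
  push_cast
  ring

lemma alexander_eq (θ : ℝ) : K.alexander (Circle.exp θ) =
    (-1) ^ (K.diagram.seifertRank / 2) * (K.diagram.form θ).det := by
  rw [det_form_eq, ← mul_assoc, ← mul_pow]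
  simp

lemma alexanderAngle_eq (θ : ℝ) : K.alexanderAngle θ =
    (-1) ^ (K.diagram.seifertRank / 2) * (K.diagram.form θ).det.re := by
  rw [alexanderAngle, alexander_eq, det_im_eq_zero (K.diagram.form_isHermitian θ),
    Complex.ofReal_re]
  have : ((-1 : ℂ) ^ (K.diagram.seifertRank / 2)) * ((K.diagram.form θ).det.re : ℂ) =
    (((-1) ^ (K.diagram.seifertRank / 2) * (K.diagram.form θ).det.re : ℝ) : ℂ) := by push_cast; rfl
  rw [this, Complex.ofReal_re]

/-- The symmetrized Alexander polynomial is real on the unit circle. -/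
lemma ofReal_alexanderAngle (θ : ℝ) : (K.alexanderAngle θ : ℂ) = K.alexander (Circle.exp θ) := by
  rw [alexanderAngle_eq, alexander_eq, det_im_eq_zero (K.diagram.form_isHermitian θ)]
  push_cast
  rfl

lemma alexanderAngle_ne_zero_iff (θ : ℝ) :
    K.alexanderAngle θ ≠ 0 ↔ (K.diagram.form θ).det ≠ 0 := by
  rw [← Complex.ofReal_ne_zero, ofReal_alexanderAngle, alexander_eq]
  simp

lemma alexanderAngle_ne_zero_iff' (θ : ℝ) :
    K.alexanderAngle θ ≠ 0 ↔ K.alexander (Circle.exp θ) ≠ 0 := by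
  rw [← Complex.ofReal_ne_zero, ofReal_alexanderAngle]

lemma one_notMem_div : (1 : Circle) ∉ K.div := by
  have := K.diagram.det_form_zero_ne_zero
  rw [← alexanderAngle_ne_zero_iff, alexanderAngle_ne_zero_iff', Circle.exp_zero] at this
  exact this

lemma signature_eq_sigIdx (ρ : Circle) :
    K.signature ρ = sigIdx (tristramMatrix K.diagram.seifertMatrix ρ) :=
  hermitianSignature_eq _

lemma sigIdx_smul_of_pos {m : ℕ} {r : ℝ} (hr : 0 < r) (A : Matrix (Fin m) (Fin m) ℂ) :
    sigIdx ((r : ℂ) • A) = sigIdx A := by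
  rw [sigIdx, sigIdx, posIdx_smul hr, ← smul_neg, posIdx_smul hr]

lemma signature_exp {θ : ℝ} (hθ : θ ∈ Set.Ioo 0 (2 * Real.pi)) :
    K.signature (Circle.exp θ) = sigIdx (K.diagram.form θ) := by
  rw [signature_eq_sigIdx, GaussCode.tristramMatrix_exp, sigIdx_smul_of_pos (sin_half_pos hθ)]

end Knot

/-- The sign of the determinant, normalized by the size of the matrix, is determined by the
signature. -/
lemma normalized_sign_det_eq {m k : ℕ} (hm : Even m) (hk : Even k) {A : Matrix (Fin m) (Fin m) ℂ}
    {B : Matrix (Fin k) (Fin k) ℂ} (hA : A.IsHermitian) (hB : B.IsHermitian) (hA0 : A.det ≠ 0)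
    (hB0 : B.det ≠ 0) (h : sigIdx A = sigIdx B) :
    (-1 : ℤ) ^ (m / 2) * SignType.sign A.det.re = (-1) ^ (k / 2) * SignType.sign B.det.re := by
  rw [sign_det hA hA0, sign_det hB hB0, ← pow_add, ← pow_add]
  have h1 := (det_ne_zero_iff_posIdx hA).1 hA0
  have h2 := (det_ne_zero_iff_posIdx hB).1 hB0
  rw [sigIdx, sigIdx] at h
  obtain ⟨a, rfl⟩ := hm
  obtain ⟨b, rfl⟩ := hk
  have e1 : (a + a) / 2 = a := by omega
  have e2 : (b + b) / 2 = b := by omega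
  rw [e1, e2]
  -- Half the size minus the negative index is half the signature, so both normalized signs have
  -- exponents of the same parity.
  have e3 : a + posIdx (-A) + 2 * posIdx (-B) = b + posIdx (-B) + 2 * posIdx (-A) := by omega
  have e4 : ∀ x y : ℕ, (-1 : ℤ) ^ (x + 2 * y) = (-1) ^ x := fun x y => by
    rw [pow_add, pow_mul]
    simp
  rw [← e4 _ (posIdx (-B)), e3, e4]

lemma Knot.sign_alexanderAngle (K : Knot) (θ : ℝ) : (SignType.sign (K.alexanderAngle θ) : ℤ) =
    (-1) ^ (K.diagram.seifertRank / 2) * SignType.sign (K.diagram.form θ).det.re := by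
  rw [K.alexanderAngle_eq, sign_mul]
  rcases neg_one_pow_eq_or ℝ (K.diagram.seifertRank / 2) with h | h <;>
    rcases neg_one_pow_eq_or ℤ (K.diagram.seifertRank / 2) with h' | h'
  · simp [h, h']
  · rcases Nat.even_or_odd (K.diagram.seifertRank / 2) with e | e
    · rw [e.neg_one_pow] at h'; omega
    · rw [e.neg_one_pow] at h; norm_num at h
  · rcases Nat.even_or_odd (K.diagram.seifertRank / 2) with e | e
    · rw [e.neg_one_pow] at h; norm_num at h
    · rw [e.neg_one_pow] at h'; omega
  · simp [h, h']

/-! ## The signature function under a crossing change -/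

lemma Circle.exists_exp_eq_of_ne_one {ρ : Circle} (h : ρ ≠ 1) :
    ∃ θ ∈ Set.Ioo 0 (2 * Real.pi), Circle.exp θ = ρ := by
  have h1 := Circle.exp_arg ρ
  have h2 := Complex.neg_pi_lt_arg (ρ : ℂ)
  have h3 := Complex.arg_le_pi (ρ : ℂ)
  have hpi := Real.pi_pos
  rcases lt_trichotomy (Complex.arg (ρ : ℂ)) 0 with h4 | h4 | h4
  · refine ⟨Complex.arg ρ + 2 * Real.pi, ⟨by linarith, by linarith⟩, ?_⟩
    rw [Circle.exp_add, h1, Circle.exp_two_pi, mul_one]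
  · rw [h4, Circle.exp_zero] at h1
    exact absurd h1.symm h
  · exact ⟨Complex.arg ρ, ⟨h4, by linarith⟩, h1⟩

lemma Knot.diagram_knot (K : Knot) : K.diagram.knot = K := Quot.out_eq K

/-- This allows the arbitrary representative `K.diagram` to be replaced by any matrix with the same
signature, even of another size. -/
lemma Knot.sign_alexanderAngle_eq (K : Knot) {k : ℕ} (hk : Even k) {B : Matrix (Fin k) (Fin k) ℂ}
    (hB : B.IsHermitian) (hB0 : B.det ≠ 0) {θ : ℝ} (h0 : K.alexanderAngle θ ≠ 0)
    (h : sigIdx (K.diagram.form θ) = sigIdx B) :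
    (SignType.sign (K.alexanderAngle θ) : ℤ) = (-1) ^ (k / 2) * SignType.sign B.det.re := by
  rw [K.sign_alexanderAngle]
  exact normalized_sign_det_eq K.diagram.even_seifertRank hk (K.diagram.form_isHermitian θ) hB
    ((K.alexanderAngle_ne_zero_iff θ).1 h0) hB0 h

namespace KnotDiagram

variable (D : KnotDiagram)

lemma sameSignature_diagram : GaussCode.SameSignature D.knot.diagram.toGaussCode D.toGaussCode :=
  KnotDiagram.sameSignature D.knot.diagram_knot

variable {θ : ℝ}

lemma alexanderAngle_ne_zero_iff (hθ : θ ∈ Set.Ioo 0 (2 * Real.pi)) :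
    D.knot.alexanderAngle θ ≠ 0 ↔ (D.form θ).det ≠ 0 :=
  (D.knot.alexanderAngle_ne_zero_iff θ).trans (D.sameSignature_diagram θ hθ).1.not

lemma sigIdx_form_diagram (hθ : θ ∈ Set.Ioo 0 (2 * Real.pi)) (h : D.knot.alexanderAngle θ ≠ 0) :
    sigIdx (D.knot.diagram.form θ) = sigIdx (D.form θ) :=
  (D.sameSignature_diagram θ hθ).2 ((D.knot.alexanderAngle_ne_zero_iff θ).1 h)

/-- The Hermitian form of a diagram after the crossing change at `c`, up to congruence. -/
def toggledForm (c : Fin D.n) (θ : ℝ) : Matrix (Fin D.seifertRank) (Fin D.seifertRank) ℂ :=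
  D.form θ + ((2 * Real.sin (θ / 2) * (1 - 2 * D.baseWeight c) : ℝ) : ℂ) • rankOne (D.flowVec c)

lemma toggledForm_eq (c : Fin D.n) (θ : ℝ) :
    D.toggledForm c θ = twist θ (D.wMatrix (D.toggleWeight c)) :=
  (D.twist_toggleWeight θ c).symm

lemma toggledForm_isHermitian (c : Fin D.n) (θ : ℝ) : (D.toggledForm c θ).IsHermitian := by
  rw [toggledForm_eq]
  exact twist_isHermitian _ _

lemma sigIdx_form_crossingChange (c : Fin D.n) (θ : ℝ) :
    sigIdx ((D.crossingChange c).form θ) = sigIdx (D.toggledForm c θ) := by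
  rw [toggledForm_eq]
  exact (D.toGaussCode.sigIdx_twist_crossingChange c D.planar θ).1

lemma det_form_crossingChange_ne_zero_iff (c : Fin D.n) (θ : ℝ) :
    ((D.crossingChange c).form θ).det ≠ 0 ↔ (D.toggledForm c θ).det ≠ 0 := by
  rw [toggledForm_eq]
  exact (D.toGaussCode.sigIdx_twist_crossingChange c D.planar θ).2

/-- The coefficient `2 sin(θ/2) (1 - 2 w)` of the rank one change has the sign of the crossing, as
the weight `w` is `0` or `1`. Both forms live on the homology of `D`, so the normalizing signs of
the two determinants cancel. -/
lemma signature_crossingChange (c : Fin D.n) (hθ : θ ∈ Set.Ioo 0 (2 * Real.pi))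
    (h0 : D.knot.alexanderAngle θ ≠ 0) (h1 : (D.crossingChange c).knot.alexanderAngle θ ≠ 0) :
    (D.crossingChange c).knot.signature (Circle.exp θ) - D.knot.signature (Circle.exp θ) =
      ((D.sign c : ℤˣ) : ℤ) * (1 - (SignType.sign (D.knot.alexanderAngle θ) : ℤ) *
        SignType.sign ((D.crossingChange c).knot.alexanderAngle θ)) := by
  have e0 := D.sigIdx_form_diagram hθ h0
  have e1 := ((D.crossingChange c).sigIdx_form_diagram hθ h1).trans
    (D.sigIdx_form_crossingChange c θ)
  have d0 := (D.alexanderAngle_ne_zero_iff hθ).1 h0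
  have d1 := (D.det_form_crossingChange_ne_zero_iff c θ).1
    (((D.crossingChange c).alexanderAngle_ne_zero_iff hθ).1 h1)
  rw [Knot.signature_exp _ hθ, Knot.signature_exp _ hθ, e0, e1,
    Knot.sign_alexanderAngle_eq _ D.even_seifertRank (D.form_isHermitian θ) d0 h0 e0,
    Knot.sign_alexanderAngle_eq _ D.even_seifertRank (D.toggledForm_isHermitian c θ) d1 h1 e1,
    mul_mul_mul_comm, ← pow_add, ← two_mul, pow_mul, neg_one_sq, one_pow, one_mul]
  have key := sigIdx_add_rankOne (D.form_isHermitian θ) (D.flowVec c) d0 d1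
  rw [toggledForm, key]
  congr 1
  have hs := sin_half_pos hθ
  unfold GaussCode.baseWeight
  rcases Int.units_eq_one_or (D.sign c) with h | h
  · rw [h, if_pos rfl, if_pos (by linarith)]
    rfl
  · have h' : ¬(-1 : ℤˣ) = 1 := by decide
    rw [h, if_neg h', if_neg (by linarith)]
    rfl

/-- The change of the signature function under a crossing change. -/
lemma signature_crossingChange' (c : Fin D.n) {θ : ℝ} (hθ : Circle.exp θ ≠ 1)
    (h0 : D.knot.alexanderAngle θ ≠ 0) (h1 : (D.crossingChange c).knot.alexanderAngle θ ≠ 0) :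
    (D.crossingChange c).knot.signature (Circle.exp θ) - D.knot.signature (Circle.exp θ) =
      ((D.sign c : ℤˣ) : ℤ) * (1 - (SignType.sign (D.knot.alexanderAngle θ) : ℤ) *
        SignType.sign ((D.crossingChange c).knot.alexanderAngle θ)) := by
  obtain ⟨θ', hθ', h⟩ := Circle.exists_exp_eq_of_ne_one hθ
  unfold Knot.alexanderAngle at *
  rw [← h] at h0 h1 ⊢
  exact D.signature_crossingChange c hθ' h0 h1

end KnotDiagram

/-! ## The jump of the signature function -/

namespace Knot

variable (K : Knot)

lemma eventually_signature_eq {θ : ℝ} (hθ : Circle.exp θ ≠ 1) (h : K.alexanderAngle θ ≠ 0) :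
    ∀ᶠ x in 𝓝 θ, K.signature (Circle.exp x) = K.signature (Circle.exp θ) := by
  have hc : Continuous fun x : ℝ => tristramMatrix K.diagram.seifertMatrix (Circle.exp x) := by
    unfold tristramMatrix
    fun_prop
  have hdet : (tristramMatrix K.diagram.seifertMatrix (Circle.exp θ)).det ≠ 0 := by
    obtain ⟨θ', hθ', h'⟩ := Circle.exists_exp_eq_of_ne_one hθ
    rw [alexanderAngle_ne_zero_iff', ← h', ← alexanderAngle_ne_zero_iff',
      alexanderAngle_ne_zero_iff] at h
    rw [← h', GaussCode.tristramMatrix_exp, Matrix.det_smul]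
    exact mul_ne_zero (pow_ne_zero _ (Complex.ofReal_ne_zero.2 (sin_half_pos hθ').ne')) h
  filter_upwards [eventually_sigIdx_eq hc.continuousAt
    (fun x => tristramMatrix_isHermitian _ _) hdet] with x hx
  rw [signature_eq_sigIdx, signature_eq_sigIdx, hx.2]

/-- The derivative of the Alexander polynomial along the unit circle. -/
lemma hasDerivAt_alexanderAngle (θ : ℝ) : ∃ e : ℂ, HasDerivAt K.alexanderAngle e.re θ ∧
    e = e.re ∧ (K.alexanderAngle θ = 0 →
      (K.alexanderPolynomial.map (Int.castRingHom ℂ)).derivative.eval ((Circle.exp θ : Circle) : ℂ)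
        ≠ 0 → e ≠ 0) := by
  set p := K.alexanderPolynomial.map (Int.castRingHom ℂ)
  set g := -((K.diagram.seifertRank / 2 : ℕ) : ℤ)
  have hp : ∀ t : ℂ, K.alexander t = t ^ g * p.eval t := fun t => by
    rw [alexander, Polynomial.aeval_def, ← Polynomial.eval_map]
    rfl
  have h1 : HasDerivAt (fun z : ℂ => Complex.exp (z * Complex.I))
      (Complex.exp (θ * Complex.I) * Complex.I) (θ : ℂ) := by
    simpa using ((hasDerivAt_id (θ : ℂ)).mul_const Complex.I).cexp
  have hne : Complex.exp (θ * Complex.I) ≠ 0 := Complex.exp_ne_zero _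
  have h2 := ((hasDerivAt_zpow g (Complex.exp (θ * Complex.I)) (Or.inl hne)).comp (θ : ℂ) h1).mul
    ((p.hasDerivAt (Complex.exp (θ * Complex.I))).comp (θ : ℂ) h1)
  have h3 : ∀ x : ℝ, (K.alexanderAngle x : ℂ) =
      ((fun t : ℂ => t ^ g) ∘ (fun z : ℂ => Complex.exp (z * Complex.I)) *
        (fun t => p.eval t) ∘ fun z : ℂ => Complex.exp (z * Complex.I)) (x : ℂ) := fun x => by
    rw [ofReal_alexanderAngle, hp, Circle.coe_exp]
    rfl
  have h4 := h2.comp_ofReal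
  simp only [← h3] at h4
  have h5 := h2.real_of_complex
  simp only [← h3, Complex.ofReal_re] at h5
  refine ⟨_, h5, h4.unique h5.ofReal_comp, fun h0 hd => ?_⟩
  rw [Circle.coe_exp] at hd
  have h6 : K.alexander (Circle.exp θ) = 0 := by rw [← ofReal_alexanderAngle, h0]; rfl
  rw [hp, Circle.coe_exp, mul_eq_zero] at h6
  have h7 := h6.resolve_left (zpow_ne_zero _ hne)
  simp only [Function.comp_apply, h7, mul_zero, zero_add]
  exact mul_ne_zero (zpow_ne_zero _ hne) (mul_ne_zero hd (mul_ne_zero hne Complex.I_ne_zero))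

lemma continuous_alexanderAngle : Continuous K.alexanderAngle :=
  continuous_iff_continuousAt.2 fun θ =>
    let ⟨_, h, _⟩ := K.hasDerivAt_alexanderAngle θ
    h.continuousAt

variable {K}

lemma isRoot_of_mem_div {ρ : Circle} (h : ρ ∈ K.div) :
    (K.alexanderPolynomial.map (Int.castRingHom ℂ)).IsRoot (ρ : ℂ) := by
  have h1 : K.alexander ρ = 0 := h
  rw [alexander, mul_eq_zero, Polynomial.aeval_def, ← Polynomial.eval_map] at h1
  exact h1.resolve_left (zpow_ne_zero _ ρ.coe_ne_zero)

lemma alexanderPolynomial_map_ne_zero : K.alexanderPolynomial.map (Int.castRingHom ℂ) ≠ 0 := by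
  intro h
  refine K.one_notMem_div ?_
  change _ * _ = (0 : ℂ)
  rw [Polynomial.aeval_def, ← Polynomial.eval_map]
  erw [h]
  simp

/-- The power of `t` and the parametrization of the circle contribute nonzero factors at a root, so
multiplicity one of the polynomial root gives a nonzero derivative in the angle. -/
lemma IsSimple.exists_hasDerivAt (hK : K.IsSimple) {θ : ℝ} (hθ : Circle.exp θ ∈ K.div) :
    ∃ e : ℝ, e ≠ 0 ∧ HasDerivAt K.alexanderAngle e θ := by
  obtain ⟨e, h1, h2, h3⟩ := K.hasDerivAt_alexanderAngle θ
  refine ⟨e.re, fun h => h3 ?_ ?_ (by rw [h2, h]; rfl), h1⟩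
  · by_contra h0
    exact (K.alexanderAngle_ne_zero_iff' θ).1 h0 hθ
  · intro h0
    have := (Polynomial.one_lt_rootMultiplicity_iff_isRoot alexanderPolynomial_map_ne_zero).2
      ⟨isRoot_of_mem_div hθ, h0⟩
    rw [hK _ hθ] at this
    exact lt_irrefl _ this

end Knot

/-! ### Signs on the two sides of a simple zero -/

lemma signAt_of_ne_zero {f : ℝ → ℝ} {a : ℝ} (h : f a ≠ 0) : signAt f a = SignType.sign (f a) := by
  classical
  have h0 : ∃ k, iteratedDeriv k f a ≠ 0 := ⟨0, by simpa using h⟩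
  have h1 : Nat.find h0 = 0 := (Nat.find_eq_zero h0).2 (by simpa using h)
  rw [signAt, dif_pos h0]
  have : iteratedDeriv (Nat.find h0) f a = f a := by rw [h1, iteratedDeriv_zero]
  convert congrArg (fun x => ((SignType.sign x : SignType) : ℤ)) this

lemma signAt_of_simple_zero {f : ℝ → ℝ} {a e : ℝ} (h : f a = 0) (he : e ≠ 0)
    (hf : HasDerivAt f e a) : signAt f a = SignType.sign e := by
  classical
  have h1 : iteratedDeriv 1 f a = e := by rw [iteratedDeriv_one, hf.deriv]
  have h0 : ∃ k, iteratedDeriv k f a ≠ 0 := ⟨1, by rwa [h1]⟩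
  have h2 : Nat.find h0 = 1 := by
    rw [Nat.find_eq_iff]
    refine ⟨by rwa [h1], fun k hk => ?_⟩
    obtain rfl : k = 0 := by omega
    simpa using h
  rw [signAt, dif_pos h0]
  have : iteratedDeriv (Nat.find h0) f a = e := by rw [h2, h1]
  convert congrArg (fun x => ((SignType.sign x : SignType) : ℤ)) this

lemma HasDerivAt.eventually_sign_eq {f : ℝ → ℝ} {a e : ℝ} (h : f a = 0) (he : e ≠ 0)
    (hf : HasDerivAt f e a) :
    (∀ᶠ x in 𝓝[>] a, SignType.sign (f x) = SignType.sign e) ∧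
      ∀ᶠ x in 𝓝[<] a, SignType.sign (f x) = -SignType.sign e := by
  have h1 := hasDerivAt_iff_tendsto_slope.1 hf
  have h2 : ∀ᶠ x in 𝓝[≠] a, SignType.sign (slope f a x) = SignType.sign e := by
    rcases he.lt_or_gt with h3 | h3
    · filter_upwards [h1.eventually_lt_const h3] with x hx
      rw [sign_neg hx, sign_neg h3]
    · filter_upwards [h1.eventually_const_lt h3] with x hx
      rw [sign_pos hx, sign_pos h3]
  have h4 : ∀ x, f x = (x - a) * slope f a x := fun x => by
    have := sub_smul_slope f a x
    simp only [smul_eq_mul, vsub_eq_sub, h, sub_zero] at this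
    exact this.symm
  constructor
  · filter_upwards [h2.filter_mono (nhdsWithin_mono a fun x hx => ne_of_gt hx),
      self_mem_nhdsWithin] with x hx hx'
    rw [h4, sign_mul, hx, sign_pos (sub_pos.2 hx'), one_mul]
  · filter_upwards [h2.filter_mono (nhdsWithin_mono a fun x hx => ne_of_lt hx),
      self_mem_nhdsWithin] with x hx hx'
    rw [h4, sign_mul, hx, sign_neg (sub_neg.2 hx'), neg_one_mul]

lemma eventually_ne_zero_of_sign {l : Filter ℝ} {f : ℝ → ℝ} {s : SignType} (hs : s ≠ 0)
    (h : ∀ᶠ x in l, SignType.sign (f x) = s) : ∀ᶠ x in l, f x ≠ 0 :=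
  h.mono fun x hx h0 => hs (by rw [← hx, h0, sign_zero])

namespace KnotDiagram

variable (D : KnotDiagram) (c : Fin D.n)

lemma withSign_sign : D.withSign c (D.sign c) = D := if_pos rfl

lemma withSign_neg_sign : D.withSign c (-D.sign c) = D.crossingChange c :=
  if_neg fun h => by
    rcases Int.units_eq_one_or (D.sign c) with h' | h' <;> rw [h'] at h <;>
      exact absurd h (by decide)

lemma signAt_withSign_mul (θ : ℝ) : signAt (D.withSign c 1).knot.alexanderAngle θ *
    signAt (D.withSign c (-1)).knot.alexanderAngle θ = signAt D.knot.alexanderAngle θ *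
      signAt (D.crossingChange c).knot.alexanderAngle θ := by
  have h1 := D.withSign_sign c
  have h2 := D.withSign_neg_sign c
  rcases Int.units_eq_one_or (D.sign c) with h | h <;> rw [h] at h1 h2
  · rw [h1, h2]
  · rw [neg_neg] at h2
    rw [h1, h2, mul_comm]

/-- The skein formula for the jump of the signature function. -/
lemma hasSignatureJump (hK : D.knot.IsSimple) {ρ : Circle} (hρ : ρ ∈ D.knot.div)
    (hgood : (D.crossingChange c).knot.alexander ρ ≠ 0) {θ : ℝ} (hθ : Circle.exp θ = ρ) :
    D.knot.HasSignatureJump ρ (2 * ((D.sign c : ℤˣ) : ℤ) *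
      signAt (D.withSign c 1).knot.alexanderAngle θ *
      signAt (D.withSign c (-1)).knot.alexanderAngle θ) := by
  subst hθ
  rw [mul_assoc, signAt_withSign_mul]
  set K := D.knot
  set K' := (D.crossingChange c).knot
  have hone : Circle.exp θ ≠ 1 := fun h => K.one_notMem_div (h ▸ hρ)
  have hK' : K'.alexanderAngle θ ≠ 0 := (K'.alexanderAngle_ne_zero_iff' θ).2 hgood
  obtain ⟨e, he, hder⟩ := hK.exists_hasDerivAt hρ
  have h0 : K.alexanderAngle θ = 0 := by
    by_contra h0
    exact (K.alexanderAngle_ne_zero_iff' θ).1 h0 hρ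
  rw [signAt_of_simple_zero h0 he hder, signAt_of_ne_zero hK']
  obtain ⟨hr, hl⟩ := HasDerivAt.eventually_sign_eq h0 he hder
  have hse : SignType.sign e ≠ 0 := by rwa [Ne, sign_eq_zero_iff]
  have hsign : ∀ᶠ x in 𝓝 θ,
      SignType.sign (K'.alexanderAngle x) = SignType.sign (K'.alexanderAngle θ) := by
    rcases hK'.lt_or_gt with h | h
    · filter_upwards [K'.continuous_alexanderAngle.continuousAt.eventually_lt_const h] with x hx
      rw [sign_neg hx, sign_neg h]
    · filter_upwards [K'.continuous_alexanderAngle.continuousAt.eventually_const_lt h] with x hx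
      rw [sign_pos hx, sign_pos h]
  have hexp : ∀ᶠ x in 𝓝 θ, Circle.exp x ≠ 1 :=
    (Circle.exp.continuous.continuousAt (x := θ)).eventually_ne hone
  -- Near `θ` the knot `K'` has constant signature and constant Alexander sign. The crossing change
  -- formula then gives the signature of `K` on each side from the sign `t` of its Alexander
  -- polynomial there.
  have key : ∀ (s : Set ℝ) (t : SignType), t ≠ 0 →
      (∀ᶠ x in 𝓝[s] θ, SignType.sign (K.alexanderAngle x) = t) →
      ∀ᶠ x in 𝓝[s] θ, K.signature (Circle.exp x) = K'.signature (Circle.exp θ) -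
        ((D.sign c : ℤˣ) : ℤ) * (1 - (t : ℤ) * SignType.sign (K'.alexanderAngle θ)) := by
    intro s t ht h
    filter_upwards [h, eventually_ne_zero_of_sign ht h, hsign.filter_mono nhdsWithin_le_nhds,
      hexp.filter_mono nhdsWithin_le_nhds,
      (K'.eventually_signature_eq hone hK').filter_mono nhdsWithin_le_nhds]
      with x h1 h2 h3 h4 h5
    have h6 : K'.alexanderAngle x ≠ 0 := fun h6 => by
      rw [h6, sign_zero] at h3
      exact hK' (sign_eq_zero_iff.1 h3.symm)
    have := D.signature_crossingChange' c h4 h2 h6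
    rw [h1, h3, h5] at this
    linarith
  have hshift : ∀ h : ℝ, Circle.exp θ * Circle.exp h = Circle.exp (θ + h) := fun h =>
    (Circle.exp_add θ h).symm
  have hcont : Tendsto (fun h : ℝ => θ + h) (𝓝 0) (𝓝 θ) := by
    have : Continuous fun h : ℝ => θ + h := by fun_prop
    simpa using this.tendsto 0
  have hgt : Tendsto (fun h : ℝ => θ + h) (𝓝[>] 0) (𝓝[>] θ) :=
    tendsto_nhdsWithin_iff.2 ⟨hcont.mono_left nhdsWithin_le_nhds, by
      filter_upwards [self_mem_nhdsWithin] with h hh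
      exact lt_add_of_pos_right θ hh⟩
  have hlt : Tendsto (fun h : ℝ => θ + h) (𝓝[<] 0) (𝓝[<] θ) :=
    tendsto_nhdsWithin_iff.2 ⟨hcont.mono_left nhdsWithin_le_nhds, by
      filter_upwards [self_mem_nhdsWithin] with h hh
      exact add_lt_of_neg_right θ hh⟩
  -- The two limits differ only in the sign of `Δ(K)`, which is that of the derivative `e` on the
  -- right and its opposite on the left.
  refine ⟨K'.signature (Circle.exp θ) - ((D.sign c : ℤˣ) : ℤ) * (1 -
      ((SignType.sign e : SignType) : ℤ) * SignType.sign (K'.alexanderAngle θ)),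
    K'.signature (Circle.exp θ) - ((D.sign c : ℤˣ) : ℤ) * (1 -
      ((-SignType.sign e : SignType) : ℤ) * SignType.sign (K'.alexanderAngle θ)), ?_, ?_, ?_⟩
  · simp only [hshift]
    exact tendsto_nhds_of_eventually_eq (hgt.eventually (key _ _ hse hr))
  · simp only [hshift]
    exact tendsto_nhds_of_eventually_eq (hlt.eventually (key _ _ (by simpa using hse) hl))
  · rw [SignType.coe_neg]
    ring

end KnotDiagram

lemma Knot.HasSignatureJump.unique {K : Knot} {ρ : Circle} {v w : ℤ}
    (hv : K.HasSignatureJump ρ v) (hw : K.HasSignatureJump ρ w) : v = w := by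
  obtain ⟨a, b, ha, hb, rfl⟩ := hv
  obtain ⟨a', b', ha', hb', rfl⟩ := hw
  rw [tendsto_nhds_unique ha ha', tendsto_nhds_unique hb hb']

/-! ## Existence of good projections -/

section pencil

variable {m : ℕ}

/-- A simple root of the determinant of the pencil `X V - Vᵀ` has nullity at most one. -/
lemma eq_zero_of_pencil_kernel (V : Matrix (Fin m) (Fin m) ℂ) {ρ : ℂ}
    (hρ : ((Polynomial.X : ℂ[X]) • V.map Polynomial.C -
      (V.map Polynomial.C)ᵀ).det.rootMultiplicity ρ = 1) {u w : Fin m → ℂ}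
    (hu : (ρ • V - Vᵀ) *ᵥ u = 0) (hw : (ρ • V - Vᵀ) *ᵥ w = 0)
    {i : Fin m} (hi : u i ≠ 0) (hwi : w i = 0) : w = 0 := by
  set M : Matrix (Fin m) (Fin m) ℂ[X] := (Polynomial.X : ℂ[X]) • V.map Polynomial.C -
    (V.map Polynomial.C)ᵀ
  let U : Fin m → ℂ[X] := fun j => Polynomial.C (u j)
  let Y : Fin m → ℂ[X] := fun j => Polynomial.C ((V *ᵥ u) j)
  -- Since `(ρ V - Vᵀ) u = 0`, applying the pencil to `u` leaves the multiple `X - ρ` of `V u`.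
  have h1 : M *ᵥ U = (Polynomial.X - Polynomial.C ρ) • Y := by
    funext j
    have h := congrArg Polynomial.C (congrFun hu j)
    simp only [Matrix.mulVec, dotProduct, Matrix.sub_apply, Matrix.smul_apply,
      Matrix.transpose_apply, smul_eq_mul, Pi.zero_apply, map_zero, map_sum, map_mul,
      map_sub, sub_mul, Finset.sum_sub_distrib] at h
    simp only [M, U, Y, Matrix.mulVec, dotProduct, Matrix.sub_apply, Matrix.smul_apply,
      Matrix.transpose_apply, smul_eq_mul, Matrix.map_apply, sub_mul, Finset.sum_sub_distrib,
      Pi.smul_apply, map_sum, map_mul, Finset.mul_sum]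
    simp only [mul_assoc] at h ⊢
    linear_combination h
  -- Cramer's rule for the column `i` splits the factor `X - ρ` off the determinant.
  have h2 : M.det * Polynomial.C (u i) =
      (Polynomial.X - Polynomial.C ρ) * (M.updateCol i Y).det := by
    have h3 : M.cramer (M *ᵥ U) i = M.det * U i := by
      rw [Matrix.cramer_eq_adjugate_mulVec, Matrix.mulVec_mulVec, Matrix.adjugate_mul,
        Matrix.smul_mulVec, Matrix.one_mulVec]
      rfl
    rw [h1, Matrix.cramer_apply, Matrix.det_updateCol_smul] at h3
    exact h3.symm
  have hM : M.det ≠ 0 := fun h => by rw [h, Polynomial.rootMultiplicity_zero] at hρ; omega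
  -- A further zero of the cofactor at `ρ` would make the root at least double.
  have h4 : (M.updateCol i Y).det.eval ρ ≠ 0 := fun h4 => by
    obtain ⟨q, hq⟩ := Polynomial.dvd_iff_isRoot.2 h4
    have h5 : (Polynomial.X - Polynomial.C ρ) ^ 2 ∣ M.det := by
      refine ⟨q * Polynomial.C (u i)⁻¹, ?_⟩
      have h6 : Polynomial.C (u i) * Polynomial.C (u i)⁻¹ = 1 := by
        rw [← Polynomial.C_mul, mul_inv_cancel₀ hi, Polynomial.C_1]
      rw [hq] at h2
      linear_combination Polynomial.C (u i)⁻¹ * h2 - M.det * h6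
    have := (Polynomial.le_rootMultiplicity_iff hM).2 h5
    omega
  have h7 : (M.updateCol i Y).det.eval ρ = ((ρ • V - Vᵀ).updateCol i (V *ᵥ u)).det := by
    rw [← Polynomial.coe_evalRingHom, RingHom.map_det]
    congr 1
    ext j k
    by_cases hk : k = i
    · subst hk
      simp [Y, Matrix.updateCol_self]
    · simp [M, Matrix.updateCol_ne hk, mul_comm (V j k) ρ]
  rw [h7] at h4
  -- Replacing column `i` does not affect the product with `w`, whose coordinate `i` vanishes. The
  -- new matrix is nonsingular and still kills `w`.
  refine Matrix.eq_zero_of_mulVec_eq_zero h4 ?_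
  rw [← hw]
  funext j
  simp only [Matrix.mulVec, dotProduct]
  refine Finset.sum_congr rfl fun k _ => ?_
  by_cases hk : k = i
  · rw [hk, hwi, mul_zero, mul_zero]
  · rw [Matrix.updateCol_ne hk]

/-- Pairing a kernel vector of the sum with `u` shows that it is annihilated by `q`. It then lies in
the kernel line of `A`, where `q` vanishes only at zero. -/
lemma det_add_rankOne_ne_zero {A : Matrix (Fin m) (Fin m) ℂ} (hA : A.IsHermitian)
    {u : Fin m → ℂ} (hu : A *ᵥ u = 0)
    (hker : ∀ w, A *ᵥ w = 0 → ∃ k : ℂ, w = k • u) {q : Fin m → ℝ} (hq : pairing q u ≠ 0) {r : ℂ}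
    (hr : r ≠ 0) : (A + r • rankOne q).det ≠ 0 := by
  intro hdet
  obtain ⟨w, hw0, hw⟩ := Matrix.exists_mulVec_eq_zero_iff.2 hdet
  rw [Matrix.add_mulVec, Matrix.smul_mulVec] at hw
  have h1 : star u ⬝ᵥ A *ᵥ w = 0 := by
    rw [Matrix.dotProduct_mulVec, ← hA.eq, ← Matrix.star_mulVec, hu]
    simp
  have h2 : star u ⬝ᵥ (A *ᵥ w + r • rankOne q *ᵥ w) = 0 := by rw [hw, dotProduct_zero]
  rw [dotProduct_add, h1, zero_add, dotProduct_smul, star_dotProduct_rankOne, smul_eq_mul,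
    mul_eq_zero, mul_eq_zero, star_eq_zero] at h2
  have h3 : pairing q w = 0 := (h2.resolve_left hr).resolve_left hq
  rw [rankOne_mulVec, h3, zero_smul, smul_zero, add_zero] at hw
  obtain ⟨k, rfl⟩ := hker w hw
  rw [map_smul, smul_eq_mul, mul_eq_zero] at h3
  exact hw0 (by rw [h3.resolve_right hq, zero_smul])

end pencil

lemma Knot.alexanderPolynomial_map (K : Knot) :
    K.alexanderPolynomial.map (Int.castRingHom ℂ) = ((Polynomial.X : ℂ[X]) •
      (K.seifertMatrix.map (Int.cast : ℤ → ℂ)).map Polynomial.C -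
      ((K.seifertMatrix.map (Int.cast : ℤ → ℂ)).map Polynomial.C)ᵀ).det := by
  rw [alexanderPolynomial, ← Polynomial.coe_mapRingHom, RingHom.map_det]
  congr 1
  ext1 i j
  simp

/-- A simple root of the pencil has a one-dimensional kernel. Its generator is a nonzero homology
class and flows through some band, and the rank one change at that crossing removes the kernel. -/
lemma Knot.IsSimple.exists_crossingChange {K : Knot} (hK : K.IsSimple) {ρ : Circle}
    (hρ : ρ ∈ K.div) : ∃ c, (K.diagram.crossingChange c).knot.alexander ρ ≠ 0 := by
  have hone : ρ ≠ 1 := fun h => K.one_notMem_div (h ▸ hρ)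
  obtain ⟨θ, hθ, rfl⟩ := Circle.exists_exp_eq_of_ne_one hone
  set D := K.diagram
  have hdet : (D.form θ).det = 0 := by
    by_contra h
    exact (K.alexanderAngle_ne_zero_iff' θ).1 ((K.alexanderAngle_ne_zero_iff θ).2 h) hρ
  obtain ⟨u, hu0, hu⟩ := Matrix.exists_mulVec_eq_zero_iff.2 hdet
  have hform : ∀ w, D.form θ *ᵥ w = 0 ↔
      (((Circle.exp θ : Circle) : ℂ) • K.seifertMatrix.map (Int.cast : ℤ → ℂ) -
        (K.seifertMatrix.map (Int.cast : ℤ → ℂ))ᵀ) *ᵥ w = 0 := fun w => by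
    rw [GaussCode.form_eq_smul, Matrix.smul_mulVec, smul_eq_zero_iff_right
      (mul_ne_zero (neg_ne_zero.2 Complex.I_ne_zero) (Complex.exp_ne_zero _)), Circle.coe_exp,
      mul_comm (θ : ℂ)]
    rfl
  have hmult := hK _ hρ
  rw [alexanderPolynomial_map] at hmult
  obtain ⟨i, hi⟩ := Function.ne_iff.1 hu0
  have hker : ∀ w, D.form θ *ᵥ w = 0 → ∃ k : ℂ, w = k • u := fun w hw => by
    refine ⟨w i / u i, ?_⟩
    rw [← sub_eq_zero]
    refine eq_zero_of_pencil_kernel _ hmult ((hform u).1 hu) ((hform _).1 ?_) hi ?_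
    · rw [Matrix.mulVec_sub, Matrix.mulVec_smul, hw, hu, smul_zero, sub_zero]
    · rw [Pi.sub_apply, Pi.smul_apply, smul_eq_mul, div_mul_cancel₀ _ hi, sub_self]
  obtain ⟨c, hc⟩ : ∃ c, pairing (D.flowVec c) u ≠ 0 := by
    by_contra! h
    exact hu0 (D.eq_zero_of_pairing_flowVec h)
  refine ⟨c, ?_⟩
  rw [← alexanderAngle_ne_zero_iff', (D.crossingChange c).alexanderAngle_ne_zero_iff hθ,
    D.det_form_crossingChange_ne_zero_iff]
  exact det_add_rankOne_ne_zero (D.form_isHermitian θ) hu hker hc (Complex.ofReal_ne_zero.2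
    (mul_ne_zero (sin_half_pos hθ).ne' (D.one_sub_two_mul_baseWeight_ne_zero c)))

lemma Knot.IsSimple.exists_isGoodProjection {K : Knot} (hK : K.IsSimple) {ρ : Circle}
    (hρ : ρ ∈ K.div) : ∃ (D : KnotDiagram) (c : Fin D.n), IsGoodProjection K ρ D c := by
  obtain ⟨c, hc⟩ := hK.exists_crossingChange hρ
  refine ⟨K.diagram, c, K.diagram_knot, ?_⟩
  rwa [KnotDiagram.withSign_neg_sign]

lemma IsGoodProjection.hasSignatureJump {K : Knot} {ρ : Circle} {D : KnotDiagram} {c : Fin D.n}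
    (h : IsGoodProjection K ρ D c) (hK : K.IsSimple) (hρ : ρ ∈ K.div) {θ : ℝ}
    (hθ : Circle.exp θ = ρ) :
    K.HasSignatureJump ρ (2 * ((D.sign c : ℤˣ) : ℤ) *
      signAt (D.withSign c 1).knot.alexanderAngle θ *
      signAt (D.withSign c (-1)).knot.alexanderAngle θ) := by
  obtain ⟨rfl, hgood⟩ := h
  rw [D.withSign_neg_sign] at hgood
  exact D.hasSignatureJump c hK hρ hgood hθ

/-- The skein formula on one good projection already forces the value to be the jump. Uniqueness of
the invariant thus reduces to uniqueness of limits. -/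
lemma SatisfiesSkein.hasSignatureJump {j : JumpInvariant} (hj : SatisfiesSkein j) (K : Knot)
    (hK : K.IsSimple) (ρ : K.div) : K.HasSignatureJump ρ (j K hK ρ) := by
  obtain ⟨D, c, h⟩ := hK.exists_isGoodProjection ρ.2
  have hθ := Circle.exp_arg (ρ : Circle)
  rw [hj K hK ρ D c h _ hθ]
  exact h.hasSignatureJump hK ρ.2 hθ

lemma Knot.IsSimple.exists_hasSignatureJump {K : Knot} (hK : K.IsSimple) (ρ : K.div) :
    ∃ v, K.HasSignatureJump ρ v := by
  obtain ⟨D, c, h⟩ := hK.exists_isGoodProjection ρ.2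
  exact ⟨_, h.hasSignatureJump hK ρ.2 (Circle.exp_arg (ρ : Circle))⟩

end

theorem theorem2p7 :
    (∃! j : JumpInvariant, SatisfiesSkein j) ∧
    (∀ j : JumpInvariant, SatisfiesSkein j →
      ∀ (K : Knot) (hK : K.IsSimple) (ρ : K.div), K.HasSignatureJump ρ (j K hK ρ)) ∧
    (∀ K : Knot, K.IsSimple → ∀ ρ : K.div,
      ∃ (D : KnotDiagram) (c : Fin D.n), IsGoodProjection K ρ D c) := by
  have hex : ∀ (K : Knot) (hK : K.IsSimple) (ρ : K.div), ∃ v, K.HasSignatureJump ρ v :=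
    fun K hK ρ => hK.exists_hasSignatureJump ρ
  choose j hj using hex
  refine ⟨⟨j, fun K hK ρ D c h θ hθ => (hj K hK ρ).unique (h.hasSignatureJump hK ρ.2 hθ),
    fun j' hj' => ?_⟩, fun j' hj' => hj'.hasSignatureJump,
    fun K hK ρ => hK.exists_isGoodProjection ρ.2⟩
  funext K hK ρ
  exact (hj'.hasSignatureJump K hK ρ).unique (hj K hK ρ)
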